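/- Let $M$ be a complex 3-manifold with a holomorphic volume form $\Upsilon$ (a nowhere vanishing holomorphic $(3,0)$-form). Let $F_{\mathbb C}\to M$ be the bundle whose fibre over $x$ consists of the complex linear isomorphisms $u:T_xM\to\mathbb C^3$ with $u^*(dz^1\wedge dz^2\wedge dz^3)=\Upsilon_x$, with the right action $u\cdot a=a^{-1}\circ u$ of $\mathrm{SU}(3)$; let $K=F_{\mathbb C}/\mathrm{SU}(3)$, a smooth 14-manifold, and let $\bar\pi_{\mathbb C}:K\to M$ be the projection. Let $\beta$ be the real 2-form on $K$ whose value at $[u]$ is $\frac{i}{2}\sum_{j=1}^3\eta^j\wedge\overline{\eta^j}$ with $\eta=u\circ\bar\pi_{\mathbb C}'$, and let $\mathcal K$ be the graded ideal of the ring of smooth differential forms on $K$ that is generated algebraically by $d\beta$. An integral element of $\mathcal K$ is a subspace $E\subset T_kK$ on which all forms of $\mathcal K$ vanish. Let $V_p(\mathcal K)\subset\mathrm{Gr}_p(TK)$ be the set of $p$-dimensional integral elements, and $V_p(\mathcal K,\bar\pi_{\mathbb C})$ the subset of those $E$ on which $\bar\pi_{\mathbb C}'$ is injective. For $E\in V_p(\mathcal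 K)$ the polar space $H(E)$ is the union of all integral elements that contain $E$; it is a linear space. The element $E$ is ordinary if, in a neighbourhood of $E$ in $\mathrm{Gr}_p(TK)$, the set $V_p(\mathcal K)$ is the common zero set of functions $\widehat\varphi_1,\dots,\widehat\varphi_q$ with linearly independent differentials, where $\varphi_1,\dots,\varphi_q\in\mathcal K$ are $p$-forms and $\widehat\varphi$ is defined by $\varphi|_{F}=\widehat\varphi(F)\,(dx^1\wedge\dots\wedge dx^p)|_F$ for local coordinates $x$ on $K$ with $(dx^1\wedge\dots\wedge dx^p)|_E\ne0$. It is regular if it is ordinary and $\dim H$ is constant on a neighbourhood of $E$ in $V_p(\mathcal K)$. Let $0\le p\le 6$ and $(m_0,\dots,m_6)=(14,14,13,11,8,6,6)$. Then: 1. $\dim H(E)\ge m_p$ for every $E\in V_p(\mathcal K,\bar\pi_{\mathbb C})$. 2. If $p\ne 3,4$, then $\dim H(E)=m_p$ for every $E\in V_p(\mathcal K,\bar\pi_{\mathbb C})$. 3. There is a dense open subset of $V_p(\mathcal K,\bar\pi_{\mathbb C})$ on which $\dim H(E)=m_p$. 4. Every $E\in V_p(\mathcal K,\bar\pi_{\mathbb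 C})$ with $\dim H(E)=m_p$ is regular. -/

import Mathlib

open Set Filter Topology
open scoped Manifold ContDiff Matrix TensorProduct

noncomputable section

namespace EDS

section Generic

variable {V : Type*} [NormedAddCommGroup V] [NormedSpace ℝ V]
variable {N : Type*} [TopologicalSpace N] [ChartedSpace V N]

/-- Degree `n` differential forms (no smoothness imposed) on a real manifold modelled on `V`. -/
abbrev DForm (V : Type*) [NormedAddCommGroup V] [NormedSpace ℝ V]
    (N : Type*) [TopologicalSpace N] [ChartedSpace V N] (n : ℕ) : Type _ :=
  ∀ x : N, (TangentSpace 𝓘(ℝ, V) x) [⋀^Fin n]→L[ℝ] ℝ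

/-- The derivative at `y` of the inverse of the preferred chart around `x₀`; it maps the
vector space `V` to the tangent space of `N` at the point with coordinates `y`. -/
def chartFrame (x₀ : N) (y : V) :
    V →L[ℝ] TangentSpace 𝓘(ℝ, V) ((chartAt V x₀).symm y) :=
  mfderiv 𝓘(ℝ, V) 𝓘(ℝ, V) (chartAt V x₀).symm y

/-- The expression of a differential form in the preferred chart around `x₀`. -/
def chartRep {n : ℕ} (θ : DForm V N n) (x₀ : N) (y : V) : V [⋀^Fin n]→L[ℝ] ℝ :=
  (θ ((chartAt V x₀).symm y)).compContinuousLinearMap (chartFrame x₀ y)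

/-- Smooth differential forms. -/
def IsSmoothForm {n : ℕ} (θ : DForm V N n) : Prop :=
  ∀ x₀ : N, ContDiffOn ℝ ∞ (chartRep θ x₀) (chartAt V x₀).target

/-- The exterior derivative, computed at `x` in the preferred chart around `x`. -/
def dForm {n : ℕ} (θ : DForm V N n) : DForm V N (n + 1) := fun x =>
  (extDeriv (chartRep θ x) (chartAt V x x)).compContinuousLinearMap
    (mfderiv 𝓘(ℝ, V) 𝓘(ℝ, V) (chartAt V x) x)

/-- The wedge product of two alternating forms (the sum over shuffles); the total degree `m` is
kept as a variable equal to `k + n`. -/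
def wedgeAlt {W : Type*} [AddCommGroup W] [Module ℝ W] [TopologicalSpace W] {k n m : ℕ}
    (h : k + n = m) (α : W [⋀^Fin k]→L[ℝ] ℝ) (φ : W [⋀^Fin n]→L[ℝ] ℝ) :
    W [⋀^Fin m]→L[ℝ] ℝ :=
  { ((LinearMap.mul' ℝ ℝ).compAlternatingMap
      (α.toAlternatingMap.domCoprod φ.toAlternatingMap)).domDomCongr
        (finSumFinEquiv.trans (finCongr h)) with
    cont := by
      change Continuous fun v : Fin m → W => LinearMap.mul' ℝ ℝ
        ((∑ σ : Equiv.Perm.ModSumCongr (Fin k) (Fin n),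
          AlternatingMap.domCoprod.summand α.toAlternatingMap φ.toAlternatingMap σ)
          fun i => v ((finSumFinEquiv.trans (finCongr h)) i))
      simp only [sum_apply, map_sum]
      refine continuous_finsetSum _ fun σ _ => ?_
      induction σ using Quotient.inductionOn' with | _ σ
      have h₁ : Continuous fun v : Fin m → W => α fun i : Fin k =>
          v ((finSumFinEquiv.trans (finCongr h)) (σ (Sum.inl i))) :=
        α.cont.comp (continuous_pi fun i => continuous_apply _)
      have h₂ : Continuous fun v : Fin m → W => φ fun i : Fin n =>
          v ((finSumFinEquiv.trans (finCongr h)) (σ (Sum.inr i))) :=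
        φ.cont.comp (continuous_pi fun i => continuous_apply _)
      have h₃ := (h₁.mul h₂).const_smul (Equiv.Perm.sign σ : ℤ)
      refine h₃.congr fun v => ?_
      change _ = LinearMap.mul' ℝ ℝ ((Equiv.Perm.sign σ : ℤ) •
        ((α fun i : Fin k => v ((finSumFinEquiv.trans (finCongr h)) (σ (Sum.inl i)))) ⊗ₜ[ℝ]
          (φ fun i : Fin n => v ((finSumFinEquiv.trans (finCongr h)) (σ (Sum.inr i))))))
      rw [map_zsmul, LinearMap.mul'_apply]
      rfl }

/-- The wedge product of two differential forms. -/
def wedge {k n m : ℕ} (h : k + n = m) (α : DForm V N k) (φ : DForm V N n) : DForm V N m :=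
  fun x => wedgeAlt h (α x) (φ x)

/-- A family of sets of forms, one in each degree: for instance a graded ideal of `Ω^*(N)`. -/
abbrev FormFamily (V : Type*) [NormedAddCommGroup V] [NormedSpace ℝ V]
    (N : Type*) [TopologicalSpace N] [ChartedSpace V N] : Type _ :=
  ∀ n : ℕ, Set (DForm V N n)

/-- The graded ideal of the ring `Ω^*(N)` of smooth forms generated algebraically by a family `S`
of homogeneous smooth forms: the smallest family that contains `S` and `0` and is closed under
addition and under wedge products with smooth forms. -/
inductive IdealGen (S : FormFamily V N) : ∀ n : ℕ, DForm V N n → Prop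
  | gen {n : ℕ} (φ : DForm V N n) (hφ : φ ∈ S n) : IdealGen S n φ
  | zero (n : ℕ) : IdealGen S n 0
  | add {n : ℕ} {φ ψ : DForm V N n} (hφ : IdealGen S n φ) (hψ : IdealGen S n ψ) :
      IdealGen S n (φ + ψ)
  | wedge {k n m : ℕ} (h : k + n = m) (α : DForm V N k) (hα : IsSmoothForm α)
      {φ : DForm V N n} (hφ : IdealGen S n φ) : IdealGen S m (EDS.wedge h α φ)

/-- The graded ideal generated by `S`, as a family of sets of forms. -/
def idealGen (S : FormFamily V N) : FormFamily V N := fun n => {φ | IdealGen S n φ}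

/-- The family whose only member is the form `φ`, of degree `n`. -/
inductive singleForm {n : ℕ} (φ : DForm V N n) : ∀ m : ℕ, DForm V N m → Prop
  | self : singleForm φ n φ

/-- The graded ideal generated by a single form. -/
def principalIdeal {n : ℕ} (φ : DForm V N n) : FormFamily V N :=
  idealGen fun m => {ψ | singleForm φ m ψ}

/-- A subspace `P` of the tangent space at `x` is an integral element of `I` when every form of
`I` vanishes on `P`. -/
def IsIntegral (I : FormFamily V N) (x : N) (P : Submodule ℝ (TangentSpace 𝓘(ℝ, V) x)) : Prop :=
  ∀ n : ℕ, ∀ ψ ∈ I n, ∀ v : Fin n → TangentSpace 𝓘(ℝ, V) x, (∀ i, v i ∈ P) → ψ x v = 0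

/-- The Grassmann bundle `Gr_p(TN)`: pairs of a point of `N` and a `p`-dimensional subspace of
the tangent space there. -/
structure TangentPlane (V : Type*) [NormedAddCommGroup V] [NormedSpace ℝ V]
    (N : Type*) [TopologicalSpace N] [ChartedSpace V N] (p : ℕ) where
  base : N
  plane : Submodule ℝ (TangentSpace 𝓘(ℝ, V) base)
  finrank_plane : Module.finrank ℝ plane = p

lemma chartFrame_injective [IsManifold 𝓘(ℝ, V) ∞ N] (x₀ : N) {y : V}
    (hy : y ∈ (chartAt V x₀).target) : Function.Injective (chartFrame (N := N) x₀ y) := by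
  have : IsManifold 𝓘(ℝ, V) 1 N := IsManifold.of_le (n := ∞) (by norm_cast)
  exact (mdifferentiable_chart (I := 𝓘(ℝ, V)) x₀).symm.mfderiv_injective hy

lemma finrank_span_of_injective {T : Type*} [AddCommGroup T] [Module ℝ T] [TopologicalSpace T]
    {p : ℕ} (L : V →L[ℝ] T) (hL : Function.Injective L) {v : Fin p → V}
    (hv : LinearIndependent ℝ v) :
    Module.finrank ℝ (Submodule.span ℝ (range fun i => L (v i))) = p := by
  have h : LinearIndependent ℝ fun i => L (v i) :=
    hv.map' (L : V →ₗ[ℝ] T) (LinearMap.ker_eq_bot.2 hL)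
  simpa using finrank_span_eq_card h

/-- The coordinate description of frames: a point `y` of the target of the preferred chart
around `x₀` and `p` linearly independent vectors of `V`. -/
abbrev ChartFrames (N : Type*) [TopologicalSpace N] [ChartedSpace V N] (p : ℕ) (x₀ : N) :
    Type _ :=
  {w : V × (Fin p → V) // w.1 ∈ (chartAt V x₀).target ∧ LinearIndependent ℝ w.2}

/-- The `p`-plane spanned by a frame that is given in coordinates. -/
def planeOfFrame [IsManifold 𝓘(ℝ, V) ∞ N] {p : ℕ} (x₀ : N) (w : ChartFrames (V := V) N p x₀) :
    TangentPlane V N p where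
  base := (chartAt V x₀).symm w.1.1
  plane := Submodule.span ℝ (range fun i => chartFrame x₀ w.1.1 (w.1.2 i))
  finrank_plane :=
    finrank_span_of_injective (chartFrame x₀ w.1.1) (chartFrame_injective x₀ w.2.1) w.2.2

/-- The topology of the Grassmann bundle: the quotient topology from the bundle of `p`-frames
(the finest topology for which all the maps `planeOfFrame x₀` are continuous). -/
instance TangentPlane.instTopologicalSpace [IsManifold 𝓘(ℝ, V) ∞ N] (p : ℕ) :
    TopologicalSpace (TangentPlane V N p) :=
  ⨆ x₀ : N, TopologicalSpace.coinduced (planeOfFrame x₀) inferInstance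

/-- `V_p(I)`: the set of `p`-dimensional integral elements of `I`. -/
def integralElements (I : FormFamily V N) (p : ℕ) : Set (TangentPlane V N p) :=
  {E | IsIntegral I E.base E.plane}

/-- The polar space `H(E)`: the union of all the integral elements of `I` that contain `E`. -/
def polarSet (I : FormFamily V N) {p : ℕ} (E : TangentPlane V N p) :
    Set (TangentSpace 𝓘(ℝ, V) E.base) :=
  {v | ∃ P : Submodule ℝ (TangentSpace 𝓘(ℝ, V) E.base), IsIntegral I E.base P ∧ E.plane ≤ P ∧ v ∈ P}

/-- The dimension of the polar space `H(E)`. (The polar space of an integral element is a linear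
subspace, so that taking the span adds nothing.) -/
def polarDim (I : FormFamily V N) {p : ℕ} (E : TangentPlane V N p) : ℕ :=
  Module.finrank ℝ (Submodule.span ℝ (polarSet I E))

/-- The extension rank `r(E) = dim H(E) - p - 1`. -/
def extensionRank (I : FormFamily V N) {p : ℕ} (E : TangentPlane V N p) : ℤ :=
  (polarDim I E : ℤ) - p - 1

/-- Graph coordinates on the Grassmann bundle. Choose a basis `b` of `V`; it gives
coordinates `x¹, …, x^p, x^{p+1}, …` around `x₀` (the preferred chart, followed by the coordinates
with respect to `b`). A `p`-plane on which `dx¹ ∧ ⋯ ∧ dx^p` is not zero, at the point with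
coordinates `y`, has a unique basis of the form `∂ᵢ + ∑ⱼ A i j ∂_{p+j}`, and `(y, A)` are its
coordinates. This is that basis. -/
def graphBasis {p m : ℕ} (b : Module.Basis (Fin p ⊕ Fin m) ℝ V) (x₀ : N)
    (w : V × (Fin p → Fin m → ℝ)) (i : Fin p) :
    TangentSpace 𝓘(ℝ, V) ((chartAt V x₀).symm w.1) :=
  chartFrame x₀ w.1 (b (Sum.inl i) + ∑ j, w.2 i j • b (Sum.inr j))

/-- The function `φ̂` on the domain of graph coordinates that a `p`-form `φ` defines by
`φ|_F = φ̂(F) (dx¹ ∧ ⋯ ∧ dx^p)|_F`: the value of `φ` on the basis of `F` that is dual to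
`dx¹, …, dx^p`. -/
def graphFun {p m : ℕ} (b : Module.Basis (Fin p ⊕ Fin m) ℝ V) (x₀ : N) (φ : DForm V N p)
    (w : V × (Fin p → Fin m → ℝ)) : ℝ :=
  φ ((chartAt V x₀).symm w.1) (graphBasis b x₀ w)

/-- An integral element `E` is ordinary when, near `E` in `Gr_p(TN)`, the set of integral elements
is the common zero set of finitely many functions `φ̂₁, …, φ̂_q`, with `φ₁, …, φ_q` of degree `p`
in the ideal, whose differentials are linearly independent. Here `b` is a basis of `V` whose first
`p` vectors span `E`, so that `E` is the plane with graph coordinates `(x(z), 0)`. -/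
def IsOrdinary (I : FormFamily V N) {p : ℕ} (E : TangentPlane V N p) : Prop :=
  E ∈ integralElements I p ∧
  ∃ (m : ℕ) (b : Module.Basis (Fin p ⊕ Fin m) ℝ V) (q : ℕ) (φ : Fin q → DForm V N p)
    (W : Set (V × (Fin p → Fin m → ℝ))),
    (∀ v : TangentSpace 𝓘(ℝ, V) E.base, v ∈ E.plane ↔
      mfderiv 𝓘(ℝ, V) 𝓘(ℝ, V) (chartAt V E.base) E.base v ∈
        Submodule.span ℝ (range fun i : Fin p => b (Sum.inl i))) ∧
    (∀ i, φ i ∈ I p) ∧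
    IsOpen W ∧ (chartAt V E.base E.base, 0) ∈ W ∧ (∀ w ∈ W, w.1 ∈ (chartAt V E.base).target) ∧
    (∀ w ∈ W, LinearIndependent ℝ fun i => fderiv ℝ (graphFun b E.base (φ i)) w) ∧
    ∀ w ∈ W,
      IsIntegral I ((chartAt V E.base).symm w.1)
          (Submodule.span ℝ (range (graphBasis b E.base w))) ↔
        ∀ i, graphFun b E.base (φ i) w = 0

/-- An integral element `E` is regular when it is ordinary and the extension rank is locally
constant on `V_p(I)` near `E`. -/
def IsRegular [IsManifold 𝓘(ℝ, V) ∞ N] (I : FormFamily V N) {p : ℕ} (E : TangentPlane V N p) :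
    Prop :=
  IsOrdinary I E ∧
    ∀ᶠ F in 𝓝[integralElements I p] E, extensionRank I F = extensionRank I E

end Generic

section SU3Bundle

/-- The model space `ℂ³` of complex 3-manifolds. -/
abbrev C3 : Type := Fin 3 → ℂ

/-- The model space of the 14-dimensional manifold `F_ℂ / SU(3)`. -/
abbrev KModel : Type := C3 × (ℝ × ℝ × ℂ × ℂ × ℂ)

variable {M : Type*} [TopologicalSpace M] [ChartedSpace C3 M]

/-- The coordinate vector field `∂/∂zᵢ` of the preferred chart around `x₀`, at the point `x`:
the complex tangent vector that the derivative of the chart maps to the `i`-th standard vector. -/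
def coordVec (x₀ x : M) (i : Fin 3) : TangentSpace 𝓘(ℂ, C3) x :=
  (mfderiv 𝓘(ℂ, C3) 𝓘(ℂ, C3) (chartAt C3 x₀) x).inverse (Pi.single i 1 : C3)

/-- Holomorphic volume forms: nowhere vanishing holomorphic `(3,0)`-forms. -/
structure HolVolumeForm (M : Type*) [TopologicalSpace M] [ChartedSpace C3 M] where
  toFun : ∀ x : M, (TangentSpace 𝓘(ℂ, C3) x) [⋀^Fin 3]→ₗ[ℂ] ℂ
  ne_zero : ∀ x, toFun x ≠ 0
  holomorphic : ∀ x₀ : M, ContDiffOn ℂ ω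
    (fun z => toFun ((chartAt C3 x₀).symm z) (coordVec x₀ ((chartAt C3 x₀).symm z)))
    (chartAt C3 x₀).target

/-- The fibre over `x` of the bundle `F_ℂ`: the complex linear isomorphisms `u : T_x M → ℂ³` that
are volume preserving, `u^*(dz¹ ∧ dz² ∧ dz³) = Υ_x`. -/
def Coframe (Υ : HolVolumeForm M) (x : M) : Type :=
  {u : TangentSpace 𝓘(ℂ, C3) x ≃ₗ[ℂ] C3 //
    ∀ v : Fin 3 → TangentSpace 𝓘(ℂ, C3) x,
      Matrix.det (Matrix.of fun i j => u (v j) i) = Υ.toFun x v}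

/-- Two coframes over `x` are equivalent when they lie in one orbit of the right action
`u · a = a⁻¹ ∘ u` of `SU(3)`. -/
def su3Setoid (Υ : HolVolumeForm M) (x : M) : Setoid (Coframe Υ x) where
  r u u' := ∃ a ∈ Matrix.specialUnitaryGroup (Fin 3) ℂ, ∀ v, u'.1 v = a⁻¹ *ᵥ u.1 v
  iseqv := by
    have hdet : ∀ a ∈ Matrix.specialUnitaryGroup (Fin 3) ℂ, IsUnit (Matrix.det a) := by
      intro a ha
      rw [(Matrix.mem_specialUnitaryGroup_iff.1 ha).2]
      exact isUnit_one
    have hinv : ∀ a ∈ Matrix.specialUnitaryGroup (Fin 3) ℂ, a⁻¹ = star a := by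
      intro a ha
      exact Matrix.inv_eq_left_inv
        (Matrix.mem_unitaryGroup_iff'.1 (Matrix.mem_specialUnitaryGroup_iff.1 ha).1)
    refine ⟨fun u => ⟨1, one_mem _, fun v => by simp⟩, ?_, ?_⟩
    · rintro u u' ⟨a, ha, h⟩
      refine ⟨star a, Matrix.mem_specialUnitaryGroup_iff.2
        ⟨Unitary.star_mem (Matrix.mem_specialUnitaryGroup_iff.1 ha).1, by
          rw [Matrix.star_eq_conjTranspose, Matrix.det_conjTranspose,
            (Matrix.mem_specialUnitaryGroup_iff.1 ha).2, star_one]⟩, fun v => ?_⟩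
      rw [h, Matrix.mulVec_mulVec, ← hinv a ha, Matrix.nonsing_inv_mul _ (by
        rw [Matrix.isUnit_nonsing_inv_det_iff]; exact hdet a ha), Matrix.one_mulVec]
    · rintro u u' u'' ⟨a, ha, h⟩ ⟨b, hb, h'⟩
      refine ⟨a * b, mul_mem ha hb, fun v => ?_⟩
      rw [h', h, Matrix.mulVec_mulVec, Matrix.mul_inv_rev]

/-- The quotient bundle `K = F_ℂ / SU(3)`. -/
def SU3Bundle (Υ : HolVolumeForm M) : Type _ :=
  Σ x : M, Quotient (su3Setoid Υ x)

/-- The projection `π̄_ℂ : K → M`. -/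
def SU3Bundle.proj {Υ : HolVolumeForm M} (k : SU3Bundle Υ) : M := k.1

lemma su3_dot {a : Matrix (Fin 3) (Fin 3) ℂ} (ha : a ∈ Matrix.specialUnitaryGroup (Fin 3) ℂ)
    (v w : C3) : star (a⁻¹ *ᵥ v) ⬝ᵥ (a⁻¹ *ᵥ w) = star v ⬝ᵥ w := by
  have hu := (Matrix.mem_specialUnitaryGroup_iff.1 ha).1
  have hinv : a⁻¹ = star a := Matrix.inv_eq_left_inv (Matrix.mem_unitaryGroup_iff'.1 hu)
  rw [hinv, Matrix.star_mulVec, Matrix.star_eq_conjTranspose, Matrix.conjTranspose_conjTranspose,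
    ← Matrix.dotProduct_mulVec, Matrix.mulVec_mulVec, ← Matrix.star_eq_conjTranspose,
    Matrix.mem_unitaryGroup_iff.1 hu, Matrix.one_mulVec]

/-- The Hermitian inner product on `T_x M` that a point `[u]` of `K` over `x` determines by
pulling back the standard one of `ℂ³` by `u`. -/
def SU3Bundle.herm {Υ : HolVolumeForm M} (k : SU3Bundle Υ)
    (v w : TangentSpace 𝓘(ℂ, C3) k.1) : ℂ :=
  Quotient.lift (s := su3Setoid Υ k.1) (fun u : Coframe Υ k.1 => star (u.1 v) ⬝ᵥ u.1 w)
    (by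
      rintro u u' ⟨a, ha, h⟩
      simp only [h, su3_dot ha]) k.2

/-- The domain of the local coordinates of `K` over the preferred chart of `M` around `x₀`. -/
def SU3Bundle.chartSource (Υ : HolVolumeForm M) (x₀ : M) : Set (SU3Bundle Υ) :=
  {k | k.1 ∈ (chartAt C3 x₀).source}

/-- The local coordinates of `K` over the preferred chart of `M` around `x₀`: the coordinates `z`
of the base point, and the entries `h₀₀, h₁₁, h₀₁, h₀₂, h₁₂` of the Hermitian matrix
`h i j = ⟨∂ᵢ, ∂ⱼ⟩`. The last entry `h₂₂` is determined by these and by `det h = |Υ(∂₀, ∂₁, ∂₂)|²`. -/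
def SU3Bundle.chartFun (Υ : HolVolumeForm M) (x₀ : M) (k : SU3Bundle Υ) : KModel :=
  (chartAt C3 x₀ k.1,
    (k.herm (coordVec x₀ k.1 0) (coordVec x₀ k.1 0)).re,
    (k.herm (coordVec x₀ k.1 1) (coordVec x₀ k.1 1)).re,
    k.herm (coordVec x₀ k.1 0) (coordVec x₀ k.1 1),
    k.herm (coordVec x₀ k.1 0) (coordVec x₀ k.1 2),
    k.herm (coordVec x₀ k.1 1) (coordVec x₀ k.1 2))

/-- The range of the local coordinates of `K`: the leading principal minors of the
Hermitian matrix are positive. -/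
def chartRange (x₀ : M) : Set KModel :=
  {w | w.1 ∈ (chartAt C3 x₀).target ∧ 0 < w.2.1 ∧
    Complex.normSq w.2.2.2.1 < w.2.1 * w.2.2.1}

/-- The Hermitian matrix with given determinant `|f|²` whose entries other than the last diagonal
one are given. -/
def gramMat (f : ℂ) (w : ℝ × ℝ × ℂ × ℂ × ℂ) : Matrix (Fin 3) (Fin 3) ℂ :=
  !![(w.1 : ℂ), w.2.2.1, w.2.2.2.1;
     star w.2.2.1, (w.2.1 : ℂ), w.2.2.2.2;
     star w.2.2.2.1, star w.2.2.2.2,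
      (star f * f - w.2.2.1 * w.2.2.2.2 * star w.2.2.2.1 - star w.2.2.1 * star w.2.2.2.2 * w.2.2.2.1
        + w.1 * (w.2.2.2.2 * star w.2.2.2.2) + w.2.1 * (w.2.2.2.1 * star w.2.2.2.1)) /
        ((w.1 * w.2.1 - Complex.normSq w.2.2.1 : ℝ) : ℂ)]

lemma gram_eq {f : ℂ} {w : ℝ × ℝ × ℂ × ℂ × ℂ} (hw : Complex.normSq w.2.2.1 < w.1 * w.2.1)
    {U : Matrix (Fin 3) (Fin 3) ℂ} (hU : U.det = f)
    (h00 : ((Uᴴ * U) 0 0).re = w.1) (h11 : ((Uᴴ * U) 1 1).re = w.2.1)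
    (h01 : (Uᴴ * U) 0 1 = w.2.2.1) (h02 : (Uᴴ * U) 0 2 = w.2.2.2.1)
    (h12 : (Uᴴ * U) 1 2 = w.2.2.2.2) : Uᴴ * U = gramMat f w := by
  have hH : (Uᴴ * U).IsHermitian := Matrix.isHermitian_conjTranspose_mul_self U
  have hdet : (Uᴴ * U).det = star f * f := by
    rw [Matrix.det_mul, Matrix.det_conjTranspose, hU]
  generalize Uᴴ * U = G at *
  have g00 : G 0 0 = (w.1 : ℂ) := by
    rw [← h00]; exact (Complex.conj_eq_iff_re.1 (hH.apply 0 0)).symm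
  have g11 : G 1 1 = (w.2.1 : ℂ) := by
    rw [← h11]; exact (Complex.conj_eq_iff_re.1 (hH.apply 1 1)).symm
  have g10 : G 1 0 = star w.2.2.1 := by rw [← h01]; exact (hH.apply 1 0).symm
  have g20 : G 2 0 = star w.2.2.2.1 := by rw [← h02]; exact (hH.apply 2 0).symm
  have g21 : G 2 1 = star w.2.2.2.2 := by rw [← h12]; exact (hH.apply 2 1).symm
  have hpos : ((w.1 * w.2.1 - Complex.normSq w.2.2.1 : ℝ) : ℂ) ≠ 0 := by
    exact_mod_cast (sub_pos.2 hw).ne'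
  have g22 : G 2 2 = gramMat f w 2 2 := by
    simp only [gramMat, Matrix.of_apply, Matrix.cons_val]
    rw [eq_div_iff hpos, ← hdet, Matrix.det_fin_three, g00, g11, g10, g20, g21, h01, h02, h12]
    push_cast
    rw [Complex.normSq_eq_conj_mul_self]
    simp only [Complex.star_def]
    ring
  ext i j
  fin_cases i <;> fin_cases j <;> first | exact g22 | simpa [gramMat] using by assumption

lemma exists_gram {f : ℂ} (hf : f ≠ 0) {w : ℝ × ℝ × ℂ × ℂ × ℂ} (h0 : 0 < w.1)
    (hw : Complex.normSq w.2.2.1 < w.1 * w.2.1) :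
    ∃ U : Matrix (Fin 3) (Fin 3) ℂ, U.det = f ∧ ((Uᴴ * U) 0 0).re = w.1 ∧
      ((Uᴴ * U) 1 1).re = w.2.1 ∧ (Uᴴ * U) 0 1 = w.2.2.1 ∧ (Uᴴ * U) 0 2 = w.2.2.2.1 ∧
      (Uᴴ * U) 1 2 = w.2.2.2.2 := by
  obtain ⟨a, b, c, d, e⟩ := w
  simp only at h0 hw ⊢
  have hδ : 0 < b - Complex.normSq c / a := by
    rw [sub_pos, div_lt_iff₀ h0]; linarith
  obtain ⟨s, hs, hsa⟩ : ∃ s : ℝ, 0 < s ∧ s * s = a :=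
    ⟨√a, Real.sqrt_pos.2 h0, Real.mul_self_sqrt h0.le⟩
  obtain ⟨t, ht, htb⟩ : ∃ t : ℝ, 0 < t ∧ t * t = b - Complex.normSq c / a :=
    ⟨√_, Real.sqrt_pos.2 hδ, Real.mul_self_sqrt hδ.le⟩
  have hs' : (s : ℂ) ≠ 0 := by exact_mod_cast hs.ne'
  have ht' : (t : ℂ) ≠ 0 := by exact_mod_cast ht.ne'
  refine ⟨!![(s : ℂ), c / s, d / s; 0, (t : ℂ), (e - star c * d / (s * s)) / t;
    0, 0, f / (s * t)], ?_, ?_, ?_, ?_, ?_, ?_⟩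
  · simp [Matrix.det_fin_three]
    field_simp
  · simp [Matrix.mul_apply, Fin.sum_univ_three, hsa]
  · have : b = Complex.normSq c / (s * s) + t * t := by rw [htb, hsa]; ring
    rw [this]
    simp [Matrix.mul_apply, Fin.sum_univ_three]
    rw [Complex.normSq_apply]
    field_simp
    ring
  · simp [Matrix.mul_apply, Fin.sum_univ_three]
    field_simp
  · simp [Matrix.mul_apply, Fin.sum_univ_three]
    field_simp
  · simp [Matrix.mul_apply, Fin.sum_univ_three]
    field_simp
    ring

/-- The matrix of a coframe with respect to the coordinate vectors. -/
def Coframe.mat {Υ : HolVolumeForm M} {x : M} (u : Coframe Υ x) (x₀ : M) :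
    Matrix (Fin 3) (Fin 3) ℂ :=
  Matrix.of fun i j => u.1 (coordVec x₀ x j) i

lemma Coframe.det_mat {Υ : HolVolumeForm M} {x : M} (u : Coframe Υ x) (x₀ : M) :
    (u.mat x₀).det = Υ.toFun x (coordVec x₀ x) := u.2 _

lemma herm_mk {Υ : HolVolumeForm M} {x : M} (u : Coframe Υ x) (x₀ : M) (i j : Fin 3) :
    SU3Bundle.herm (Υ := Υ) ⟨x, Quotient.mk _ u⟩ (coordVec x₀ x i) (coordVec x₀ x j)
      = ((u.mat x₀)ᴴ * u.mat x₀) i j := rfl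

lemma chartFun_gram {Υ : HolVolumeForm M} {x₀ x : M} (u : Coframe Υ x) {w : KModel}
    (hw : w ∈ chartRange x₀) (h : SU3Bundle.chartFun Υ x₀ ⟨x, Quotient.mk _ u⟩ = w) :
    (u.mat x₀)ᴴ * u.mat x₀ = gramMat (Υ.toFun x (coordVec x₀ x)) w.2 := by
  simp only [SU3Bundle.chartFun, herm_mk] at h
  subst h
  exact gram_eq hw.2.2 (u.det_mat x₀) rfl rfl rfl rfl rfl

lemma isOpen_trans_source (x₀ x₁ : M) :
    IsOpen (chartRange x₀ ∩ {w | (chartAt C3 x₀).symm w.1 ∈ (chartAt C3 x₁).source}) := by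
  have h1 : IsOpen ((chartAt C3 x₀).symm.trans (chartAt C3 x₁)).source :=
    ((chartAt C3 x₀).symm.trans (chartAt C3 x₁)).open_source
  have h2 : IsOpen {w : KModel | 0 < w.2.1 ∧ Complex.normSq w.2.2.2.1 < w.2.1 * w.2.2.1} :=
    IsOpen.inter (isOpen_lt (f := fun _ : KModel => (0 : ℝ)) (g := fun w : KModel => w.2.1)
      continuous_const (by fun_prop))
      (isOpen_lt (f := fun w : KModel => Complex.normSq w.2.2.2.1)
        (g := fun w : KModel => w.2.1 * w.2.2.1)
        (Complex.continuous_normSq.comp (by fun_prop)) (by fun_prop))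
  convert! (h1.preimage (continuous_fst (X := C3) (Y := ℝ × ℝ × ℂ × ℂ × ℂ))).inter h2 using 1
  ext w
  simp only [chartRange, mem_inter_iff, mem_ofPred_eq, mem_preimage,
    OpenPartialHomeomorph.trans_source, OpenPartialHomeomorph.symm_source]
  tauto

section Charts

variable [IsManifold 𝓘(ℂ, C3) ω M]

lemma isManifold_one : IsManifold 𝓘(ℂ, C3) 1 M := IsManifold.of_le (n := ω) le_top

/-- The derivative of the preferred chart around `x₀` at `x`. -/
def chartDeriv {x₀ x : M} (hx : x ∈ (chartAt C3 x₀).source) :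
    TangentSpace 𝓘(ℂ, C3) x ≃L[ℂ] C3 :=
  have : IsManifold 𝓘(ℂ, C3) 1 M := isManifold_one
  (mdifferentiable_chart (I := 𝓘(ℂ, C3)) x₀).mfderiv hx

lemma coordVec_eq {x₀ x : M} (hx : x ∈ (chartAt C3 x₀).source) (i : Fin 3) :
    coordVec x₀ x i = (chartDeriv hx).symm (Pi.single i 1) := by
  have : mfderiv 𝓘(ℂ, C3) 𝓘(ℂ, C3) (chartAt C3 x₀) x
      = (chartDeriv hx : TangentSpace 𝓘(ℂ, C3) x →L[ℂ] C3) := rfl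
  rw [coordVec, this]
  exact congrArg (fun L : C3 →L[ℂ] TangentSpace 𝓘(ℂ, C3) x => L (Pi.single i 1))
    (ContinuousLinearMap.inverse_equiv (chartDeriv hx))

/-- The coordinate vectors form a basis. -/
def coordBasis {x₀ x : M} (hx : x ∈ (chartAt C3 x₀).source) :
    Module.Basis (Fin 3) ℂ (TangentSpace 𝓘(ℂ, C3) x) :=
  Module.Basis.ofEquivFun (chartDeriv hx).toLinearEquiv

lemma coordBasis_coe {x₀ x : M} (hx : x ∈ (chartAt C3 x₀).source) :
    ⇑(coordBasis hx) = coordVec x₀ x := by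
  ext1 i
  rw [coordVec_eq hx, coordBasis, Module.Basis.coe_ofEquivFun]
  rfl

lemma vol_coordVec_ne_zero (Υ : HolVolumeForm M) {x₀ x : M}
    (hx : x ∈ (chartAt C3 x₀).source) : Υ.toFun x (coordVec x₀ x) ≠ 0 := by
  rw [← coordBasis_coe hx]
  exact (AlternatingMap.map_basis_ne_zero_iff (coordBasis hx) (Υ.toFun x)).2 (Υ.ne_zero x)

lemma exists_coframe (Υ : HolVolumeForm M) {x₀ x : M} (hx : x ∈ (chartAt C3 x₀).source)
    {U : Matrix (Fin 3) (Fin 3) ℂ} (hU : U.det = Υ.toFun x (coordVec x₀ x)) :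
    ∃ u : Coframe Υ x, u.mat x₀ = U := by
  have hdet : IsUnit U.det := by
    rw [hU]; exact (vol_coordVec_ne_zero Υ hx).isUnit
  have hinv : Invertible U := Matrix.invertibleOfIsUnitDet U hdet
  let T : C3 ≃ₗ[ℂ] C3 := Matrix.toLinearEquiv' U hinv
  have hT : ∀ v, T v = U *ᵥ v := fun v => rfl
  refine ⟨⟨(chartDeriv hx).toLinearEquiv.trans T, fun v => ?_⟩, ?_⟩
  · have h1 := (Υ.toFun x).eq_smul_basis_det (coordBasis hx)
    have h2 : (Matrix.of fun i j => ((chartDeriv hx).toLinearEquiv.trans T) (v j) i)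
        = U * (coordBasis hx).toMatrix v := by
      ext i j
      rfl
    rw [h2, Matrix.det_mul, hU]
    conv_rhs => rw [h1]
    rw [coordBasis_coe hx]
    rfl
  · ext i j
    change T (chartDeriv hx (coordVec x₀ x j)) i = _
    rw [coordVec_eq hx, ContinuousLinearEquiv.apply_symm_apply, hT]
    simp

lemma coframe_equiv {Υ : HolVolumeForm M} {x₀ x : M} (hx : x ∈ (chartAt C3 x₀).source)
    (u u' : Coframe Υ x) (h : (u.mat x₀)ᴴ * u.mat x₀ = (u'.mat x₀)ᴴ * u'.mat x₀) :
    (Quotient.mk (su3Setoid Υ x) u) = Quotient.mk (su3Setoid Υ x) u' := by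
  have hd : ∀ w : Coframe Υ x, IsUnit (w.mat x₀).det := fun w => by
    rw [w.det_mat]; exact (vol_coordVec_ne_zero Υ hx).isUnit
  set U := u.mat x₀ with hU
  set U' := u'.mat x₀ with hU'
  have hdd : U.det = U'.det := by rw [hU, hU', u.det_mat, u'.det_mat]
  have hUu := hd u
  have hUu' := hd u'
  rw [← hU] at hUu
  rw [← hU'] at hUu'
  have hUc : IsUnit U'ᴴ.det := by
    rw [Matrix.det_conjTranspose]; exact hUu'.star
  have ha : (U * U'⁻¹)ᴴ * (U * U'⁻¹) = 1 := by
    rw [Matrix.conjTranspose_mul, Matrix.mul_assoc, ← Matrix.mul_assoc Uᴴ, h,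
      Matrix.mul_assoc U'ᴴ, Matrix.mul_nonsing_inv _ hUu', Matrix.mul_one,
      Matrix.conjTranspose_nonsing_inv, Matrix.nonsing_inv_mul _ hUc]
  refine Quotient.sound ⟨U * U'⁻¹, Matrix.mem_specialUnitaryGroup_iff.2
    ⟨Matrix.mem_unitaryGroup_iff'.2 ha, ?_⟩, ?_⟩
  · rw [Matrix.det_mul, Matrix.det_nonsing_inv, hdd, Ring.mul_inverse_cancel _ hUu']
  · have hmul : (U * U'⁻¹)⁻¹ * U = U' := by
      rw [Matrix.mul_inv_rev, Matrix.nonsing_inv_nonsing_inv _ hUu', Matrix.mul_assoc,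
        Matrix.nonsing_inv_mul _ hUu, Matrix.mul_one]
    intro v
    have key : (u'.1 : TangentSpace 𝓘(ℂ, C3) x →ₗ[ℂ] C3)
        = (Matrix.mulVecLin (U * U'⁻¹)⁻¹) ∘ₗ (u.1 : TangentSpace 𝓘(ℂ, C3) x →ₗ[ℂ] C3) := by
      refine (coordBasis hx).ext fun j => ?_
      rw [coordBasis_coe hx]
      ext i
      exact (congrFun (congrFun hmul i) j).symm
    exact congrArg (fun L : TangentSpace 𝓘(ℂ, C3) x →ₗ[ℂ] C3 => L v) key

open scoped ComplexOrder in
lemma chartFun_mapsTo (Υ : HolVolumeForm M) (x₀ : M) :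
    MapsTo (SU3Bundle.chartFun Υ x₀) (SU3Bundle.chartSource Υ x₀) (chartRange x₀) := by
  rintro ⟨x, q⟩ (hx : x ∈ (chartAt C3 x₀).source)
  induction q using Quotient.inductionOn with | _ u
  refine ⟨(chartAt C3 x₀).map_source hx, ?_⟩
  have hunit : IsUnit (u.mat x₀) := by
    rw [Matrix.isUnit_iff_isUnit_det, u.det_mat]
    exact (vol_coordVec_ne_zero Υ hx).isUnit
  have hP : ((u.mat x₀)ᴴ * u.mat x₀).PosDef :=
    Matrix.PosDef.conjTranspose_mul_self _ (Matrix.mulVec_injective_of_isUnit hunit)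
  simp only [SU3Bundle.chartFun, herm_mk]
  generalize (u.mat x₀)ᴴ * u.mat x₀ = G at hP
  have h0 := hP.diag_pos (i := 0)
  have hS : (G.submatrix ![0, 1] ![0, 1]).PosDef :=
    hP.submatrix (by decide)
  have hd := hS.det_pos
  have hH := hP.isHermitian
  have g00 : G 0 0 = ((G 0 0).re : ℂ) := (Complex.conj_eq_iff_re.1 (hH.apply 0 0)).symm
  have g11 : G 1 1 = ((G 1 1).re : ℂ) := (Complex.conj_eq_iff_re.1 (hH.apply 1 1)).symm
  rw [Matrix.det_fin_two] at hd
  simp only [Matrix.submatrix_apply, Matrix.cons_val_zero, Matrix.cons_val_one] at hd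
  rw [← hH.apply 1 0, g00, g11, Complex.star_def, Complex.mul_conj] at hd
  rw [g00] at h0
  refine ⟨by exact_mod_cast h0, ?_⟩
  have : (0 : ℝ) < (G 0 0).re * (G 1 1).re - Complex.normSq (G 0 1) := by exact_mod_cast hd
  simpa using sub_pos.1 this

lemma chartFun_injOn (Υ : HolVolumeForm M) (x₀ : M) :
    InjOn (SU3Bundle.chartFun Υ x₀) (SU3Bundle.chartSource Υ x₀) := by
  rintro ⟨x, q⟩ (hx : x ∈ (chartAt C3 x₀).source) ⟨x', q'⟩ (hx' : x' ∈ (chartAt C3 x₀).source) h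
  obtain rfl : x = x' := (chartAt C3 x₀).injOn hx hx' (congrArg Prod.fst h)
  induction q using Quotient.inductionOn with | _ u
  induction q' using Quotient.inductionOn with | _ u'
  have hm := chartFun_mapsTo Υ x₀ (x := ⟨x, Quotient.mk _ u⟩) hx
  rw [coframe_equiv hx u u' ((chartFun_gram u hm rfl).trans (chartFun_gram u' hm h.symm).symm)]

lemma chartFun_surjOn (Υ : HolVolumeForm M) (x₀ : M) :
    SurjOn (SU3Bundle.chartFun Υ x₀) (SU3Bundle.chartSource Υ x₀) (chartRange x₀) := by
  rintro ⟨z, w⟩ ⟨hz, h0, hw⟩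
  have hx : (chartAt C3 x₀).symm z ∈ (chartAt C3 x₀).source := (chartAt C3 x₀).map_target hz
  obtain ⟨U, hU, h1, h2, h3, h4, h5⟩ := exists_gram (vol_coordVec_ne_zero Υ hx) h0 hw
  obtain ⟨u, rfl⟩ := exists_coframe Υ hx hU
  refine ⟨⟨_, Quotient.mk _ u⟩, hx, ?_⟩
  simp only [SU3Bundle.chartFun, herm_mk, h1, h2, h3, h4, h5, (chartAt C3 x₀).right_inv hz]

lemma chartFun_bijOn (Υ : HolVolumeForm M) (x₀ : M) :
    BijOn (SU3Bundle.chartFun Υ x₀) (SU3Bundle.chartSource Υ x₀) (chartRange x₀) :=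
  ⟨chartFun_mapsTo Υ x₀, chartFun_injOn Υ x₀, chartFun_surjOn Υ x₀⟩

lemma SU3Bundle.nonempty (Υ : HolVolumeForm M) (x : M) : Nonempty (SU3Bundle Υ) := by
  obtain ⟨k, -⟩ := chartFun_surjOn Υ x
    (a := (chartAt C3 x x, 1, 1, 0, 0, 0)) ⟨(chartAt C3 x).map_source (mem_chart_source C3 x), by
      simp, by simp⟩
  exact ⟨k⟩

/-- The local coordinates of `K` over the preferred chart of `M` around `x₀`. -/
def SU3Bundle.chart (Υ : HolVolumeForm M) (x₀ : M) : PartialEquiv (SU3Bundle Υ) KModel :=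
  have := SU3Bundle.nonempty Υ x₀
  (chartFun_bijOn Υ x₀).toPartialEquiv

lemma chartDeriv_apply {x₀ x : M} (hx : x ∈ (chartAt C3 x₀).source) (v : C3) :
    chartDeriv hx v = tangentCoordChange 𝓘(ℂ, C3) x x₀ x v := by
  have : IsManifold 𝓘(ℂ, C3) 1 M := isManifold_one
  exact congrArg (fun L : C3 →L[ℂ] C3 => L v)
    (mfderiv_chartAt_eq_tangentCoordChange (I := 𝓘(ℂ, C3)) hx)

/-- The Jacobian matrix, at `z`, of the change of coordinates of `M` from the chart around `x₁` to
the chart around `x₀`. -/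
def jacMat (x₀ x₁ : M) (z : C3) : Matrix (Fin 3) (Fin 3) ℂ :=
  Matrix.of fun i j => fderiv ℂ (chartAt C3 x₀ ∘ (chartAt C3 x₁).symm)
    (chartAt C3 x₁ ((chartAt C3 x₀).symm z)) (Pi.single j 1) i

lemma Coframe.mat_change {Υ : HolVolumeForm M} {x₀ x₁ x : M}
    (hx : x ∈ (chartAt C3 x₀).source) (hx₁ : x ∈ (chartAt C3 x₁).source) (u : Coframe Υ x) :
    u.mat x₁ = u.mat x₀ * jacMat x₀ x₁ (chartAt C3 x₀ x) := by
  have : IsManifold 𝓘(ℂ, C3) 1 M := isManifold_one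
  have key : ∀ j i, chartDeriv hx (coordVec x₁ x j) i = jacMat x₀ x₁ (chartAt C3 x₀ x) i j := by
    intro j i
    have hc : coordVec x₁ x j = tangentCoordChange 𝓘(ℂ, C3) x₁ x x (Pi.single j 1) := by
      refine (coordVec_eq hx₁ j).trans ((chartDeriv hx₁).symm_apply_eq.2 ?_)
      refine Eq.trans ?_ (chartDeriv_apply hx₁ _).symm
      rw [tangentCoordChange_comp, tangentCoordChange_self]
      · simpa using hx₁
      · simpa using hx₁
    rw [hc]
    have := chartDeriv_apply hx (tangentCoordChange 𝓘(ℂ, C3) x₁ x x (Pi.single j 1))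
    refine (congrFun this i).trans ?_
    rw [tangentCoordChange_comp (by simpa using ⟨hx₁, hx⟩), tangentCoordChange_def]
    simp [jacMat, fderivWithin_univ, extChartAt, OpenPartialHomeomorph.extend,
      (chartAt C3 x₀).left_inv hx]
  ext i j
  have hsum := (coordBasis hx).sum_equivFun (coordVec x₁ x j)
  have h2 : coordVec x₁ x j
      = ∑ l, jacMat x₀ x₁ (chartAt C3 x₀ x) l j • coordVec x₀ x l := by
    rw [← hsum, coordBasis_coe hx]
    refine Finset.sum_congr rfl fun l _ => ?_
    rw [← key j l]
    rfl
  change u.1 (coordVec x₁ x j) i = _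
  rw [h2, map_sum, Finset.sum_apply, Matrix.mul_apply]
  refine Finset.sum_congr rfl fun l _ => ?_
  rw [map_smul, Pi.smul_apply, smul_eq_mul, mul_comm]
  rfl

/-- The change of local coordinates of `K`. -/
def transFun (Υ : HolVolumeForm M) (x₀ x₁ : M) (w : KModel) : KModel :=
  let f : ℂ := Υ.toFun ((chartAt C3 x₀).symm w.1) (coordVec x₀ ((chartAt C3 x₀).symm w.1))
  let G := (jacMat x₀ x₁ w.1)ᴴ * gramMat f w.2 * jacMat x₀ x₁ w.1
  (chartAt C3 x₁ ((chartAt C3 x₀).symm w.1), (G 0 0).re, (G 1 1).re, G 0 1, G 0 2, G 1 2)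

lemma chart_trans_source (Υ : HolVolumeForm M) (x₀ x₁ : M) :
    ((SU3Bundle.chart Υ x₀).symm.trans (SU3Bundle.chart Υ x₁)).source
      = chartRange x₀ ∩ {w | (chartAt C3 x₀).symm w.1 ∈ (chartAt C3 x₁).source} := by
  ext w
  rw [PartialEquiv.trans_source]
  refine and_congr_right fun (hw : w ∈ chartRange x₀) => ?_
  have h1 : SU3Bundle.chart Υ x₀ ((SU3Bundle.chart Υ x₀).symm w) = w :=
    (SU3Bundle.chart Υ x₀).right_inv hw
  have h2 : (SU3Bundle.chart Υ x₀).symm w ∈ SU3Bundle.chartSource Υ x₀ :=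
    (SU3Bundle.chart Υ x₀).map_target hw
  have h3 : (chartAt C3 x₀).symm w.1 = ((SU3Bundle.chart Υ x₀).symm w).1 := by
    conv_lhs => rw [← h1]
    exact (chartAt C3 x₀).left_inv h2
  simp only [mem_ofPred_eq, h3]
  rfl

lemma chart_trans_eq (Υ : HolVolumeForm M) (x₀ x₁ : M) {w : KModel}
    (hw : w ∈ chartRange x₀) (hw' : (chartAt C3 x₀).symm w.1 ∈ (chartAt C3 x₁).source) :
    SU3Bundle.chart Υ x₁ ((SU3Bundle.chart Υ x₀).symm w) = transFun Υ x₀ x₁ w := by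
  have h1 : SU3Bundle.chart Υ x₀ ((SU3Bundle.chart Υ x₀).symm w) = w :=
    (SU3Bundle.chart Υ x₀).right_inv hw
  have h2 : (SU3Bundle.chart Υ x₀).symm w ∈ SU3Bundle.chartSource Υ x₀ :=
    (SU3Bundle.chart Υ x₀).map_target hw
  generalize (SU3Bundle.chart Υ x₀).symm w = k at h1 h2
  obtain ⟨x, q⟩ := k
  obtain rfl : (chartAt C3 x₀).symm w.1 = x := by
    conv_lhs => rw [← h1]
    exact (chartAt C3 x₀).left_inv h2
  induction q using Quotient.inductionOn with | _ u
  have hg := chartFun_gram u hw h1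
  change SU3Bundle.chartFun Υ x₁ _ = _
  simp only [SU3Bundle.chartFun, herm_mk, transFun, Coframe.mat_change
    ((chartAt C3 x₀).map_target hw.1) hw' u, (chartAt C3 x₀).right_inv hw.1, ← hg,
    Matrix.conjTranspose_mul, Matrix.mul_assoc]

lemma contDiffOn_transFun (Υ : HolVolumeForm M) (x₀ x₁ : M) :
    ContDiffOn ℝ ∞ (transFun Υ x₀ x₁)
      (chartRange x₀ ∩ {w | (chartAt C3 x₀).symm w.1 ∈ (chartAt C3 x₁).source}) := by
  set s : Set KModel :=
    chartRange x₀ ∩ {w | (chartAt C3 x₀).symm w.1 ∈ (chartAt C3 x₁).source} with hs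
  set t : Set C3 := ((chartAt C3 x₀).symm.trans (chartAt C3 x₁)).source with ht
  have hst : MapsTo (Prod.fst : KModel → C3) s t := fun w hw => ⟨hw.1.1, hw.2⟩
  have hcoord : ∀ y₀ y₁ : M, ContDiffOn ℂ ω (chartAt C3 y₁ ∘ (chartAt C3 y₀).symm)
      ((chartAt C3 y₀).symm.trans (chartAt C3 y₁)).source := by
    intro y₀ y₁
    have := contDiffOn_ext_coord_change (I := 𝓘(ℂ, C3)) (n := ω) y₁ y₀
    simpa [extChartAt, OpenPartialHomeomorph.extend] using this
  have hre : ∀ {F : Type} [NormedAddCommGroup F] [NormedSpace ℂ F] {g : C3 → F},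
      ContDiffOn ℂ ω g t → ContDiffOn ℝ ∞ (fun w : KModel => g w.1) s := by
    intro F _ _ g hg
    have h1 : ContDiffOn ℝ ω g t := hg.restrict_scalars ℝ
    exact (h1.of_le le_top).comp contDiff_fst.contDiffOn hst
  have hbase : ContDiffOn ℝ ∞
      (fun w : KModel => chartAt C3 x₁ ((chartAt C3 x₀).symm w.1)) s := hre (hcoord x₀ x₁)
  have hf : ContDiffOn ℝ ∞ (fun w : KModel => Υ.toFun ((chartAt C3 x₀).symm w.1)
      (coordVec x₀ ((chartAt C3 x₀).symm w.1))) s :=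
    hre ((Υ.holomorphic x₀).mono fun z hz => hz.1)
  have hJ : ∀ i j, ContDiffOn ℝ ∞ (fun w : KModel => jacMat x₀ x₁ w.1 i j) s := by
    intro i j
    refine hre (g := fun z => jacMat x₀ x₁ z i j) ?_
    have h1 : ContDiffOn ℂ ω (fderiv ℂ (chartAt C3 x₀ ∘ (chartAt C3 x₁).symm))
        ((chartAt C3 x₁).symm.trans (chartAt C3 x₀)).source :=
      (hcoord x₁ x₀).fderiv_of_isOpen
        ((chartAt C3 x₁).symm.trans (chartAt C3 x₀)).open_source le_top
    have h2 : MapsTo (chartAt C3 x₁ ∘ (chartAt C3 x₀).symm) t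
        ((chartAt C3 x₁).symm.trans (chartAt C3 x₀)).source := by
      intro z hz
      have hz1 : z ∈ (chartAt C3 x₀).target := hz.1
      have hz2 : (chartAt C3 x₀).symm z ∈ (chartAt C3 x₁).source := hz.2
      refine ⟨(chartAt C3 x₁).map_source hz2, ?_⟩
      change (chartAt C3 x₁).symm (chartAt C3 x₁ ((chartAt C3 x₀).symm z)) ∈ (chartAt C3 x₀).source
      rw [(chartAt C3 x₁).left_inv hz2]
      exact (chartAt C3 x₀).map_target hz1
    have h3 := h1.comp (hcoord x₀ x₁) h2
    have h4 := h3.clm_apply (contDiffOn_const (c := (Pi.single j 1 : C3)))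
    exact (contDiffOn_pi.1 h4) i
  have hstar : ∀ {g : KModel → ℂ}, ContDiffOn ℝ ∞ g s → ContDiffOn ℝ ∞ (fun w => star (g w)) s :=
    fun hg => Complex.conjCLE.contDiff.comp_contDiffOn hg
  have hofReal : ∀ {g : KModel → ℝ}, ContDiffOn ℝ ∞ g s →
      ContDiffOn ℝ ∞ (fun w => (g w : ℂ)) s :=
    fun hg => Complex.ofRealCLM.contDiff.comp_contDiffOn hg
  have hreal : ∀ {g : KModel → ℂ}, ContDiffOn ℝ ∞ g s → ContDiffOn ℝ ∞ (fun w => (g w).re) s :=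
    fun hg => Complex.reCLM.contDiff.comp_contDiffOn hg
  have ha : ContDiffOn ℝ ∞ (fun w : KModel => w.2.1) s := by fun_prop
  have hb : ContDiffOn ℝ ∞ (fun w : KModel => w.2.2.1) s := by fun_prop
  have hc : ContDiffOn ℝ ∞ (fun w : KModel => w.2.2.2.1) s := by fun_prop
  have hd : ContDiffOn ℝ ∞ (fun w : KModel => w.2.2.2.2.1) s := by fun_prop
  have he : ContDiffOn ℝ ∞ (fun w : KModel => w.2.2.2.2.2) s := by fun_prop
  have hn : ContDiffOn ℝ ∞ (fun w : KModel => Complex.normSq w.2.2.2.1) s := by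
    simp only [Complex.normSq_apply]
    exact (hreal hc).mul (hreal hc) |>.add
      ((Complex.imCLM.contDiff.comp_contDiffOn hc).mul (Complex.imCLM.contDiff.comp_contDiffOn hc))
  have hG : ∀ i j, ContDiffOn ℝ ∞ (fun w : KModel =>
      gramMat (Υ.toFun ((chartAt C3 x₀).symm w.1) (coordVec x₀ ((chartAt C3 x₀).symm w.1)))
        w.2 i j) s := by
    intro i j
    fin_cases i <;> fin_cases j
    · exact hofReal ha
    · exact hc
    · exact hd
    · exact hstar hc
    · exact hofReal hb
    · exact he
    · exact hstar hd
    · exact hstar he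
    · refine ContDiffOn.mul ?_ (ContDiffOn.inv (hofReal ((ha.mul hb).sub hn)) ?_)
      · exact (((((hstar hf).mul hf).sub ((hc.mul he).mul (hstar hd))).sub
          (((hstar hc).mul (hstar he)).mul hd)).add ((hofReal ha).mul (he.mul (hstar he)))).add
          ((hofReal hb).mul (hd.mul (hstar hd)))
      · intro w hw
        exact_mod_cast (sub_pos.2 hw.1.2.2).ne'
  have hfin : ∀ i j, ContDiffOn ℝ ∞ (fun w : KModel =>
      ((jacMat x₀ x₁ w.1)ᴴ *
        gramMat (Υ.toFun ((chartAt C3 x₀).symm w.1) (coordVec x₀ ((chartAt C3 x₀).symm w.1))) w.2 *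
        jacMat x₀ x₁ w.1) i j) s := by
    intro i j
    simp only [Matrix.mul_apply, Matrix.conjTranspose_apply]
    exact ContDiffOn.sum fun l _ =>
      (ContDiffOn.sum fun l' _ => (hstar (hJ l' i)).mul (hG l' l)).mul (hJ l j)
  exact hbase.prodMk ((hreal (hfin 0 0)).prodMk ((hreal (hfin 1 1)).prodMk
    ((hfin 0 1).prodMk ((hfin 0 2).prodMk (hfin 1 2)))))

/-- The atlas of `K`, whose changes of coordinates are smooth. It is the manifold structure of the
quotient `F_ℂ / SU(3)`: `h` is a smooth function of `u`, the functions `h i j` separate the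
`SU(3)`-orbits, and `u` can be recovered from `h`, up to `SU(3)`, by a smooth local section. -/
def SU3Bundle.core (Υ : HolVolumeForm M) : ChartedSpaceCore KModel (SU3Bundle Υ) where
  atlas := range (SU3Bundle.chart Υ)
  chartAt k := SU3Bundle.chart Υ k.1
  mem_chart_source k := mem_chart_source C3 k.1
  chart_mem_atlas k := mem_range_self _
  open_source := by
    rintro _ _ ⟨x₀, rfl⟩ ⟨x₁, rfl⟩
    rw [chart_trans_source]
    exact isOpen_trans_source x₀ x₁
  continuousOn_toFun := by
    rintro _ _ ⟨x₀, rfl⟩ ⟨x₁, rfl⟩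
    rw [chart_trans_source]
    exact (contDiffOn_transFun Υ x₀ x₁).continuousOn.congr fun w hw =>
      chart_trans_eq Υ x₀ x₁ hw.1 hw.2

/-- The topology of `K`. -/
instance SU3Bundle.instTopologicalSpace (Υ : HolVolumeForm M) : TopologicalSpace (SU3Bundle Υ) :=
  (SU3Bundle.core Υ).toTopologicalSpace

/-- The manifold structure of `K`. -/
instance SU3Bundle.instChartedSpace (Υ : HolVolumeForm M) : ChartedSpace KModel (SU3Bundle Υ) :=
  (SU3Bundle.core Υ).toChartedSpace

instance SU3Bundle.instIsManifold (Υ : HolVolumeForm M) :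
    IsManifold 𝓘(ℝ, KModel) ∞ (SU3Bundle Υ) := by
  refine isManifold_of_contDiffOn _ _ _ ?_
  intro e e' he he'
  simp only [atlas, ChartedSpace.atlas, mem_iUnion, mem_singleton_iff] at he he'
  obtain ⟨_, ⟨x₀, rfl⟩, rfl⟩ := he
  obtain ⟨_, ⟨x₁, rfl⟩, rfl⟩ := he'
  have hsrc := chart_trans_source Υ x₀ x₁
  have h := (contDiffOn_transFun Υ x₀ x₁).congr fun w hw => chart_trans_eq Υ x₀ x₁ hw.1 hw.2
  rw [← hsrc] at h
  simp only [modelWithCornersSelf_coe, modelWithCornersSelf_coe_symm, Function.comp_id,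
    Function.id_comp, preimage_id_eq, id, range_id, inter_univ]
  exact h

/-- The standard Kähler form `(i/2) ∑ⱼ dzʲ ∧ dz̄ʲ` of `ℂ³`. (It is real valued.) -/
def stdKahler : C3 [⋀^Fin 2]→L[ℝ] ℝ where
  toFun v := (Complex.I / 2 * ∑ j, (v 0 j * star (v 1 j) - v 1 j * star (v 0 j))).re
  map_update_add' := by
    intro _ v i x y
    fin_cases i <;> simp [Fin.sum_univ_three] <;> ring
  map_update_smul' := by
    intro _ v i c x
    fin_cases i <;> simp [Fin.sum_univ_three] <;> ring
  map_eq_zero_of_eq' := by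
    intro v i j h hij
    fin_cases i <;> fin_cases j <;> simp_all
  cont := by
    fun_prop

/-- A coframe as a real linear map. (The real and the complex tangent space of `M` at `x` are the
same space, identified with the model space by the same chart.) -/
def Coframe.real {Υ : HolVolumeForm M} {x : M} (u : Coframe Υ x) :
    TangentSpace 𝓘(ℝ, C3) x →L[ℝ] C3 :=
  let u' : C3 →ₗ[ℂ] C3 := u.1.toLinearMap
  (LinearMap.toContinuousLinearMap u').restrictScalars ℝ

/-- The derivative of the projection `π̄_ℂ : K → M`. -/
def projDeriv {Υ : HolVolumeForm M} (k : SU3Bundle Υ) :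
    TangentSpace 𝓘(ℝ, KModel) k →L[ℝ] TangentSpace 𝓘(ℝ, C3) k.1 :=
  mfderiv 𝓘(ℝ, KModel) 𝓘(ℝ, C3) SU3Bundle.proj k

lemma stdKahler_comp {a : Matrix (Fin 3) (Fin 3) ℂ}
    (ha : a ∈ Matrix.specialUnitaryGroup (Fin 3) ℂ) {W : Type*} [AddCommGroup W] [Module ℝ W]
    [TopologicalSpace W] (L L' : W →L[ℝ] C3) (h : ∀ v, L' v = a⁻¹ *ᵥ L v) :
    stdKahler.compContinuousLinearMap L = stdKahler.compContinuousLinearMap L' := by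
  have key : ∀ (T : W →L[ℝ] C3) (v : Fin 2 → W), stdKahler.compContinuousLinearMap T v =
      (Complex.I / 2 * (star (T (v 1)) ⬝ᵥ T (v 0) - star (T (v 0)) ⬝ᵥ T (v 1))).re := by
    intro T v
    simp only [dotProduct, ← Finset.sum_sub_distrib]
    change (Complex.I / 2 *
      ∑ j, (T (v 0) j * star (T (v 1) j) - T (v 1) j * star (T (v 0) j))).re = _
    congr 3
    ext j
    simp only [Pi.star_apply]
    ring
  ext v
  rw [key, key, h, h, su3_dot ha, su3_dot ha]

/-- The 2-form `β = (i/2) ∑ⱼ ηʲ ∧ η̄ʲ` on `K`: at the point `[u]` it is the pullback of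
`(i/2) ∑ⱼ dzʲ ∧ dz̄ʲ` by `η = u ∘ π̄_ℂ'`, which is the same for all `u` in an `SU(3)`-orbit. -/
def betaForm (Υ : HolVolumeForm M) : DForm KModel (SU3Bundle Υ) 2 := fun k =>
  Quotient.lift (s := su3Setoid Υ k.1)
    (fun u : Coframe Υ k.1 => stdKahler.compContinuousLinearMap (u.real.comp (projDeriv k)))
    (by
      rintro u u' ⟨a, ha, h⟩
      exact stdKahler_comp ha _ _ fun v => h _) k.2

/-- The ideal `𝒦` on `K` generated by `dβ`. -/
def idealK (Υ : HolVolumeForm M) : FormFamily KModel (SU3Bundle Υ) :=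
  principalIdeal (dForm (betaForm Υ))

/-- A `p`-plane tangent to `K` is `π̄_ℂ`-transverse when the derivative of the projection
`π̄_ℂ : K → M` is injective on it. -/
def IsTransverse {Υ : HolVolumeForm M} {p : ℕ} (E : TangentPlane KModel (SU3Bundle Υ) p) : Prop :=
  InjOn (projDeriv E.base) E.plane

/-- `V_p(𝒦, π̄_ℂ)`: the set of `π̄_ℂ`-transverse `p`-dimensional integral elements of `𝒦`. -/
def transverseElements (Υ : HolVolumeForm M) (p : ℕ) :
    Set (TangentPlane KModel (SU3Bundle Υ) p) :=
  {E | E ∈ integralElements (idealK Υ) p ∧ IsTransverse E}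

end Charts

end SU3Bundle
end EDS
end

noncomputable section

namespace EDS

/-! ### Changes of chart, naturality of the exterior derivative, integral elements of a principal
ideal -/

section Generic

variable {V : Type*} [NormedAddCommGroup V] [NormedSpace ℝ V]
variable {N : Type*} [TopologicalSpace N] [ChartedSpace V N]

/-! In local coordinates a point of `K` over `x` is a positive Hermitian form `h` on the tangent
space with `det h = |Υ|²`, and `β` is the imaginary part of `h`, pulled back from `M`. Hence
`dβ(u,v,w) = σ(κu)(v,w) + σ(κv)(w,u) + σ(κw)(u,v)`, where `κ` is the derivative of `h` and
`σ(B)(x,z) = Im(x* B z)` sees only horizontal components. On the eight-dimensional vertical space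
`κ` is an isomorphism onto the Hermitian `B` with `tr(adj(h) B) = 0`, and this space is
complementary to each line spanned by `r r*`, because `r* adj(h) r ≠ 0`. `IsModel` records these
facts, `isModel_dBeta` proves them, and the rest is linear algebra, semicontinuity and a submersion
argument.

Polar spaces. `H(E)` is the kernel of the map sending `v` to the values of `dβ(v,·,·)` on pairs from
a frame of `E`. For a complex basis `e₀, e₁, e₂`, all coefficients of `κ` of a vertical vector other
than the one at `(e₀,e₀)` can be prescribed: eight real parameters. For `p ≤ 3` the pairs impose
independent conditions on vertical vectors. For `p = 4` there are at most six conditions, and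
exactly six for the frame `ie₀, e₁, ie₁, e₂`, hence for generic frames. For `p = 5` the horizontal
part of `E` is a real hyperplane of `ℂ³`, spanned by some `ie₀, e₁, ie₁, e₂, ie₂`. Since `σ(B)` has
type `(1,1)`, the ten pairs impose eight independent vertical conditions, and the absence of a
`(3,0)` part in `dβ` makes the other two consistent when `E` is integral. So `H(E)` is complementary
to the vertical space and has dimension 6. For `p = 6`, `E` contains such a 5-plane, whence `H(E) =
E`.

Regularity. The values of `dβ` on triples of frame vectors are, up to constants, functions `φ̂` of
forms `α ∧ dβ`. Moving the last vector of a triple vertically changes its value by a vertical 2-form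
on the first two vectors and leaves triples with smaller last index alone, so the differentials are
independent by triangularity (`linearIndependent_fderiv_tripFun`). For `p = 6` two triples must be
omitted, and their vanishing follows from the others (`IsModel.vanishesOn_span_iff_trip_six`). The
dimension of `H` is upper semicontinuous and `m_p` is its least value on the open set of transverse
planes, so it is locally constant wherever it equals `m_p`.

Density is an issue only for `p = 4`. The map from frames to their horizontal parts and test values
is a submersion, so nearby horizontal frames lift to integral frames
(`IsModel.eventually_exists_lift`). The good horizontal frames contain the nonvanishing locus of a
nonzero analytic function (`dense_verticalSurj`). -/

lemma mdifferentiableAt_chartAt_symm [IsManifold 𝓘(ℝ, V) ∞ N] (x₀ : N) {y : V}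
    (hy : y ∈ (chartAt V x₀).target) :
    MDifferentiableAt 𝓘(ℝ, V) 𝓘(ℝ, V) (chartAt V x₀).symm y := by
  have : IsManifold 𝓘(ℝ, V) 1 N := IsManifold.of_le (n := ∞) (by norm_cast)
  exact (mdifferentiable_chart (I := 𝓘(ℝ, V)) x₀).mdifferentiableAt_symm hy

lemma mdifferentiableAt_chartAt [IsManifold 𝓘(ℝ, V) ∞ N] (x₀ : N) {x : N}
    (hx : x ∈ (chartAt V x₀).source) :
    MDifferentiableAt 𝓘(ℝ, V) 𝓘(ℝ, V) (chartAt V x₀) x := by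
  have : IsManifold 𝓘(ℝ, V) 1 N := IsManifold.of_le (n := ∞) (by norm_cast)
  exact (mdifferentiable_chart (I := 𝓘(ℝ, V)) x₀).mdifferentiableAt hx

/-- The change of coordinates from the preferred chart around `x₁` to the one around `x₀`. -/
def chartTrans (V : Type*) [NormedAddCommGroup V] {N : Type*} [TopologicalSpace N]
    [ChartedSpace V N] (x₀ x₁ : N) : V → V :=
  chartAt V x₀ ∘ (chartAt V x₁).symm

lemma contDiffOn_chartTrans [IsManifold 𝓘(ℝ, V) ∞ N] (x₀ x₁ : N) :
    ContDiffOn ℝ ∞ (chartTrans V x₀ x₁) ((chartAt V x₁).symm.trans (chartAt V x₀)).source := by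
  have := contDiffOn_ext_coord_change (I := 𝓘(ℝ, V)) (n := ∞) x₀ x₁
  simpa [extChartAt, OpenPartialHomeomorph.extend, chartTrans] using this

lemma chartFrame_trans [IsManifold 𝓘(ℝ, V) ∞ N] (x₀ x₁ : N) {y : V}
    (hy : y ∈ ((chartAt V x₁).symm.trans (chartAt V x₀)).source) :
    (chartFrame x₁ y : V →L[ℝ] V) =
      (chartFrame x₀ (chartTrans V x₀ x₁ y) : V →L[ℝ] V).comp
        (fderiv ℝ (chartTrans V x₀ x₁) y) := by
  have hy1 : y ∈ (chartAt V x₁).target := hy.1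
  have hy2 : (chartAt V x₁).symm y ∈ (chartAt V x₀).source := hy.2
  have hd : DifferentiableAt ℝ (chartTrans V x₀ x₁) y :=
    ((contDiffOn_chartTrans x₀ x₁).contDiffAt
      ((((chartAt V x₁).symm.trans (chartAt V x₀)).open_source).mem_nhds hy)).differentiableAt
      (by norm_num)
  have hev : (chartAt V x₁).symm =ᶠ[𝓝 y] (chartAt V x₀).symm ∘ chartTrans V x₀ x₁ := by
    filter_upwards [(((chartAt V x₁).symm.trans (chartAt V x₀)).open_source).mem_nhds hy]
      with z hz
    exact ((chartAt V x₀).left_inv hz.2).symm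
  have h1 := hev.mfderiv_eq (I := 𝓘(ℝ, V)) (I' := 𝓘(ℝ, V))
  have h2 := mfderiv_comp (I := 𝓘(ℝ, V)) (I' := 𝓘(ℝ, V)) (I'' := 𝓘(ℝ, V)) y
    (mdifferentiableAt_chartAt_symm x₀ (y := chartTrans V x₀ x₁ y)
      ((chartAt V x₀).map_source hy2)) hd.mdifferentiableAt
  rw [mfderiv_eq_fderiv] at h2
  exact h1.trans h2

lemma chartRep_trans [IsManifold 𝓘(ℝ, V) ∞ N] {n : ℕ} (θ : DForm V N n) (x₀ x₁ : N) {y : V}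
    (hy : y ∈ ((chartAt V x₁).symm.trans (chartAt V x₀)).source) :
    chartRep θ x₁ y = (chartRep θ x₀ (chartTrans V x₀ x₁ y)).compContinuousLinearMap
        (fderiv ℝ (chartTrans V x₀ x₁) y) := by
  have h := chartFrame_trans x₀ x₁ hy
  have hp : (chartAt V x₀).symm (chartTrans V x₀ x₁ y) = (chartAt V x₁).symm y :=
    (chartAt V x₀).left_inv hy.2
  -- All tangent spaces are copies of `V`; forgetting the dependence on the point permits rewriting
  -- the point.
  let θ' : N → V [⋀^Fin n]→L[ℝ] ℝ := θ
  change (θ' ((chartAt V x₁).symm y)).compContinuousLinearMap (chartFrame x₁ y : V →L[ℝ] V) =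
    ((θ' ((chartAt V x₀).symm (chartTrans V x₀ x₁ y))).compContinuousLinearMap
      (chartFrame x₀ (chartTrans V x₀ x₁ y) : V →L[ℝ] V)).compContinuousLinearMap _
  rw [hp, h]
  rfl

lemma mfderiv_chartAt_comp_chartFrame [IsManifold 𝓘(ℝ, V) ∞ N] (x₀ : N) {y : V}
    (hy : y ∈ (chartAt V x₀).target) (v : V) :
    (mfderiv 𝓘(ℝ, V) 𝓘(ℝ, V) (chartAt V x₀) ((chartAt V x₀).symm y) (chartFrame x₀ y v) : V)
      = v := by
  have : IsManifold 𝓘(ℝ, V) 1 N := IsManifold.of_le (n := ∞) (by norm_cast)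
  have h := (mdifferentiable_chart (I := 𝓘(ℝ, V)) x₀).comp_symm_deriv hy
  exact congrArg (fun L : V →L[ℝ] V => L v) h

lemma chartFrame_comp_mfderiv_chartAt [IsManifold 𝓘(ℝ, V) ∞ N] (x₀ : N) {x : N}
    (hx : x ∈ (chartAt V x₀).source) (v : TangentSpace 𝓘(ℝ, V) x) :
    (chartFrame x₀ (chartAt V x₀ x)
      (mfderiv 𝓘(ℝ, V) 𝓘(ℝ, V) (chartAt V x₀) x v) : V) = v := by
  have : IsManifold 𝓘(ℝ, V) 1 N := IsManifold.of_le (n := ∞) (by norm_cast)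
  have h := (mdifferentiable_chart (I := 𝓘(ℝ, V)) x₀).symm_comp_deriv hx
  exact congrArg (fun L : V →L[ℝ] V => L v) h

lemma IsSmoothForm.contDiffAt_chartRep {n : ℕ} {θ : DForm V N n} (hθ : IsSmoothForm θ) (x₀ : N)
    {y : V} (hy : y ∈ (chartAt V x₀).target) : ContDiffAt ℝ ∞ (chartRep θ x₀) y :=
  (hθ x₀).contDiffAt ((chartAt V x₀).open_target.mem_nhds hy)

/-- The exterior derivative may be computed in any chart. -/
lemma chartRep_dForm [IsManifold 𝓘(ℝ, V) ∞ N] {n : ℕ} {θ : DForm V N n} (hθ : IsSmoothForm θ)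
    (x₀ : N) {y : V} (hy : y ∈ (chartAt V x₀).target) :
    chartRep (dForm θ) x₀ y = extDeriv (chartRep θ x₀) y := by
  set x : N := (chartAt V x₀).symm y with hx
  have hys : y ∈ ((chartAt V x₀).symm.trans (chartAt V x)).source :=
    ⟨hy, mem_chart_source V x⟩
  have hT : chartTrans V x x₀ y = chartAt V x x := rfl
  have hev : chartRep θ x₀ =ᶠ[𝓝 y] fun z =>
      (chartRep θ x (chartTrans V x x₀ z)).compContinuousLinearMap
        (fderiv ℝ (chartTrans V x x₀) z) := by
    filter_upwards [(((chartAt V x₀).symm.trans (chartAt V x)).open_source).mem_nhds hys]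
      with z hz
    exact chartRep_trans θ x x₀ hz
  -- `dForm` at a point uses the preferred chart of that very point, which moves with `y`;
  -- naturality of `d` under the coordinate change transfers it to the fixed chart.
  rw [hev.extDeriv_eq, extDeriv_pullback (r := ∞)
    ((hθ.contDiffAt_chartRep x (y := chartTrans V x x₀ y)
      ((chartAt V x).map_source (mem_chart_source V x))).differentiableAt (by norm_num))
    ((contDiffOn_chartTrans x x₀).contDiffAt
      ((((chartAt V x₀).symm.trans (chartAt V x)).open_source).mem_nhds hys)) (by
        simpa using WithTop.coe_le_coe.2 (le_top (a := (2 : ℕ∞))))]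
  have h := chartFrame_trans x x₀ hys
  have hm : ∀ v : V, (mfderiv 𝓘(ℝ, V) 𝓘(ℝ, V) (chartAt V x) x
      (chartFrame x₀ y v : V) : V) = fderiv ℝ (chartTrans V x x₀) y v := by
    intro v
    rw [h]
    have h3 := mfderiv_chartAt_comp_chartFrame x (y := chartAt V x x)
      ((chartAt V x).map_source (mem_chart_source V x)) (fderiv ℝ (chartTrans V x x₀) y v)
    rw [(chartAt V x).left_inv (mem_chart_source V x)] at h3
    exact h3
  ext v
  change extDeriv (chartRep θ x) (chartAt V x x) (fun i => _) = _
  refine congrArg (extDeriv (chartRep θ x) (chartAt V x x)) (funext fun i => ?_)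
  exact hm (v i)

lemma wedgeAlt_apply_eq_zero {W : Type*} [AddCommGroup W] [Module ℝ W] [TopologicalSpace W]
    {k n m : ℕ} (h : k + n = m) (α : W [⋀^Fin k]→L[ℝ] ℝ) (φ : W [⋀^Fin n]→L[ℝ] ℝ)
    {P : Submodule ℝ W} (hφ : ∀ v : Fin n → W, (∀ i, v i ∈ P) → φ v = 0) (v : Fin m → W)
    (hv : ∀ i, v i ∈ P) : wedgeAlt h α φ v = 0 := by
  change LinearMap.mul' ℝ ℝ ((∑ σ : Equiv.Perm.ModSumCongr (Fin k) (Fin n),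
    AlternatingMap.domCoprod.summand α.toAlternatingMap φ.toAlternatingMap σ)
      fun i => v ((finSumFinEquiv.trans (finCongr h)) i)) = 0
  simp only [sum_apply, map_sum]
  refine Finset.sum_eq_zero fun σ _ => ?_
  induction σ using Quotient.inductionOn' with | _ σ
  change LinearMap.mul' ℝ ℝ ((Equiv.Perm.sign σ : ℤ) •
        ((α fun i : Fin k => v ((finSumFinEquiv.trans (finCongr h)) (σ (Sum.inl i)))) ⊗ₜ[ℝ]
          (φ fun i : Fin n => v ((finSumFinEquiv.trans (finCongr h)) (σ (Sum.inr i)))))) = 0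
  rw [hφ _ fun i => hv _]
  simp

/-- Restriction to `P` kills sums and wedge multiples of forms that already vanish on `P`, so the
generator alone decides. -/
lemma isIntegral_principalIdeal_iff {n : ℕ} (φ : DForm V N n) (x : N)
    (P : Submodule ℝ (TangentSpace 𝓘(ℝ, V) x)) :
    IsIntegral (principalIdeal φ) x P ↔
      ∀ v : Fin n → TangentSpace 𝓘(ℝ, V) x, (∀ i, v i ∈ P) → φ x v = 0 := by
  refine ⟨fun h => h n φ (IdealGen.gen φ singleForm.self), fun h m ψ hψ => ?_⟩
  change IdealGen _ m ψ at hψ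
  induction hψ with
  | gen ψ hψ => cases hψ; exact h
  | zero n => intro v _; rfl
  | add hφ hψ ih1 ih2 =>
    intro v hv
    exact (congrArg₂ (· + ·) (ih1 v hv) (ih2 v hv)).trans (add_zero 0)
  | wedge h α hα hφ ih => exact fun v hv => wedgeAlt_apply_eq_zero h _ _ ih v hv

end Generic

/-! ### Algebra of a 3-form: integral subspaces and polar spaces -/

section ThreeForms

variable {W : Type*} [AddCommGroup W] [Module ℝ W] [TopologicalSpace W]

lemma map_three_cycle (φ : W [⋀^Fin 3]→L[ℝ] ℝ) (a b c : W) : φ ![b, c, a] = φ ![a, b, c] := by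
  have h := φ.toAlternatingMap.map_perm ![a, b, c] (finRotate 3)
  have h2 : (![a, b, c] : Fin 3 → W) ∘ finRotate 3 = ![b, c, a] := by
    ext i; fin_cases i <;> rfl
  rw [h2, sign_finRotate] at h
  simpa using h

lemma map_three_swap (φ : W [⋀^Fin 3]→L[ℝ] ℝ) (a b c : W) : φ ![b, a, c] = -φ ![a, b, c] := by
  have h := φ.toAlternatingMap.map_swap ![a, b, c] (i := 0) (j := 1) (by decide)
  have h2 : (![a, b, c] : Fin 3 → W) ∘ Equiv.swap 0 1 = ![b, a, c] := by
    ext i; fin_cases i <;> rfl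
  rw [h2] at h
  exact h

/-- A 3-form as a trilinear map. -/
def triLin (φ : W [⋀^Fin 3]→L[ℝ] ℝ) : W →ₗ[ℝ] W →ₗ[ℝ] W →ₗ[ℝ] ℝ :=
  have hadd : ∀ a a' b c, φ ![a + a', b, c] = φ ![a, b, c] + φ ![a', b, c] :=
    fun a a' b c => φ.toAlternatingMap.map_vecCons_add ![b, c] a a'
  have hsmul : ∀ (r : ℝ) a b c, φ ![r • a, b, c] = r * φ ![a, b, c] :=
    fun r a b c => φ.toAlternatingMap.map_vecCons_smul ![b, c] r a
  have hadd1 : ∀ a b b' c, φ ![a, b + b', c] = φ ![a, b, c] + φ ![a, b', c] :=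
    fun a b b' c => by
      rw [← map_three_cycle φ a, ← map_three_cycle φ a b, ← map_three_cycle φ a b', hadd]
  have hsmul1 : ∀ (r : ℝ) a b c, φ ![a, r • b, c] = r * φ ![a, b, c] :=
    fun r a b c => by rw [← map_three_cycle φ a, ← map_three_cycle φ a b, hsmul]
  have hadd2 : ∀ a b c c', φ ![a, b, c + c'] = φ ![a, b, c] + φ ![a, b, c'] :=
    fun a b c c' => by
      rw [map_three_cycle φ _ a, map_three_cycle φ c a, map_three_cycle φ c' a, hadd]
  have hsmul2 : ∀ (r : ℝ) a b c, φ ![a, b, r • c] = r * φ ![a, b, c] :=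
    fun r a b c => by rw [map_three_cycle φ _ a, map_three_cycle φ c a, hsmul]
  LinearMap.mk₂ ℝ (fun a b =>
    { toFun := fun c => φ ![a, b, c]
      map_add' := hadd2 a b
      map_smul' := fun r c => hsmul2 r a b c })
    (fun a a' b => LinearMap.ext fun c => hadd a a' b c)
    (fun r a b => LinearMap.ext fun c => hsmul r a b c)
    (fun a b b' => LinearMap.ext fun c => hadd1 a b b' c)
    (fun r a b => LinearMap.ext fun c => hsmul1 r a b c)

lemma triLin_apply (φ : W [⋀^Fin 3]→L[ℝ] ℝ) (a b c : W) : triLin φ a b c = φ ![a, b, c] := rfl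

lemma triLin_cycle (φ : W [⋀^Fin 3]→L[ℝ] ℝ) (a b c : W) : triLin φ b c a = triLin φ a b c :=
  map_three_cycle φ a b c

lemma triLin_swap (φ : W [⋀^Fin 3]→L[ℝ] ℝ) (a b c : W) : triLin φ b a c = -triLin φ a b c :=
  map_three_swap φ a b c

lemma triLin_swap_right (φ : W [⋀^Fin 3]→L[ℝ] ℝ) (a b c : W) :
    triLin φ a c b = -triLin φ a b c := by
  rw [← triLin_cycle φ a c b, triLin_swap φ b c a, triLin_cycle]

lemma triLin_self (φ : W [⋀^Fin 3]→L[ℝ] ℝ) (a c : W) : triLin φ a a c = 0 := by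
  have := triLin_swap φ a a c
  linarith

lemma triLin_self_right (φ : W [⋀^Fin 3]→L[ℝ] ℝ) (a c : W) : triLin φ c a a = 0 := by
  rw [← triLin_cycle, triLin_self]

lemma triLin_self_outer (φ : W [⋀^Fin 3]→L[ℝ] ℝ) (a c : W) : triLin φ a c a = 0 := by
  rw [← triLin_cycle, triLin_self_right]

/-- The 3-form `φ` vanishes on the subspace `P`. -/
def VanishesOn (φ : W [⋀^Fin 3]→L[ℝ] ℝ) (P : Submodule ℝ W) : Prop :=
  ∀ a ∈ P, ∀ b ∈ P, ∀ c ∈ P, triLin φ a b c = 0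

lemma vanishesOn_iff (φ : W [⋀^Fin 3]→L[ℝ] ℝ) (P : Submodule ℝ W) :
    VanishesOn φ P ↔ ∀ v : Fin 3 → W, (∀ i, v i ∈ P) → φ v = 0 := by
  constructor
  · intro h v hv
    have : v = ![v 0, v 1, v 2] := by ext i; fin_cases i <;> rfl
    rw [this]
    exact h _ (hv 0) _ (hv 1) _ (hv 2)
  · intro h a ha b hb c hc
    refine h ![a, b, c] fun i => ?_
    fin_cases i
    exacts [ha, hb, hc]

/-- The space of vectors `v` such that the contraction of `φ` with `v` vanishes on `P`. -/
def polarSpace (φ : W [⋀^Fin 3]→L[ℝ] ℝ) (P : Submodule ℝ W) : Submodule ℝ W where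
  carrier := {v | ∀ a ∈ P, ∀ b ∈ P, triLin φ v a b = 0}
  add_mem' := by
    intro u v hu hv a ha b hb
    rw [map_add, LinearMap.add_apply, LinearMap.add_apply, hu a ha b hb, hv a ha b hb, add_zero]
  zero_mem' := by intro a _ b _; simp
  smul_mem' := by
    intro r v hv a ha b hb
    rw [map_smul, LinearMap.smul_apply, LinearMap.smul_apply, hv a ha b hb, smul_zero]

lemma mem_polarSpace {φ : W [⋀^Fin 3]→L[ℝ] ℝ} {P : Submodule ℝ W} {v : W} :
    v ∈ polarSpace φ P ↔ ∀ a ∈ P, ∀ b ∈ P, triLin φ v a b = 0 := Iff.rfl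

lemma VanishesOn.le_polarSpace {φ : W [⋀^Fin 3]→L[ℝ] ℝ} {P : Submodule ℝ W}
    (h : VanishesOn φ P) : P ≤ polarSpace φ P := fun v hv => h v hv

/-- Expanding trilinearly, each term contains `v` at least twice, or once against `P`, or not at
all. This is why the union of the integral elements through `P` is the linear space `polarSpace φ
P`. -/
lemma VanishesOn.sup_span {φ : W [⋀^Fin 3]→L[ℝ] ℝ} {P : Submodule ℝ W}
    (h : VanishesOn φ P) {v : W} (hv : v ∈ polarSpace φ P) :
    VanishesOn φ (P ⊔ Submodule.span ℝ {v}) := by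
  intro a' ha' b' hb' c' hc'
  obtain ⟨a, ha, _, h1, rfl⟩ := Submodule.mem_sup.1 ha'
  obtain ⟨b, hb, _, h2, rfl⟩ := Submodule.mem_sup.1 hb'
  obtain ⟨c, hc, _, h3, rfl⟩ := Submodule.mem_sup.1 hc'
  obtain ⟨r, rfl⟩ := Submodule.mem_span_singleton.1 h1
  obtain ⟨s, rfl⟩ := Submodule.mem_span_singleton.1 h2
  obtain ⟨t, rfl⟩ := Submodule.mem_span_singleton.1 h3
  have e1 : triLin φ a v c = 0 := by rw [← triLin_cycle]; exact hv c hc a ha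
  have e2 : triLin φ a b v = 0 := by rw [triLin_cycle φ v a b]; exact hv a ha b hb
  simp only [map_add, map_smul, LinearMap.add_apply, LinearMap.smul_apply, h a ha b hb c hc,
    hv b hb c hc, e1, e2, triLin_self, triLin_self_right, triLin_self_outer, smul_zero, add_zero]

lemma VanishesOn.mono {φ : W [⋀^Fin 3]→L[ℝ] ℝ} {P Q : Submodule ℝ W} (h : VanishesOn φ Q)
    (hPQ : P ≤ Q) : VanishesOn φ P :=
  fun a ha b hb c hc => h a (hPQ ha) b (hPQ hb) c (hPQ hc)

lemma polarSpace_span {ι : Type*} (φ : W [⋀^Fin 3]→L[ℝ] ℝ) (g : ι → W) (v : W) :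
    v ∈ polarSpace φ (Submodule.span ℝ (range g)) ↔ ∀ i j, triLin φ v (g i) (g j) = 0 := by
  constructor
  · exact fun h i j => h _ (Submodule.subset_span ⟨i, rfl⟩) _ (Submodule.subset_span ⟨j, rfl⟩)
  · intro h a ha b hb
    induction ha using Submodule.span_induction with
    | mem a ha =>
      obtain ⟨i, rfl⟩ := ha
      induction hb using Submodule.span_induction with
      | mem b hb => obtain ⟨j, rfl⟩ := hb; exact h i j
      | zero => simp
      | add b b' _ _ h1 h2 => rw [map_add, h1, h2, add_zero]
      | smul r b _ h1 => rw [map_smul, h1, smul_zero]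
    | zero => simp
    | add b b' _ _ h1 h2 => rw [map_add, LinearMap.add_apply, h1, h2, add_zero]
    | smul r b _ h1 => rw [map_smul, LinearMap.smul_apply, h1, smul_zero]

/-- A symmetric criterion in terms of increasing pairs of indices. -/
lemma polarSpace_span_lt {ι : Type*} [LinearOrder ι] (φ : W [⋀^Fin 3]→L[ℝ] ℝ) (g : ι → W) (v : W) :
    v ∈ polarSpace φ (Submodule.span ℝ (range g)) ↔
      ∀ i j, i < j → triLin φ v (g i) (g j) = 0 := by
  rw [polarSpace_span]
  refine ⟨fun h i j _ => h i j, fun h i j => ?_⟩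
  rcases lt_trichotomy i j with hij | rfl | hij
  · exact h i j hij
  · exact triLin_self_right φ _ _
  · rw [triLin_swap_right, h j i hij, neg_zero]

/-- Vanishing on `P` means that `P` lies in its own polar space, which reduces the claim to
generators and sorted pairs; the remaining index is sorted in by alternation. -/
lemma vanishesOn_span_lt {ι : Type*} [LinearOrder ι] (φ : W [⋀^Fin 3]→L[ℝ] ℝ) (g : ι → W) :
    VanishesOn φ (Submodule.span ℝ (range g)) ↔
      ∀ i j k, i < j → j < k → triLin φ (g i) (g j) (g k) = 0 := by
  constructor
  · exact fun h i j k _ _ => h _ (Submodule.subset_span ⟨i, rfl⟩) _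
      (Submodule.subset_span ⟨j, rfl⟩) _ (Submodule.subset_span ⟨k, rfl⟩)
  · intro h
    have key : Submodule.span ℝ (range g) ≤ polarSpace φ (Submodule.span ℝ (range g)) := by
      rw [Submodule.span_le]
      rintro _ ⟨i, rfl⟩
      refine (polarSpace_span_lt φ g (g i)).2 fun j k hjk => ?_
      rcases lt_trichotomy i j with hij | rfl | hij
      · exact h i j k hij hjk
      · exact triLin_self φ _ _
      · rcases lt_trichotomy i k with hik | rfl | hik
        · rw [triLin_swap, h j i k hij hik, neg_zero]
        · exact triLin_self_outer φ _ _
        · rw [← triLin_cycle, h j k i hjk hik]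
    exact key

end ThreeForms

/-! ### Global smooth forms with prescribed constant coefficients near a point -/

section Cutoff

variable {V : Type*} [NormedAddCommGroup V] [NormedSpace ℝ V]
variable {N : Type*} [TopologicalSpace N] [ChartedSpace V N]

/-- Alternatization as a continuous linear map. -/
def alternatizationL (V : Type*) [NormedAddCommGroup V] [NormedSpace ℝ V] (n : ℕ) :
    ContinuousMultilinearMap ℝ (fun _ : Fin n => V) ℝ →L[ℝ] V [⋀^Fin n]→L[ℝ] ℝ :=
  LinearMap.mkContinuous
    { toFun := fun f => ContinuousMultilinearMap.alternatization f
      map_add' := map_add _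
      map_smul' := fun r f => by
        ext v
        change (ContinuousMultilinearMap.alternatization (r • f)) v =
          r * (ContinuousMultilinearMap.alternatization f) v
        rw [ContinuousMultilinearMap.alternatization_apply_apply,
          ContinuousMultilinearMap.alternatization_apply_apply, Finset.mul_sum]
        refine Finset.sum_congr rfl fun σ _ => ?_
        rcases Int.units_eq_one_or (Equiv.Perm.sign σ) with h | h <;> simp [h] } (Fintype.card (Equiv.Perm (Fin n))) (by
    intro f
    refine ContinuousAlternatingMap.opNorm_le_bound _ (by positivity) fun v => ?_
    simp only [LinearMap.coe_mk, AddHom.coe_mk,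
      ContinuousMultilinearMap.alternatization_apply_apply]
    refine (norm_sum_le _ _).trans ?_
    rw [mul_assoc, ← nsmul_eq_mul, ← Finset.card_univ]
    refine Finset.sum_le_card_nsmul _ _ _ fun σ _ => ?_
    have h1 : ∏ i, ‖(v ∘ σ) i‖ = ∏ i, ‖v i‖ := Equiv.prod_comp σ fun i => ‖v i‖
    rw [← h1]
    refine le_trans (le_of_eq ?_) (f.le_opNorm (v ∘ σ))
    rcases Int.units_eq_one_or (Equiv.Perm.sign σ) with h | h <;> simp [h])

/-- The pullback is a homogeneous polynomial in `L`. Smoothness is known for multilinear maps and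
passes to alternating ones through the linear map `alternatizationL`, which multiplies a form that
is already alternating by `n!`. -/
lemma contDiff_compContinuousLinearMap {n : ℕ} (α : V [⋀^Fin n]→L[ℝ] ℝ) :
    ContDiff ℝ ∞ fun L : V →L[ℝ] V => α.compContinuousLinearMap L := by
  have h1 : ∀ L : V →L[ℝ] V, α.compContinuousLinearMap L =
      ((n.factorial : ℝ)⁻¹) • alternatizationL V n
        (ContinuousMultilinearMap.compContinuousLinearMapContinuousMultilinear ℝ
          (fun _ : Fin n => V) (fun _ : Fin n => V) ℝ (fun _ => L)
          α.toContinuousMultilinearMap) := by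
    intro L
    ext v
    have hn : (n.factorial : ℝ) ≠ 0 := by exact_mod_cast n.factorial_ne_zero
    change _ = (n.factorial : ℝ)⁻¹ • (ContinuousMultilinearMap.alternatization
      (α.compContinuousLinearMap L).toContinuousMultilinearMap) v
    have h2 := AlternatingMap.coe_alternatization (α.compContinuousLinearMap L).toAlternatingMap
    have h3 : (ContinuousMultilinearMap.alternatization
        (α.compContinuousLinearMap L).toContinuousMultilinearMap) v =
        MultilinearMap.alternatization
          ((α.compContinuousLinearMap L).toAlternatingMap : MultilinearMap ℝ _ _) v := by
      rw [ContinuousMultilinearMap.alternatization_apply_apply, MultilinearMap.alternatization_apply]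
      rfl
    rw [h3, h2]
    simp [hn]
  simp only [h1]
  have hd : ContDiff ℝ ∞ fun (L : V →L[ℝ] V) (_ : Fin n) => L :=
    contDiff_pi.2 fun _ => contDiff_id
  have h2 : ContDiff ℝ ∞ fun L : V →L[ℝ] V =>
      ContinuousMultilinearMap.compContinuousLinearMapContinuousMultilinear ℝ
        (fun _ : Fin n => V) (fun _ : Fin n => V) ℝ fun _ => L :=
    (ContinuousMultilinearMap.contDiff _).comp hd
  exact ((alternatizationL V n).contDiff.comp (h2.clm_apply contDiff_const)).const_smul _

/-- A form with constant coefficients in a chart extends, near a given point, to a smooth form. -/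
lemma exists_isSmoothForm_eventuallyEq [FiniteDimensional ℝ V] [T2Space N]
    [IsManifold 𝓘(ℝ, V) ∞ N] {n : ℕ} (x₀ : N) (α₀ : V [⋀^Fin n]→L[ℝ] ℝ) :
    ∃ α : DForm V N n, IsSmoothForm α ∧
      ∀ᶠ y in 𝓝 (chartAt V x₀ x₀), chartRep α x₀ y = α₀ := by
  obtain ⟨f⟩ : Nonempty (SmoothBumpFunction 𝓘(ℝ, V) x₀) := inferInstance
  refine ⟨fun x => f x • α₀.compContinuousLinearMap
    (mfderiv 𝓘(ℝ, V) 𝓘(ℝ, V) (chartAt V x₀) x), fun x₁ y hy => ?_, ?_⟩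
  · refine ContDiffAt.contDiffWithinAt ?_
    have hfs : ContDiffAt ℝ ∞ (f ∘ (chartAt V x₁).symm) y := by
      have h1 := contMDiffOn_chart_symm (I := 𝓘(ℝ, V)) (n := ∞) (x := x₁) (H := V) (M := N)
      have h2 := f.contMDiff.comp_contMDiffOn h1
      exact (contMDiffOn_iff_contDiffOn.1 h2).contDiffAt ((chartAt V x₁).open_target.mem_nhds hy)
    by_cases hc : (chartAt V x₁).symm y ∈ (chartAt V x₀).source
    · have hys : y ∈ ((chartAt V x₁).symm.trans (chartAt V x₀)).source := ⟨hy, hc⟩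
      have hnhds := (((chartAt V x₁).symm.trans (chartAt V x₀)).open_source).mem_nhds hys
      have hT := (contDiffOn_chartTrans x₀ x₁).contDiffAt hnhds
      have hev : (fun z => f ((chartAt V x₁).symm z) • α₀.compContinuousLinearMap
          (fderiv ℝ (chartTrans V x₀ x₁) z)) =ᶠ[𝓝 y]
          chartRep (fun x => f x • α₀.compContinuousLinearMap
            (mfderiv 𝓘(ℝ, V) 𝓘(ℝ, V) (chartAt V x₀) x)) x₁ := by
        filter_upwards [hnhds] with z hz
        have h := chartFrame_trans x₀ x₁ hz
        have hm : ∀ v : V, fderiv ℝ (chartTrans V x₀ x₁) z v =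
            (mfderiv 𝓘(ℝ, V) 𝓘(ℝ, V) (chartAt V x₀) ((chartAt V x₁).symm z)
              (chartFrame x₁ z v : V) : V) := by
          intro v
          rw [h]
          have h3 := mfderiv_chartAt_comp_chartFrame x₀ (y := chartTrans V x₀ x₁ z)
            ((chartAt V x₀).map_source hz.2) (fderiv ℝ (chartTrans V x₀ x₁) z v)
          have hp : (chartAt V x₀).symm (chartTrans V x₀ x₁ z) = (chartAt V x₁).symm z :=
            (chartAt V x₀).left_inv hz.2
          rw [hp] at h3
          exact h3.symm
        ext v
        change f _ • α₀ (fun i => _) = f _ • α₀ (fun i => _)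
        refine congrArg (fun u => f ((chartAt V x₁).symm z) • α₀ u) (funext fun i => ?_)
        exact hm (v i)
      refine ContDiffAt.congr_of_eventuallyEq ?_ hev.symm
      refine hfs.smul ((contDiff_compContinuousLinearMap α₀).contDiffAt.comp y ?_)
      exact hT.fderiv_right (m := ∞) (by norm_cast)
    -- Outside the chart domain the bump function vanishes on a neighbourhood, so the extended form
    -- is locally zero.
    · have hcl : IsClosed (tsupport f) := isClosed_tsupport f
      have hnot : (chartAt V x₁).symm y ∉ tsupport f :=
        fun h => hc (f.tsupport_subset_chartAt_source h)
      have hcont := ((chartAt V x₁).symm.continuousAt (x := y) hy)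
      have hev := hcont.eventually (hcl.isOpen_compl.mem_nhds hnot)
      refine (contDiffAt_const (c := 0)).congr_of_eventuallyEq ?_
      filter_upwards [hev] with z hz
      have h0 : f ((chartAt V x₁).symm z) = 0 := image_eq_zero_of_notMem_tsupport hz
      ext v
      change f ((chartAt V x₁).symm z) • α₀ (fun i => _) = 0
      rw [h0, zero_smul]
  · have hx := mem_chart_source V x₀
    have h1 := f.eventuallyEq_one
    have hcont := (chartAt V x₀).symm.continuousAt (x := chartAt V x₀ x₀)
      ((chartAt V x₀).map_source hx)
    unfold ContinuousAt at hcont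
    rw [(chartAt V x₀).left_inv hx] at hcont
    filter_upwards [hcont.eventually h1,
      (chartAt V x₀).open_target.mem_nhds ((chartAt V x₀).map_source hx)] with z hz hzt
    ext v
    change f ((chartAt V x₀).symm z) • α₀ (fun i => _) = α₀ v
    rw [hz, Pi.one_apply, one_smul]
    exact congrArg α₀ (funext fun i => mfderiv_chartAt_comp_chartFrame x₀ hzt (v i))

end Cutoff

/-! ### Wedge products with covectors dual to a frame -/

section Wedge

variable {V : Type*} [AddCommGroup V] [Module ℝ V] [TopologicalSpace V]

/-- The exterior product of finitely many covectors. -/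
def detForm {k : ℕ} (ξ : Fin k → V →L[ℝ] ℝ) : V [⋀^Fin k]→L[ℝ] ℝ :=
  { (Matrix.detRowAlternating (R := ℝ) (n := Fin k)).compLinearMap
      (LinearMap.pi fun a => (ξ a : V →ₗ[ℝ] ℝ)) with
    cont := by
      change Continuous fun v : Fin k → V => Matrix.det (Matrix.of fun c a => ξ a (v c))
      exact Continuous.matrix_det (continuous_pi fun c => continuous_pi fun a =>
        (ξ a).continuous.comp (continuous_apply c)) }

/-- The sign of the permutation which compares `τ` with the standard identification. -/
def shuffleSign {k n m : ℕ} (h : k + n = m) (τ : Fin k ⊕ Fin n ≃ Fin m) : ℤˣ :=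
  Equiv.Perm.sign (τ.trans (finSumFinEquiv.trans (finCongr h)).symm)

/-- The wedge product of `φ` with some of the covectors dual to a frame, evaluated on that frame. -/
lemma wedgeAlt_detForm {k n m : ℕ} (h : k + n = m) (τ : Fin k ⊕ Fin n ≃ Fin m)
    (ξ : Fin m → V →L[ℝ] ℝ) (φ : V [⋀^Fin n]→L[ℝ] ℝ) (g : Fin m → V)
    (hg : ∀ i j, ξ i (g j) = if i = j then 1 else 0) :
    wedgeAlt h (detForm fun a => ξ (τ (Sum.inl a))) φ g =
      ((shuffleSign h τ : ℤ) : ℝ) * φ fun b => g (τ (Sum.inr b)) := by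
  set τ₀ : Fin k ⊕ Fin n ≃ Fin m := finSumFinEquiv.trans (finCongr h) with hτ₀
  set σ₀ : Equiv.Perm (Fin k ⊕ Fin n) := τ.trans τ₀.symm with hσ₀
  have hσ₀' : ∀ x, τ₀ (σ₀ x) = τ x := fun x => by simp [hσ₀]
  have hterm : ∀ σ : Equiv.Perm (Fin k ⊕ Fin n),
      LinearMap.mul' ℝ ℝ (AlternatingMap.domCoprod.summand
        (detForm fun a => ξ (τ (Sum.inl a))).toAlternatingMap φ.toAlternatingMap
        (Quotient.mk'' σ) fun i => g (τ₀ i)) =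
      ((Equiv.Perm.sign σ : ℤ) : ℝ) *
        (Matrix.det (Matrix.of fun c a => ξ (τ (Sum.inl a)) (g (τ₀ (σ (Sum.inl c))))) *
          φ fun b => g (τ₀ (σ (Sum.inr b)))) := by
    intro σ
    change LinearMap.mul' ℝ ℝ ((Equiv.Perm.sign σ : ℤ) •
        ((detForm (fun a => ξ (τ (Sum.inl a))) fun i : Fin k => g (τ₀ (σ (Sum.inl i)))) ⊗ₜ[ℝ]
          (φ fun i : Fin n => g (τ₀ (σ (Sum.inr i)))))) = _
    rw [map_zsmul, LinearMap.mul'_apply, zsmul_eq_mul]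
    rfl
  change LinearMap.mul' ℝ ℝ ((∑ σ : Equiv.Perm.ModSumCongr (Fin k) (Fin n),
    AlternatingMap.domCoprod.summand (detForm fun a => ξ (τ (Sum.inl a))).toAlternatingMap
      φ.toAlternatingMap σ) fun i => g (τ₀ i)) = _
  simp only [sum_apply, map_sum]
  -- Of all shuffles only the class of `σ₀` survives: the covectors must meet exactly the frame
  -- vectors to which they are dual.
  refine (Finset.sum_eq_single (Quotient.mk'' σ₀ : Equiv.Perm.ModSumCongr (Fin k) (Fin n))
    ?_ ?_).trans ?_
  rotate_left 2
  · rw [hterm]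
    simp only [hσ₀', hg]
    have : (Matrix.of fun c a : Fin k => if τ (Sum.inl a) = τ (Sum.inl c) then (1 : ℝ) else 0)
        = 1 := by
      ext c a
      simp [Matrix.one_apply, eq_comm]
    rw [this, Matrix.det_one, one_mul]
    rfl
  · intro σ _ hne
    induction σ using Quotient.inductionOn' with | _ σ
    rw [hterm]
    by_contra hcon
    refine hne ?_
    -- If `σ` fed a frame vector outside the left block of `τ` to the determinant, that row would be
    -- zero. So `σ₀⁻¹ σ` preserves the left block, and `σ`, `σ₀` represent the same shuffle.
    have hdet : Matrix.det (Matrix.of fun c a =>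
        ξ (τ (Sum.inl a)) (g (τ₀ (σ (Sum.inl c))))) ≠ 0 := by
      intro h0
      rw [h0] at hcon
      simp at hcon
    have hmaps : MapsTo (σ₀⁻¹ * σ) (range (Sum.inl : Fin k → Fin k ⊕ Fin n))
        (range (Sum.inl : Fin k → Fin k ⊕ Fin n)) := by
      rintro _ ⟨c, rfl⟩
      by_contra hc
      refine hdet (Matrix.det_eq_zero_of_row_eq_zero c fun a => ?_)
      simp only [Matrix.of_apply, hg]
      refine if_neg fun hac => hc ⟨a, ?_⟩
      rw [← hσ₀'] at hac
      rw [Equiv.Perm.mul_apply, ← τ₀.injective hac]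
      exact (σ₀.symm_apply_apply _).symm
    have hmem := Equiv.Perm.mem_sumCongrHom_range_of_perm_mapsTo_inl hmaps
    exact (QuotientGroup.eq.2 hmem).symm
  · intro hn
    exact absurd (Finset.mem_univ _) hn

lemma exists_equiv_extend_inr {k n m : ℕ} (h : k + n = m) {d : Fin n → Fin m}
    (hd : Function.Injective d) : ∃ τ : Fin k ⊕ Fin n ≃ Fin m, ∀ b, τ (Sum.inr b) = d b := by
  classical
  let τ₀ : Fin k ⊕ Fin n ≃ Fin m := finSumFinEquiv.trans (finCongr h)
  have hi : Function.Injective fun b : Fin n => τ₀ (Sum.inr b) :=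
    τ₀.injective.comp Sum.inr_injective
  let f : {x // x ∈ range fun b : Fin n => τ₀ (Sum.inr b)} ≃ {x // x ∈ range d} :=
    (Equiv.ofInjective _ hi).symm.trans (Equiv.ofInjective d hd)
  refine ⟨τ₀.trans f.extendSubtype, fun b => ?_⟩
  rw [Equiv.trans_apply, Equiv.extendSubtype_apply_of_mem _ _ ⟨b, rfl⟩]
  have : (Equiv.ofInjective _ hi).symm ⟨τ₀ (Sum.inr b), ⟨b, rfl⟩⟩ = b :=
    (Equiv.ofInjective _ hi).symm_apply_apply b
  simp only [f, Equiv.trans_apply]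
  rw [this]
  rfl

end Wedge

/-! ### Sesquilinear forms and their imaginary parts -/

section Sesquilinear

/-- The sesquilinear form of a complex matrix. -/
def sesq (B : Matrix (Fin 3) (Fin 3) ℂ) (x z : C3) : ℂ := star x ⬝ᵥ (B *ᵥ z)

/-- The imaginary part of the sesquilinear form of a complex matrix, a real 2-form if the matrix is
Hermitian. -/
def sig (B : Matrix (Fin 3) (Fin 3) ℂ) (x z : C3) : ℝ := (sesq B x z).im

variable (B B' : Matrix (Fin 3) (Fin 3) ℂ) (x x' z z' : C3)

lemma sesq_add_mat : sesq (B + B') x z = sesq B x z + sesq B' x z := by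
  simp [sesq, Matrix.add_mulVec]

lemma sesq_smul_mat (c : ℂ) : sesq (c • B) x z = c * sesq B x z := by
  simp [sesq, Matrix.smul_mulVec]

lemma sesq_add_left : sesq B (x + x') z = sesq B x z + sesq B x' z := by
  simp [sesq, add_dotProduct]

lemma sesq_add_right : sesq B x (z + z') = sesq B x z + sesq B x z' := by
  simp [sesq, Matrix.mulVec_add]

lemma sesq_smul_left (c : ℂ) : sesq B (c • x) z = star c * sesq B x z := by
  simp [sesq, smul_dotProduct]

lemma sesq_smul_right (c : ℂ) : sesq B x (c • z) = c * sesq B x z := by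
  simp [sesq, Matrix.mulVec_smul]

lemma sesq_star {B : Matrix (Fin 3) (Fin 3) ℂ} (hB : B.IsHermitian) (x z : C3) :
    star (sesq B x z) = sesq B z x := by
  rw [sesq, Matrix.star_dotProduct, star_star, Matrix.star_mulVec, hB.eq, sesq,
    ← Matrix.dotProduct_mulVec]

lemma sesq_vecMulVec (r : C3) :
    sesq (Matrix.vecMulVec r (star r)) x z = (star x ⬝ᵥ r) * (star r ⬝ᵥ z) := by
  rw [sesq, Matrix.vecMulVec_mulVec]
  simp [mul_comm]

lemma conjTranspose_mul_mul_apply (S : Matrix (Fin 3) (Fin 3) ℂ) (a b : Fin 3) :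
    (Sᴴ * B * S) a b = sesq B (fun i => S i a) fun i => S i b := by
  rw [Matrix.mul_assoc, Matrix.mul_apply, sesq, dotProduct]
  rfl

lemma sig_antisymm {B : Matrix (Fin 3) (Fin 3) ℂ} (hB : B.IsHermitian) (x z : C3) :
    sig B z x = -sig B x z := by
  rw [sig, sig, ← sesq_star hB x z, Complex.star_def, Complex.conj_im]

/-- Invariance under `i` says that the 2-form has type `(1,1)`. This and its variant
`sig_smul_I_left` are the source of the two redundant conditions on 5-planes. -/
lemma sig_smul_I {B : Matrix (Fin 3) (Fin 3) ℂ} (x z : C3) :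
    sig B (Complex.I • x) (Complex.I • z) = sig B x z := by
  rw [sig, sig, sesq_smul_left, sesq_smul_right]
  congr 1
  rw [Complex.star_def, Complex.conj_I, ← mul_assoc, neg_mul, Complex.I_mul_I, neg_neg, one_mul]

lemma sig_smul_I_left {B : Matrix (Fin 3) (Fin 3) ℂ} (x z : C3) :
    sig B (Complex.I • x) z = -sig B x (Complex.I • z) := by
  rw [sig, sig, sesq_smul_left, sesq_smul_right]
  simp

lemma sig_add_mat : sig (B + B') x z = sig B x z + sig B' x z := by
  simp [sig, sesq_add_mat]

lemma sig_smul_mat (c : ℝ) : sig (c • B) x z = c * sig B x z := by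
  have : (c • B : Matrix (Fin 3) (Fin 3) ℂ) = (c : ℂ) • B := by ext; simp
  rw [this, sig, sig, sesq_smul_mat, Complex.im_ofReal_mul]

lemma sig_add_left : sig B (x + x') z = sig B x z + sig B x' z := by
  simp [sig, sesq_add_left]

lemma sig_add_right : sig B x (z + z') = sig B x z + sig B x z' := by
  simp [sig, sesq_add_right]

lemma sig_smul_left (c : ℝ) : sig B (c • x) z = c * sig B x z := by
  have : (c • x : C3) = (c : ℂ) • x := by ext; simp
  rw [this, sig, sig, sesq_smul_left]
  simp

lemma sig_smul_right (c : ℝ) : sig B x (c • z) = c * sig B x z := by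
  have : (c • z : C3) = (c : ℂ) • z := by ext; simp
  rw [this, sig, sig, sesq_smul_right]
  simp

end Sesquilinear

/-! ### The pointwise algebraic model of `dβ` -/

section Model

variable {W : Type*} [NormedAddCommGroup W] [NormedSpace ℝ W]

/-- The algebraic properties of the 3-form `dβ` at a point: it is of type `(2,1) + (1,2)` with
coefficients `κ`, and the restriction of `κ` to the vertical space is an isomorphism onto a space of
Hermitian forms that is complementary to each line spanned by a form of rank one. -/
structure IsModel (φ : (C3 × W) [⋀^Fin 3]→L[ℝ] ℝ)
    (κ : C3 × W →ₗ[ℝ] Matrix (Fin 3) (Fin 3) ℂ) : Prop where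
  formula : ∀ u v w, triLin φ u v w =
    sig (κ u) v.1 w.1 + sig (κ v) w.1 u.1 + sig (κ w) u.1 v.1
  herm : ∀ u, (κ u).IsHermitian
  surj : ∀ B : Matrix (Fin 3) (Fin 3) ℂ, B.IsHermitian → ∀ r : C3, r ≠ 0 →
    ∃ (t : ℝ) (w : W), κ (0, w) = B + (t : ℂ) • Matrix.vecMulVec r (star r)
  inj : ∀ (w : W) (t : ℝ) (r : C3), r ≠ 0 →
    κ (0, w) = (t : ℂ) • Matrix.vecMulVec r (star r) → w = 0

variable {φ : (C3 × W) [⋀^Fin 3]→L[ℝ] ℝ} {κ : C3 × W →ₗ[ℝ] Matrix (Fin 3) (Fin 3) ℂ}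

/-- The other two terms of the cyclic formula contain the horizontal part of `(0, w)`, which is
zero. -/
lemma IsModel.vertical (h : IsModel φ κ) (w : W) (u v : C3 × W) :
    triLin φ (0, w) u v = sig (κ (0, w)) u.1 v.1 := by
  rw [h.formula]
  simp [sig, sesq]

/-- The matrix with given columns. -/
def colMat (e : Fin 3 → C3) : Matrix (Fin 3) (Fin 3) ℂ := Matrix.of fun i a => e a i

lemma isUnit_det_colMat {e : Fin 3 → C3} (he : LinearIndependent ℂ e) :
    IsUnit (colMat e).det := by
  rw [← Matrix.isUnit_iff_isUnit_det, ← Matrix.linearIndependent_cols_iff_isUnit]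
  exact he

/-- A covector that vanishes on the last two vectors of a basis. -/
def dualVec (e : Fin 3 → C3) : C3 := fun i => star ((colMat e)⁻¹ 0 i)

lemma star_dualVec_dotProduct {e : Fin 3 → C3} (he : LinearIndependent ℂ e) (b : Fin 3) :
    star (dualVec e) ⬝ᵥ e b = (1 : Matrix (Fin 3) (Fin 3) ℂ) 0 b := by
  rw [← Matrix.nonsing_inv_mul _ (isUnit_det_colMat he), Matrix.mul_apply, dotProduct]
  simp [dualVec, colMat]

lemma dotProduct_dualVec {e : Fin 3 → C3} (he : LinearIndependent ℂ e) (b : Fin 3) :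
    star (e b) ⬝ᵥ dualVec e = (1 : Matrix (Fin 3) (Fin 3) ℂ) 0 b := by
  have := congrArg star (star_dualVec_dotProduct he b)
  rw [← Matrix.star_dotProduct_star, star_star] at this
  rw [this, Matrix.one_apply]
  split_ifs <;> simp

lemma dualVec_ne_zero {e : Fin 3 → C3} (he : LinearIndependent ℂ e) : dualVec e ≠ 0 := by
  intro h
  have := star_dualVec_dotProduct he 0
  rw [h] at this
  simp at this

/-- All but one of the coefficients of the Hermitian form of a vertical vector with respect to a
basis can be prescribed. -/
lemma IsModel.exists_vertical (h : IsModel φ κ) {e : Fin 3 → C3} (he : LinearIndependent ℂ e)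
    {B' : Matrix (Fin 3) (Fin 3) ℂ} (hB' : B'.IsHermitian) :
    ∃ w, ∀ a b, (a ≠ 0 ∨ b ≠ 0) → sesq (κ (0, w)) (e a) (e b) = B' a b := by
  have hdet := isUnit_det_colMat he
  have hdet' : IsUnit (colMat e)ᴴ.det := by
    rw [Matrix.det_conjTranspose]; exact hdet.star
  set T := (colMat e)⁻¹ with hT
  have hherm : (Tᴴ * B' * T).IsHermitian := Matrix.isHermitian_conjTranspose_mul_mul T hB'
  -- The model realizes a Hermitian form up to a multiple of `r r*`. With `r` dual to `e 0` this
  -- correction affects only the coefficient at `(0, 0)`.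
  obtain ⟨t, w, hw⟩ := h.surj _ hherm (dualVec e) (dualVec_ne_zero he)
  refine ⟨w, fun a b hab => ?_⟩
  have h1 : sesq (Tᴴ * B' * T) (e a) (e b) = B' a b := by
    have h2 := conjTranspose_mul_mul_apply (Tᴴ * B' * T) (colMat e) a b
    have h3 : (colMat e)ᴴ * (Tᴴ * B' * T) * colMat e = B' := by
      have h4 : (colMat e)ᴴ * Tᴴ = 1 := by
        rw [← Matrix.conjTranspose_mul, Matrix.nonsing_inv_mul _ hdet, Matrix.conjTranspose_one]
      rw [← Matrix.mul_assoc, ← Matrix.mul_assoc, h4, Matrix.one_mul, Matrix.mul_assoc,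
        Matrix.nonsing_inv_mul _ hdet, Matrix.mul_one]
    rw [h3] at h2
    exact h2.symm
  rw [hw, sesq_add_mat, h1, sesq_smul_mat, sesq_vecMulVec, dotProduct_dualVec he,
    star_dualVec_dotProduct he]
  rcases hab with hab | hab <;> simp [Matrix.one_apply, hab.symm]

/-- A Hermitian form whose only possible nonzero coefficient is at `(e 0, e 0)` is a real multiple
of `r r*` with `r` dual to `e 0`, and no nonzero vertical vector has such a form. -/
lemma IsModel.vertical_eq_zero (h : IsModel φ κ) {e : Fin 3 → C3} (he : LinearIndependent ℂ e)
    {w : W} (hw : ∀ a b, (a ≠ 0 ∨ b ≠ 0) → sesq (κ (0, w)) (e a) (e b) = 0) : w = 0 := by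
  have hdet := isUnit_det_colMat he
  set T := (colMat e)⁻¹ with hT
  set c := sesq (κ (0, w)) (e 0) (e 0) with hc
  have hreal : ((c.re : ℝ) : ℂ) = c := Complex.conj_eq_iff_re.1 (sesq_star (h.herm _) (e 0) (e 0))
  refine h.inj w c.re (dualVec e) (dualVec_ne_zero he) ?_
  have h1 : (colMat e)ᴴ * κ (0, w) * colMat e = Matrix.single 0 0 c := by
    ext a b
    rw [conjTranspose_mul_mul_apply]
    change sesq _ (e a) (e b) = _
    by_cases hab : a ≠ 0 ∨ b ≠ 0
    · rw [hw a b hab]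
      rcases hab with hab | hab <;> simp [hab.symm]
    · push Not at hab
      rw [hab.1, hab.2, ← hc]
      simp
  have h4 : Tᴴ * (colMat e)ᴴ = 1 := by
    rw [← Matrix.conjTranspose_mul, Matrix.mul_nonsing_inv _ hdet, Matrix.conjTranspose_one]
  have h2 : κ (0, w) = Tᴴ * Matrix.single 0 0 c * T := by
    rw [← h1, ← Matrix.mul_assoc, ← Matrix.mul_assoc, h4, Matrix.one_mul, Matrix.mul_assoc,
      Matrix.mul_nonsing_inv _ hdet, Matrix.mul_one]
  rw [h2, hreal]
  ext i j
  simp [Matrix.mul_apply, Fin.sum_univ_three, Matrix.vecMulVec_apply, dualVec, ← hT,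
    Matrix.single_apply]
  ring

end Model

/-! ### Independent conditions on vertical vectors -/

section Adapted

variable {W : Type*} [NormedAddCommGroup W] [NormedSpace ℝ W]
variable {φ : (C3 × W) [⋀^Fin 3]→L[ℝ] ℝ} {κ : C3 × W →ₗ[ℝ] Matrix (Fin 3) (Fin 3) ℂ}

/-- The values of the forms of vertical vectors on the pairs of vectors of `x` (the pairs that start
with the third vector being omitted when there are five vectors) can be prescribed. -/
def VerticalSurj (κ : C3 × W →ₗ[ℝ] Matrix (Fin 3) (Fin 3) ℂ) {j : ℕ} (x : Fin j → C3) : Prop :=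
  ∀ d : Fin j → Fin j → ℝ, ∃ w, ∀ i i' : Fin j, i < i' → ¬(j = 5 ∧ i.val = 2) →
    sig (κ (0, w)) (x i) (x i') = d i i'

/-- The real basis of `ℂ³` adapted to a complex basis. -/
def adaptedVec (e : Fin 3 → C3) : Fin 6 → C3 :=
  ![Complex.I • e 0, e 1, Complex.I • e 1, e 2, Complex.I • e 2, e 0]

/-- The eight pairs correspond to the eight free real parameters: three complex off-diagonal
coefficients and two diagonal ones. The omitted pairs `(2,3)` and `(2,4)` repeat `(1,4)`, up to
sign, and `(1,3)`. -/
lemma IsModel.verticalSurj_five (h : IsModel φ κ) {e : Fin 3 → C3} (he : LinearIndependent ℂ e) :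
    VerticalSurj κ fun i : Fin 5 => adaptedVec e (Fin.castLE (by norm_num) i) := by
  intro d
  -- The entries solve `sig(ix, z) = -Re B(x,z)`, `sig(ix, iz) = sig(x, z) = Im B(x,z)` and `sig(x,
  -- iz) = Re B(x,z)`.
  let B' : Matrix (Fin 3) (Fin 3) ℂ :=
    !![0, -d 0 1 + d 0 2 * Complex.I, -d 0 3 + d 0 4 * Complex.I;
      -d 0 1 - d 0 2 * Complex.I, d 1 2, d 1 4 + d 1 3 * Complex.I;
      -d 0 3 - d 0 4 * Complex.I, d 1 4 - d 1 3 * Complex.I, d 3 4]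
  have hB' : B'.IsHermitian := by
    ext i j
    fin_cases i <;> fin_cases j <;> simp [B', sub_eq_add_neg]
  obtain ⟨w, hw⟩ := h.exists_vertical he hB'
  have h01 := hw 0 1 (by decide)
  have h02 := hw 0 2 (by decide)
  have h11 := hw 1 1 (by decide)
  have h12 := hw 1 2 (by decide)
  have h22 := hw 2 2 (by decide)
  refine ⟨w, fun i i' hlt hne => ?_⟩
  fin_cases i <;> fin_cases i' <;> first
    | exact absurd hlt (by decide)
    | exact absurd ⟨rfl, rfl⟩ hne
    | simp [adaptedVec, Fin.castLE, sig, sesq_smul_left, sesq_smul_right, h01, h02, h11, h12, h22,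
        B']

/-- The six pairs of `ie₀, e₁, ie₁, e₂` involve six different real parameters; the two that do not
occur, `Im B₀₂` and `B₂₂`, are set to zero. Not every real 4-plane has such a basis: a complex
2-plane has none, and there the conditions are dependent. -/
lemma IsModel.verticalSurj_four (h : IsModel φ κ) {e : Fin 3 → C3} (he : LinearIndependent ℂ e) :
    VerticalSurj κ fun i : Fin 4 => adaptedVec e (Fin.castLE (by norm_num) i) := by
  intro d
  let B' : Matrix (Fin 3) (Fin 3) ℂ :=
    !![0, -d 0 1 + d 0 2 * Complex.I, -d 0 3;
      -d 0 1 - d 0 2 * Complex.I, d 1 2, -d 2 3 + d 1 3 * Complex.I;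
      -d 0 3, -d 2 3 - d 1 3 * Complex.I, 0]
  have hB' : B'.IsHermitian := by
    ext i j
    fin_cases i <;> fin_cases j <;> simp [B', sub_eq_add_neg]
  obtain ⟨w, hw⟩ := h.exists_vertical he hB'
  have h01 := hw 0 1 (by decide)
  have h02 := hw 0 2 (by decide)
  have h11 := hw 1 1 (by decide)
  have h12 := hw 1 2 (by decide)
  refine ⟨w, fun i i' hlt hne => ?_⟩
  fin_cases i <;> fin_cases i' <;> first
    | exact absurd hlt (by decide)
    | simp [adaptedVec, Fin.castLE, sig, sesq_smul_left, sesq_smul_right, h01, h02, h11, h12, B']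

/-- A vertical vector is determined by the values of its form on eight pairs of vectors. -/
lemma IsModel.vertical_eq_zero_of_sig (h : IsModel φ κ) {e : Fin 3 → C3}
    (he : LinearIndependent ℂ e) {w : W}
    (hw : ∀ i i' : Fin 5, i < i' → i.val ≠ 2 →
      sig (κ (0, w)) (adaptedVec e (Fin.castLE (by norm_num) i))
        (adaptedVec e (Fin.castLE (by norm_num) i')) = 0) : w = 0 := by
  have hB := h.herm (0, w)
  have e01 := hw 0 1 (by decide) (by decide)
  have e02 := hw 0 2 (by decide) (by decide)
  have e03 := hw 0 3 (by decide) (by decide)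
  have e04 := hw 0 4 (by decide) (by decide)
  have e12 := hw 1 2 (by decide) (by decide)
  have e13 := hw 1 3 (by decide) (by decide)
  have e14 := hw 1 4 (by decide) (by decide)
  have e34 := hw 3 4 (by decide) (by decide)
  simp [adaptedVec, Fin.castLE, sig, sesq_smul_left, sesq_smul_right] at e01 e02 e03 e04 e12 e13 e14 e34
  have hdiag : ∀ x : C3, (sesq (κ (0, w)) x x).im = 0 := fun x =>
    Complex.conj_eq_iff_im.1 (sesq_star hB x x)
  have h01 : sesq (κ (0, w)) (e 0) (e 1) = 0 := Complex.ext e01 e02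
  have h02 : sesq (κ (0, w)) (e 0) (e 2) = 0 := Complex.ext e03 e04
  have h12 : sesq (κ (0, w)) (e 1) (e 2) = 0 := Complex.ext e14 e13
  have h11 : sesq (κ (0, w)) (e 1) (e 1) = 0 := Complex.ext e12 (hdiag _)
  have h22 : sesq (κ (0, w)) (e 2) (e 2) = 0 := Complex.ext e34 (hdiag _)
  refine h.vertical_eq_zero he fun a b hab => ?_
  fin_cases a <;> fin_cases b <;> first
    | exact absurd hab (by decide)
    | assumption
    | (rw [← sesq_star hB]; first | exact (congrArg star h01).trans (star_zero _)
                                  | exact (congrArg star h02).trans (star_zero _)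
                                  | exact (congrArg star h12).trans (star_zero _))

lemma exists_not_mem_span (x y : C3) : ∃ z : C3, z ∉ Submodule.span ℂ ({x, y} : Set C3) := by
  by_contra hcon
  push Not at hcon
  have htop : Submodule.span ℂ ({x, y} : Set C3) = ⊤ := by
    rw [eq_top_iff]; exact fun z _ => hcon z
  have h1 := finrank_span_finset_le_card (R := ℂ) ({x, y} : Finset C3)
  have h2 : (({x, y} : Finset C3) : Set C3) = {x, y} := by simp
  rw [Set.finrank, h2, htop, finrank_top] at h1
  have h3 : Module.finrank ℂ C3 = 3 := by simp
  have h4 := Finset.card_le_two (a := x) (b := y)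
  omega

lemma linearIndependent_cons_of_pair {x y z : C3} (hxy : LinearIndependent ℂ ![x, y])
    (hz : z ∉ Submodule.span ℂ ({x, y} : Set C3)) : LinearIndependent ℂ ![z, x, y] := by
  have : (![z, x, y] : Fin 3 → C3) = Fin.cons z ![x, y] := rfl
  rw [this]
  refine hxy.finCons ?_
  simpa [Matrix.range_cons, Set.pair_comm] using hz

lemma exists_basis_of_pair {x y : C3} (hxy : LinearIndependent ℂ ![x, y]) :
    ∃ z, LinearIndependent ℂ ![z, x, y] := by
  obtain ⟨z, hz⟩ := exists_not_mem_span x y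
  exact ⟨z, linearIndependent_cons_of_pair hxy hz⟩

lemma exists_pair_of_ne_zero {x : C3} (hx : x ≠ 0) : ∃ y, LinearIndependent ℂ ![x, y] := by
  obtain ⟨y, hy⟩ := exists_not_mem_span x x
  refine ⟨y, ?_⟩
  rw [LinearIndependent.pair_iff' hx]
  rintro a rfl
  exact hy (Submodule.smul_mem _ _ (Submodule.subset_span (by simp)))

/-- For every real 2-plane there is a vertical vector whose form does not vanish on it. -/
lemma IsModel.exists_sig_ne_zero (h : IsModel φ κ) {x y : C3} (hxy : LinearIndependent ℝ ![x, y]) :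
    ∃ w, sig (κ (0, w)) x y ≠ 0 := by
  have hx : x ≠ 0 := hxy.ne_zero 0
  by_cases hc : LinearIndependent ℂ ![x, y]
  · obtain ⟨z, hz⟩ := exists_basis_of_pair hc
    obtain ⟨w, hw⟩ := h.exists_vertical hz
      (B' := !![0, 0, 0; 0, 0, Complex.I; 0, -Complex.I, 0]) (by
        ext i j; fin_cases i <;> fin_cases j <;> simp)
    refine ⟨w, ?_⟩
    have := hw 1 2 (by decide)
    change sesq _ x y = Complex.I at this
    rw [sig, this]
    simp
  · rw [LinearIndependent.pair_iff' hx] at hc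
    push Not at hc
    obtain ⟨a, rfl⟩ := hc
    have ha : a.im ≠ 0 := by
      intro ha
      rw [LinearIndependent.pair_iff' hx] at hxy
      refine hxy a.re ?_
      have : a = (a.re : ℂ) := by apply Complex.ext <;> simp [ha]
      conv_rhs => rw [this]
      ext; simp
    obtain ⟨z, hz⟩ := exists_pair_of_ne_zero hx
    obtain ⟨z', hz'⟩ := exists_basis_of_pair hz
    obtain ⟨w, hw⟩ := h.exists_vertical hz' (B' := 1) Matrix.isHermitian_one
    refine ⟨w, ?_⟩
    have := hw 1 1 (by decide)
    change sesq _ x x = 1 at this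
    rw [sig, sesq_smul_right, this]
    simpa using ha

lemma verticalSurj_of_le_one {j : ℕ} (hj : j ≤ 1) (x : Fin j → C3) : VerticalSurj κ x := by
  intro d
  refine ⟨0, fun i i' hlt => ?_⟩
  have := i'.isLt
  omega

lemma sig_smul_vertical (c : ℝ) (w : W) (x y : C3) :
    sig (κ (0, c • w)) x y = c * sig (κ (0, w)) x y := by
  have : ((0 : C3), c • w) = c • ((0 : C3), w) := by simp
  rw [this, map_smul, sig_smul_mat]

lemma sig_add_vertical (w w' : W) (x y : C3) :
    sig (κ (0, w + w')) x y = sig (κ (0, w)) x y + sig (κ (0, w')) x y := by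
  have : ((0 : C3), w + w') = ((0 : C3), w) + ((0 : C3), w') := by simp
  rw [this, map_add, sig_add_mat]

lemma IsModel.verticalSurj_two (h : IsModel φ κ) {x : Fin 2 → C3} (hx : LinearIndependent ℝ x) :
    VerticalSurj κ x := by
  intro d
  have hx' : x = ![x 0, x 1] := by ext i; fin_cases i <;> rfl
  rw [hx'] at hx
  obtain ⟨w, hw⟩ := h.exists_sig_ne_zero hx
  refine ⟨(d 0 1 / sig (κ (0, w)) (x 0) (x 1)) • w, fun i i' hlt _ => ?_⟩
  fin_cases i <;> fin_cases i' <;> first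
    | exact absurd hlt (by decide)
    | (change sig _ (x 0) (x 1) = d 0 1
       rw [sig_smul_vertical, div_mul_cancel₀ _ hw])

/-- A linear map to `ι → ℝ` is onto if its components are linearly independent. -/
lemma surjective_of_forall_sum_eq_zero {ι U : Type*} [Fintype ι] [AddCommGroup U] [Module ℝ U]
    (L : U →ₗ[ℝ] ι → ℝ) (h : ∀ c : ι → ℝ, (∀ u, ∑ i, c i * L u i = 0) → c = 0) :
    Function.Surjective L := by
  classical
  rw [← LinearMap.range_eq_top]
  by_contra hne
  obtain ⟨f, hf, hle⟩ := Submodule.exists_le_ker_of_lt_top _ (lt_top_iff_ne_top.2 hne)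
  refine hf ?_
  have hfe : ∀ v, f v = ∑ i, f (Pi.single i 1) * v i := by
    intro v
    conv_lhs => rw [← Finset.univ_sum_single v, map_sum]
    refine Finset.sum_congr rfl fun i _ => ?_
    have : (Pi.single i (v i) : ι → ℝ) = v i • Pi.single i 1 := by
      rw [← Pi.single_smul, smul_eq_mul, mul_one]
    rw [this, map_smul, smul_eq_mul, mul_comm]
  have h0 := h (fun i => f (Pi.single i 1)) fun u => by
    rw [← hfe]
    exact hle ⟨u, rfl⟩
  ext i
  simpa using congrFun h0 i

/-- In a real 3-space every bivector is decomposable. So a linear relation among the values on the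
three pairs would be the vanishing of all vertical forms on one 2-plane, contrary to
`IsModel.exists_sig_ne_zero`. -/
lemma IsModel.verticalSurj_three (h : IsModel φ κ) {x : Fin 3 → C3}
    (hx : LinearIndependent ℝ x) : VerticalSurj κ x := by
  have hpair : ∀ a b c : C3, LinearIndependent ℝ ![a, b, c] → ∀ r s : ℝ,
      LinearIndependent ℝ ![a + r • c, b + s • c] := by
    intro a b c habc r s
    rw [LinearIndependent.pair_iff]
    intro p q hpq
    have := Fintype.linearIndependent_iff.1 habc ![p, q, p * r + q * s] (by
      simp only [Fin.sum_univ_three, Matrix.cons_val]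
      rw [← hpq]
      module)
    exact ⟨this 0, this 1⟩
  have hx' : LinearIndependent ℝ ![x 0, x 1, x 2] := by
    convert hx using 1
    ext i; fin_cases i <;> rfl
  have hx'' : LinearIndependent ℝ ![x 1, x 2, x 0] := by
    have := hx.comp (finRotate 3) (finRotate 3).injective
    convert this using 1
    ext i; fin_cases i <;> rfl
  have hx''' : LinearIndependent ℝ ![x 2, x 0, x 1] := by
    have := hx.comp (finRotate 3 ∘ finRotate 3)
      ((finRotate 3).injective.comp (finRotate 3).injective)
    convert this using 1
    ext i; fin_cases i <;> rfl
  let L : W →ₗ[ℝ] Fin 3 → ℝ :=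
    { toFun := fun w => ![sig (κ (0, w)) (x 1) (x 2), sig (κ (0, w)) (x 2) (x 0),
        sig (κ (0, w)) (x 0) (x 1)]
      map_add' := fun w w' => by
        ext i; fin_cases i <;> simp [sig_add_vertical]
      map_smul' := fun r w => by
        ext i; fin_cases i <;> simp [sig_smul_vertical] }
  have key : ∀ a b c : C3, LinearIndependent ℝ ![a, b, c] → ∀ p q r : ℝ,
      (∀ w, p * sig (κ (0, w)) b c + q * sig (κ (0, w)) c a + r * sig (κ (0, w)) a b = 0) →
      r = 0 := by
    intro a b c habc p q r hw
    by_contra hr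
    -- The relation divided by `r` is the value on the pair `a - (p/r) c`, `b - (q/r) c`.
    obtain ⟨w, hw'⟩ := h.exists_sig_ne_zero (hpair a b c habc (-(p / r)) (-(q / r)))
    refine hw' ?_
    have h1 := hw w
    have h2 := sig_antisymm (h.herm (0, w)) c a
    have h3 := sig_antisymm (h.herm (0, w)) b c
    have h4 : sig (κ (0, w)) c c = 0 := by
      have := sig_antisymm (h.herm (0, w)) c c; linarith
    simp only [sig_add_left, sig_add_right, sig_smul_left, sig_smul_right, h2, h3, h4]
    field_simp
    linear_combination r * h1
  have hsurj : Function.Surjective L := by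
    refine surjective_of_forall_sum_eq_zero L fun c hc => ?_
    have hc' : ∀ w, c 0 * sig (κ (0, w)) (x 1) (x 2) + c 1 * sig (κ (0, w)) (x 2) (x 0) +
        c 2 * sig (κ (0, w)) (x 0) (x 1) = 0 := fun w => by
      have := hc w
      simpa [Fin.sum_univ_three, L] using this
    ext i
    fin_cases i
    · exact key _ _ _ hx'' (c 1) (c 2) (c 0) fun w => by linarith [hc' w]
    · exact key _ _ _ hx''' (c 2) (c 0) (c 1) fun w => by linarith [hc' w]
    · exact key _ _ _ hx' (c 0) (c 1) (c 2) hc'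
  intro d
  -- The pairs of `L` are in cyclic order, so the middle one is `(2, 0)` and carries a minus sign.
  obtain ⟨w, hw⟩ := hsurj ![d 1 2, -d 0 2, d 0 1]
  refine ⟨w, fun i i' hlt _ => ?_⟩
  have h0 : sig (κ (0, w)) (x 1) (x 2) = d 1 2 := congrFun hw 0
  have h1 : sig (κ (0, w)) (x 2) (x 0) = -d 0 2 := congrFun hw 1
  have h2 : sig (κ (0, w)) (x 0) (x 1) = d 0 1 := congrFun hw 2
  have h3 := sig_antisymm (h.herm (0, w)) (x 2) (x 0)
  fin_cases i <;> fin_cases i' <;> first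
    | exact absurd hlt (by decide)
    | assumption
    | (change sig _ (x 0) (x 2) = d 0 2
       linarith)

end Adapted

/-! ### Real hyperplanes of `ℂ³` and polar spaces of transverse 5-planes -/

section FivePlanes

variable {W : Type*} [NormedAddCommGroup W] [NormedSpace ℝ W]
variable {φ : (C3 × W) [⋀^Fin 3]→L[ℝ] ℝ} {κ : C3 × W →ₗ[ℝ] Matrix (Fin 3) (Fin 3) ℂ}

lemma finrank_C3 : Module.finrank ℝ C3 = 6 := by
  rw [finrank_real_of_complex]
  simp

/-- The complex span of `s` has real dimension at most `2 * s.card`, too small to contain `P`. -/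
lemma exists_mem_not_mem_span (P : Submodule ℝ C3) (s : Finset C3)
    (hs : 2 * s.card < Module.finrank ℝ P) :
    ∃ z ∈ P, z ∉ Submodule.span ℂ (s : Set C3) := by
  by_contra hcon
  push Not at hcon
  have hle : P ≤ (Submodule.span ℂ (s : Set C3)).restrictScalars ℝ := hcon
  have h1 := Submodule.finrank_mono hle
  have h2 : Module.finrank ℝ ((Submodule.span ℂ (s : Set C3)).restrictScalars ℝ) =
      2 * Module.finrank ℂ (Submodule.span ℂ (s : Set C3)) :=
    finrank_real_of_complex (Submodule.span ℂ (s : Set C3))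
  have h3 := finrank_span_finset_le_card (R := ℂ) s
  rw [Set.finrank] at h3
  omega

/-- A real hyperplane of `ℂ³` has a basis that is part of a basis adapted to a complex basis. -/
lemma exists_adaptedVec (P : Submodule ℝ C3) (hP : Module.finrank ℝ P = 5) :
    ∃ e : Fin 3 → C3, LinearIndependent ℂ e ∧
      ∀ i : Fin 5, adaptedVec e (Fin.castLE (by norm_num) i) ∈ P := by
  let J : C3 ≃ₗ[ℝ] C3 :=
    (LinearEquiv.smulOfNeZero ℂ C3 Complex.I Complex.I_ne_zero).restrictScalars ℝ
  have hJ : ∀ x, J x = Complex.I • x := fun x => rfl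
  -- The largest complex subspace of `P`. Two hyperplanes of a 6-dimensional space meet in real
  -- dimension at least 4, so it contains two complex independent vectors.
  let Q : Submodule ℝ C3 := P ⊓ P.comap (J : C3 →ₗ[ℝ] C3)
  have hcomap : Module.finrank ℝ (P.comap (J : C3 →ₗ[ℝ] C3)) = 5 := by
    rw [← hP]
    have : P.comap (J : C3 →ₗ[ℝ] C3) = P.map (J.symm : C3 →ₗ[ℝ] C3) :=
      (Submodule.map_equiv_eq_comap_symm J.symm P).symm
    rw [this]
    exact LinearEquiv.finrank_map_eq J.symm P
  have hQ : 4 ≤ Module.finrank ℝ Q := by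
    have h1 := Submodule.finrank_sup_add_finrank_inf_eq P (P.comap (J : C3 →ₗ[ℝ] C3))
    have h2 := Submodule.finrank_le (P ⊔ P.comap (J : C3 →ₗ[ℝ] C3))
    rw [finrank_C3] at h2
    change 4 ≤ Module.finrank ℝ (P ⊓ P.comap (J : C3 →ₗ[ℝ] C3) : Submodule ℝ C3)
    omega
  have hQI : ∀ x ∈ Q, x ∈ P ∧ Complex.I • x ∈ P := fun x hx => ⟨hx.1, hx.2⟩
  obtain ⟨a, ha, ha0⟩ := exists_mem_not_mem_span Q ∅ (by simp; omega)
  obtain ⟨b, hb, hb0⟩ := exists_mem_not_mem_span Q {a} (by simp; omega)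
  obtain ⟨c, hc, hc0⟩ := exists_mem_not_mem_span P {a, b} (by
    have := Finset.card_le_two (a := a) (b := b); omega)
  have ha1 : a ≠ 0 := by simpa using ha0
  have hab : LinearIndependent ℂ ![a, b] := by
    rw [LinearIndependent.pair_iff' ha1]
    rintro r rfl
    exact hb0 (Submodule.smul_mem _ _ (Submodule.subset_span (by simp)))
  have hc1 : -Complex.I • c ∉ Submodule.span ℂ ({a, b} : Set C3) := by
    intro hmem
    refine hc0 ?_
    have := Submodule.smul_mem _ Complex.I hmem
    rw [smul_smul, mul_neg, Complex.I_mul_I, neg_neg, one_smul] at this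
    simpa using this
  -- The adapted basis starts with `i e₀`, which has to be the vector `c` of `P`; hence `e₀ = -i c`.
  refine ⟨![-Complex.I • c, a, b], linearIndependent_cons_of_pair hab hc1, fun i => ?_⟩
  fin_cases i
  · change Complex.I • (-Complex.I • c) ∈ P
    rwa [smul_smul, mul_neg, Complex.I_mul_I, neg_neg, one_smul]
  exacts [(hQI a ha).1, (hQI a ha).2, (hQI b hb).1, (hQI b hb).2]

lemma linearIndependent_adaptedVec {e : Fin 3 → C3} (he : LinearIndependent ℂ e) :
    LinearIndependent ℝ (adaptedVec e) := by
  rw [Fintype.linearIndependent_iff]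
  intro g hg
  have h1 := Fintype.linearIndependent_iff.1 he
    ![(g 5 : ℂ) + g 0 * Complex.I, (g 1 : ℂ) + g 2 * Complex.I, (g 3 : ℂ) + g 4 * Complex.I] (by
      rw [← hg]
      ext i
      simp [Fin.sum_univ_succ, adaptedVec]
      ring)
  have h2 : ∀ x y : ℝ, (x : ℂ) + y * Complex.I = 0 → x = 0 ∧ y = 0 := fun x y h =>
    ⟨by simpa using congrArg Complex.re h, by simpa using congrArg Complex.im h⟩
  have e0 := h2 _ _ (h1 0)
  have e1 := h2 _ _ (h1 1)
  have e2 := h2 _ _ (h1 2)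
  intro i
  fin_cases i
  exacts [e0.2, e1.1, e1.2, e2.1, e2.2, e0.1]

/-- The 3-form has no component of type `(3,0)`. -/
lemma IsModel.type_identity (h : IsModel φ κ) {a b c a' b' c' : C3 × W}
    (ha : a'.1 = Complex.I • a.1) (hb : b'.1 = Complex.I • b.1) (hc : c'.1 = Complex.I • c.1) :
    triLin φ a b c - triLin φ a b' c' - triLin φ a' b' c - triLin φ a' b c' = 0 := by
  simp only [h.formula, ha, hb, hc, sig_smul_I]
  simp only [sig_smul_I_left]
  ring

/-- A basis of a subspace on which the first projection is injective can be lifted. -/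
lemma exists_lift {E : Submodule ℝ (C3 × W)} {ι : Type*} (x : ι → C3)
    (hx : ∀ i, x i ∈ E.map (LinearMap.fst ℝ C3 W)) :
    ∃ g : ι → C3 × W, (∀ i, g i ∈ E) ∧ ∀ i, (g i).1 = x i := by
  choose g hg using hx
  exact ⟨g, fun i => (hg i).1, fun i => (hg i).2⟩

lemma finrank_map_fst {E : Submodule ℝ (C3 × W)} (hE : InjOn Prod.fst (E : Set (C3 × W))) :
    Module.finrank ℝ (E.map (LinearMap.fst ℝ C3 W)) = Module.finrank ℝ E := by
  rw [← LinearMap.range_domRestrict]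
  refine LinearMap.finrank_range_of_inj fun x y hxy => Subtype.ext (hE x.2 y.2 hxy)

lemma linearIndependent_of_fst {ι : Type*} {g : ι → C3 × W}
    (hg : LinearIndependent ℝ fun i => (g i).1) : LinearIndependent ℝ g :=
  LinearIndependent.of_comp (LinearMap.fst ℝ C3 W) hg

lemma linearIndependent_fst {ι : Type*} {g : ι → C3 × W} (hg : LinearIndependent ℝ g)
    (hE : InjOn Prod.fst (Submodule.span ℝ (range g) : Set (C3 × W))) :
    LinearIndependent ℝ fun i => (g i).1 :=
  hg.map_injOn (LinearMap.fst ℝ C3 W) hE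

lemma injOn_fst_span {ι : Type*} {g : ι → C3 × W}
    (hg : LinearIndependent ℝ fun i => (g i).1) :
    InjOn Prod.fst (Submodule.span ℝ (range g) : Set (C3 × W)) := by
  have : LinearIndependent ℝ (LinearMap.fst ℝ C3 W ∘ g) := hg
  exact LinearMap.injOn_of_disjoint_ker le_rfl (Submodule.range_ker_disjoint this)

lemma span_eq_of_card_eq {V ι : Type*} [AddCommGroup V] [Module ℝ V] [Fintype ι] {g : ι → V}
    {E : Submodule ℝ V} [FiniteDimensional ℝ E] (hg : LinearIndependent ℝ g) (hmem : ∀ i, g i ∈ E)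
    (hcard : Module.finrank ℝ E = Fintype.card ι) : Submodule.span ℝ (range g) = E := by
  refine Submodule.eq_of_le_of_finrank_eq (Submodule.span_le.2 ?_) ?_
  · rintro _ ⟨i, rfl⟩; exact hmem i
  · rw [finrank_span_eq_card hg, hcard]

/-- A transverse 5-plane has a basis adapted to a complex basis. -/
lemma exists_adapted_frame_five {E : Submodule ℝ (C3 × W)} [FiniteDimensional ℝ E]
    (hE : InjOn Prod.fst (E : Set (C3 × W))) (h5 : Module.finrank ℝ E = 5) :
    ∃ (e : Fin 3 → C3) (g : Fin 5 → C3 × W), LinearIndependent ℂ e ∧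
      (∀ i, (g i).1 = adaptedVec e (Fin.castLE (by norm_num) i)) ∧
      LinearIndependent ℝ g ∧ Submodule.span ℝ (range g) = E := by
  obtain ⟨e, he, hmem⟩ := exists_adaptedVec (E.map (LinearMap.fst ℝ C3 W))
    ((finrank_map_fst hE).trans h5)
  obtain ⟨g, hgE, hg⟩ := exists_lift _ hmem
  have hli : LinearIndependent ℝ g := by
    refine linearIndependent_of_fst ?_
    simp only [hg]
    exact (linearIndependent_adaptedVec he).comp _ (Fin.castLE_injective _)
  exact ⟨e, g, he, hg, hli, span_eq_of_card_eq hli hgE (by simpa using h5)⟩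

/-- Against an adapted frame of the 5-plane, eight of the polar conditions already determine all the
free coefficients of the vertical form. -/
lemma IsModel.vertical_eq_zero_of_mem_polarSpace (h : IsModel φ κ) {E : Submodule ℝ (C3 × W)}
    [FiniteDimensional ℝ E] (hE : InjOn Prod.fst (E : Set (C3 × W)))
    (h5 : Module.finrank ℝ E = 5) {w : W} (hw : ((0 : C3), w) ∈ polarSpace φ E) : w = 0 := by
  obtain ⟨e, g, he, hg, hli, hspan⟩ := exists_adapted_frame_five hE h5
  refine h.vertical_eq_zero_of_sig he fun i i' _ _ => ?_
  rw [← hg, ← hg, ← h.vertical]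
  have hmem : ∀ j, g j ∈ E := fun j => hspan ▸ Submodule.subset_span ⟨j, rfl⟩
  exact hw _ (hmem i) _ (hmem i')

/-- The tangent space is the sum of the vertical space and the polar space of a transverse
integral 5-plane. -/
lemma IsModel.exists_sub_vertical_mem_polarSpace (h : IsModel φ κ) {E : Submodule ℝ (C3 × W)}
    [FiniteDimensional ℝ E] (hE : InjOn Prod.fst (E : Set (C3 × W)))
    (h5 : Module.finrank ℝ E = 5) (hφ : VanishesOn φ E) (v : C3 × W) :
    ∃ w : W, v - ((0 : C3), w) ∈ polarSpace φ E := by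
  obtain ⟨e, g, he, hg, hli, hspan⟩ := exists_adapted_frame_five hE h5
  have hmem : ∀ j, g j ∈ E := fun j => hspan ▸ Submodule.subset_span ⟨j, rfl⟩
  have g0 : (g 0).1 = Complex.I • e 0 := hg 0
  have g1 : (g 1).1 = e 1 := hg 1
  have g2 : (g 2).1 = Complex.I • e 1 := hg 2
  have g3 : (g 3).1 = e 2 := hg 3
  have g4 : (g 4).1 = Complex.I • e 2 := hg 4
  have hII : ∀ x : C3, Complex.I • Complex.I • x = -x := fun x => by
    rw [smul_smul, Complex.I_mul_I, neg_one_smul]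
  set v₀ : C3 × W := (e 0, 0) with hv₀
  set d : Fin 5 → Fin 5 → ℝ := fun i j => triLin φ v₀ (g i) (g j) with hd
  have hz : ∀ i j k, triLin φ (g i) (g j) (g k) = 0 :=
    fun i j k => hφ _ (hmem i) _ (hmem j) _ (hmem k)
  -- Multiplication by `i` takes the horizontal part of `v₀` to that of `g 0`. In the type identity
  -- the two terms with `g 0` lie on `E` and vanish, leaving a relation between two values of the
  -- contraction with `v₀`; it matches the one satisfied by vertical forms.
  have d24 : d 2 4 = d 1 3 := by
    have := h.type_identity (a := v₀) (b := g 1) (c := g 3) (a' := g 0) (b' := g 2) (c' := g 4)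
      g0 (by rw [g1, g2]) (by rw [g3, g4])
    rw [hz, hz] at this
    simp only [hd]
    linarith
  have d23 : d 2 3 = -d 1 4 := by
    -- Here `b' = -g 1` because `i · (i e₁) = -e₁`.
    have := h.type_identity (a := v₀) (b := g 2) (c := g 3) (a' := g 0) (b' := -g 1) (c' := g 4)
      g0 (by rw [Prod.fst_neg, g1, g2, hII]) (by rw [g3, g4])
    simp only [map_neg, LinearMap.neg_apply, hz] at this
    simp only [hd]
    linarith
  obtain ⟨w, hw⟩ := h.verticalSurj_five he d
  have hw' : v₀ - ((0 : C3), w) ∈ polarSpace φ E := by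
    rw [← hspan, polarSpace_span_lt]
    intro i j hij
    rw [map_sub, LinearMap.sub_apply, LinearMap.sub_apply, sub_eq_zero, h.vertical, hg, hg]
    by_cases hi : i.val = 2
    · have h13 : sig (κ (0, w)) (e 1) (e 2) = d 1 3 := hw 1 3 (by decide) (by decide)
      have h14 : sig (κ (0, w)) (e 1) (Complex.I • e 2) = d 1 4 := hw 1 4 (by decide) (by decide)
      obtain rfl : i = 2 := Fin.ext hi
      obtain rfl | rfl : j = 3 ∨ j = 4 := by omega
      · change d 2 3 = sig (κ (0, w)) (Complex.I • e 1) (e 2)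
        rw [sig_smul_I_left, h14, d23]
      · change d 2 4 = sig (κ (0, w)) (Complex.I • e 1) (Complex.I • e 2)
        rw [sig_smul_I, h13, d24]
    · exact (hw i j hij fun hh => hi hh.2).symm
  have htop : Submodule.span ℂ (range e) = ⊤ :=
    he.span_eq_top_of_card_eq_finrank' (by simp)
  obtain ⟨z, hz'⟩ := (Submodule.mem_span_range_iff_exists_fun ℂ).1
    (htop ▸ Submodule.mem_top : v.1 ∈ Submodule.span ℂ (range e))
  set f : C3 × W := (z 0).im • g 0 + (z 1).re • g 1 + (z 1).im • g 2 + (z 2).re • g 3 +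
    (z 2).im • g 4 with hf
  have hfE : f ∈ E :=
    E.add_mem (E.add_mem (E.add_mem (E.add_mem (E.smul_mem _ (hmem 0)) (E.smul_mem _ (hmem 1)))
      (E.smul_mem _ (hmem 2))) (E.smul_mem _ (hmem 3))) (E.smul_mem _ (hmem 4))
  have hv : v.1 = ((z 0).re • v₀ + f).1 := by
    rw [← hz']
    ext i
    simp [hf, hv₀, g0, g1, g2, g3, g4, Fin.sum_univ_three]
    conv_lhs => rw [← Complex.re_add_im (z 0), ← Complex.re_add_im (z 1), ← Complex.re_add_im (z 2)]
    ring
  set w' := (v - ((z 0).re • v₀ + f)).2 with hw''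
  have hvert : v - ((z 0).re • v₀ + f) = ((0 : C3), w') := by
    refine Prod.ext ?_ rfl
    rw [Prod.fst_sub, hv, sub_self]
  refine ⟨w' + (z 0).re • w, ?_⟩
  have hsplit : v - ((0 : C3), w' + (z 0).re • w) = (z 0).re • (v₀ - ((0 : C3), w)) + f := by
    have h1 : v = (z 0).re • v₀ + f + ((0 : C3), w') := by rw [← hvert]; abel
    have h2 : ((0 : C3), w' + (z 0).re • w) = ((0 : C3), w') + (z 0).re • ((0 : C3), w) := by simp
    rw [h2]
    nth_rewrite 1 [h1]
    rw [smul_sub]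
    abel
  rw [hsplit]
  exact Submodule.add_mem _ (Submodule.smul_mem _ _ hw') (hφ.le_polarSpace hfE)

end FivePlanes

/-! ### Dimensions of the polar spaces in the model -/

section PolarDimension

variable {W : Type*} [NormedAddCommGroup W] [NormedSpace ℝ W]
variable {φ : (C3 × W) [⋀^Fin 3]→L[ℝ] ℝ} {κ : C3 × W →ₗ[ℝ] Matrix (Fin 3) (Fin 3) ℂ}

/-- The increasing pairs of indices. -/
abbrev IncPair (j : ℕ) : Type := {a : Fin j × Fin j // a.1 < a.2}

/-- The values of the contraction of `φ` with a vector on the pairs of vectors of a frame. -/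
def contractPairs {V : Type*} [AddCommGroup V] [Module ℝ V] [TopologicalSpace V]
    (φ : V [⋀^Fin 3]→L[ℝ] ℝ) {j : ℕ} (g : Fin j → V) :
    V →ₗ[ℝ] IncPair j → ℝ :=
  LinearMap.pi fun a => ((triLin φ).flip (g a.1.1)).flip (g a.1.2)

lemma contractPairs_apply {V : Type*} [AddCommGroup V] [Module ℝ V] [TopologicalSpace V]
    (φ : V [⋀^Fin 3]→L[ℝ] ℝ) {j : ℕ} (g : Fin j → V) (v : V) (a : IncPair j) :
    contractPairs φ g v a = triLin φ v (g a.1.1) (g a.1.2) := rfl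

lemma ker_contractPairs {V : Type*} [AddCommGroup V] [Module ℝ V] [TopologicalSpace V]
    (φ : V [⋀^Fin 3]→L[ℝ] ℝ) {j : ℕ} (g : Fin j → V) :
    LinearMap.ker (contractPairs φ g) = polarSpace φ (Submodule.span ℝ (range g)) := by
  ext v
  rw [LinearMap.mem_ker, polarSpace_span_lt]
  constructor
  · exact fun h i j hij => congrFun h ⟨(i, j), hij⟩
  · exact fun h => funext fun a => h _ _ a.2

/-- Vertical vectors alone attain all values. The case of five vectors is excluded because two pairs
are then left out of `VerticalSurj`. -/
lemma IsModel.contractPairs_surjective (h : IsModel φ κ) {j : ℕ} (hj : j ≠ 5)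
    {g : Fin j → C3 × W} (hg : VerticalSurj κ fun i => (g i).1) :
    Function.Surjective (contractPairs φ g) := by
  intro d
  obtain ⟨w, hw⟩ := hg fun i i' => if hlt : i < i' then d ⟨(i, i'), hlt⟩ else 0
  refine ⟨(0, w), funext fun a => ?_⟩
  rw [contractPairs_apply, h.vertical, hw _ _ a.2 fun hh => hj hh.1, dif_pos a.2]

lemma IsModel.verticalSurj_of_le_three (h : IsModel φ κ) {j : ℕ} (hj : j ≤ 3) {x : Fin j → C3}
    (hx : LinearIndependent ℝ x) : VerticalSurj κ x := by
  interval_cases j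
  exacts [verticalSurj_of_le_one (by norm_num) x, verticalSurj_of_le_one (by norm_num) x,
    h.verticalSurj_two hx, h.verticalSurj_three hx]

lemma exists_frame {V : Type*} [AddCommGroup V] [Module ℝ V] {p : ℕ} {E : Submodule ℝ V}
    [FiniteDimensional ℝ E] (hp : Module.finrank ℝ E = p) :
    ∃ g : Fin p → V, LinearIndependent ℝ g ∧ Submodule.span ℝ (range g) = E := by
  let b := Module.finBasisOfFinrankEq ℝ E hp
  have hli : LinearIndependent ℝ fun i => (b i : V) :=
    b.linearIndependent.map' E.subtype (Submodule.ker_subtype E)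
  exact ⟨_, hli, span_eq_of_card_eq hli (fun i => (b i).2) (by simpa using hp)⟩

/-- The vertical space. -/
def verticalSpace (W : Type*) [NormedAddCommGroup W] [NormedSpace ℝ W] : Submodule ℝ (C3 × W) :=
  LinearMap.range (LinearMap.inr ℝ C3 W)

lemma finrank_verticalSpace : Module.finrank ℝ (verticalSpace W) = Module.finrank ℝ W :=
  LinearMap.finrank_range_of_inj LinearMap.inr_injective

variable [FiniteDimensional ℝ W]

lemma finrank_polarSpace_add_rank {j : ℕ} (g : Fin j → C3 × W) :
    Module.finrank ℝ (LinearMap.range (contractPairs φ g)) +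
      Module.finrank ℝ (polarSpace φ (Submodule.span ℝ (range g))) =
        6 + Module.finrank ℝ W := by
  rw [← ker_contractPairs, LinearMap.finrank_range_add_finrank_ker, Module.finrank_prod, finrank_C3]

lemma finrank_polarSpace_of_surjective {j : ℕ} {g : Fin j → C3 × W}
    (hs : Function.Surjective (contractPairs φ g)) :
    Fintype.card (IncPair j) + Module.finrank ℝ (polarSpace φ (Submodule.span ℝ (range g))) =
        6 + Module.finrank ℝ W := by
  rw [← finrank_polarSpace_add_rank (φ := φ) g, LinearMap.range_eq_top.2 hs, finrank_top]
  simp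

lemma le_finrank_polarSpace {j : ℕ} (g : Fin j → C3 × W) :
    6 + Module.finrank ℝ W ≤
      Fintype.card (IncPair j) +
        Module.finrank ℝ (polarSpace φ (Submodule.span ℝ (range g))) := by
  rw [← finrank_polarSpace_add_rank (φ := φ) g]
  have h1 := Submodule.finrank_le (LinearMap.range (contractPairs φ g))
  rw [Module.finrank_fintype_fun_eq_card] at h1
  omega

/-- The polar space is a complement of the vertical space, hence has the dimension 6 of `ℂ³`. -/
lemma IsModel.finrank_polarSpace_five (h : IsModel φ κ) {E : Submodule ℝ (C3 × W)}
    (hE : InjOn Prod.fst (E : Set (C3 × W)))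
    (h5 : Module.finrank ℝ E = 5) (hφ : VanishesOn φ E) :
    Module.finrank ℝ (polarSpace φ E) = 6 := by
  have h1 := Submodule.finrank_sup_add_finrank_inf_eq (polarSpace φ E) (verticalSpace W)
  have hinf : polarSpace φ E ⊓ verticalSpace W = ⊥ := by
    rw [eq_bot_iff]
    rintro v ⟨hv, w, rfl⟩
    rw [LinearMap.inr_apply] at hv ⊢
    rw [h.vertical_eq_zero_of_mem_polarSpace hE h5 hv]
    exact Submodule.zero_mem _
  have hsup : polarSpace φ E ⊔ verticalSpace W = ⊤ := by
    rw [eq_top_iff]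
    intro v _
    obtain ⟨w, hw⟩ := h.exists_sub_vertical_mem_polarSpace hE h5 hφ v
    exact Submodule.mem_sup.2 ⟨_, hw, _, ⟨w, rfl⟩, sub_add_cancel _ _⟩
  rw [hinf, hsup, finrank_bot, finrank_top, finrank_verticalSpace, Module.finrank_prod, finrank_C3] at h1
  omega

/-- An integral 6-plane lies in its own polar space, which lies in that of any of its 5-planes, and
this has dimension 6. -/
lemma IsModel.finrank_polarSpace_six (h : IsModel φ κ) {E : Submodule ℝ (C3 × W)}
    (hE : InjOn Prod.fst (E : Set (C3 × W)))
    (h6 : Module.finrank ℝ E = 6) (hφ : VanishesOn φ E) :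
    Module.finrank ℝ (polarSpace φ E) = 6 := by
  refine le_antisymm ?_ (h6 ▸ Submodule.finrank_mono hφ.le_polarSpace)
  obtain ⟨g, hli, hg⟩ := exists_frame h6
  have hli' := hli.comp _ (Fin.castSucc_injective 5)
  set F := Submodule.span ℝ (range (g ∘ Fin.castSucc)) with hFdef
  have hFE : F ≤ E := hg ▸ Submodule.span_mono (range_comp_subset_range _ _)
  have hF : Module.finrank ℝ F = 5 := by simpa using finrank_span_eq_card hli'
  rw [← h.finrank_polarSpace_five (hE.mono hFE) hF (hφ.mono hFE)]
  exact Submodule.finrank_mono fun v hv a ha b hb => hv a (hFE ha) b (hFE hb)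

/-- The generic dimensions of the polar spaces. -/
def polarDims : Fin 7 → ℕ := ![14, 14, 13, 11, 8, 6, 6]

/-- For `p ≤ 3` the codimension is the full number of pairs, 0, 0, 1 or 3. For `p = 4` the six pairs
only bound it from above, which is the one case where equality may fail. -/
lemma IsModel.finrank_polarSpace (h : IsModel φ κ) (hW : Module.finrank ℝ W = 8) {p : Fin 7}
    {E : Submodule ℝ (C3 × W)} (hE : InjOn Prod.fst (E : Set (C3 × W)))
    (hp : Module.finrank ℝ E = p) (hφ : VanishesOn φ E) :
    polarDims p ≤ Module.finrank ℝ (polarSpace φ E) ∧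
      (p ≠ 4 → Module.finrank ℝ (polarSpace φ E) = polarDims p) := by
  obtain ⟨g, hli, rfl⟩ := exists_frame hp
  have hfst := linearIndependent_fst hli hE
  have hle : ∀ hj : (p : ℕ) ≤ 3, Fintype.card (IncPair p) +
      Module.finrank ℝ (polarSpace φ (Submodule.span ℝ (range g))) = 14 := fun hj => by
    rw [finrank_polarSpace_of_surjective (h.contractPairs_surjective (by omega)
      (h.verticalSurj_of_le_three hj hfst)), hW]
  have c2 : Fintype.card (IncPair 2) = 1 := by decide
  have c3 : Fintype.card (IncPair 3) = 3 := by decide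
  have c4 : Fintype.card (IncPair 4) = 6 := by decide
  fin_cases p
  · have := hle (by simp)
    have h2 : Module.finrank ℝ (polarSpace φ (Submodule.span ℝ (range g))) = 14 := by
      simpa using this
    exact ⟨h2.ge, fun _ => h2⟩
  · have := hle (by simp)
    have c1 : Fintype.card (IncPair 1) = 0 := by decide
    have h2 : Module.finrank ℝ (polarSpace φ (Submodule.span ℝ (range g))) = 14 := by
      change Fintype.card (IncPair 1) + _ = _ at this
      omega
    exact ⟨h2.ge, fun _ => h2⟩
  · have := hle (by simp)
    have h2 : Module.finrank ℝ (polarSpace φ (Submodule.span ℝ (range g))) = 13 := by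
      change Fintype.card (IncPair 2) + _ = _ at this
      omega
    exact ⟨h2.ge, fun _ => h2⟩
  · have := hle (by simp)
    have h2 : Module.finrank ℝ (polarSpace φ (Submodule.span ℝ (range g))) = 11 := by
      change Fintype.card (IncPair 3) + _ = _ at this
      omega
    exact ⟨h2.ge, fun _ => h2⟩
  · have := le_finrank_polarSpace (φ := φ) g
    refine ⟨?_, fun hne => absurd rfl hne⟩
    change _ ≤ Fintype.card (IncPair 4) + _ at this
    change 8 ≤ _
    omega
  · have h2 := h.finrank_polarSpace_five hE hp hφ
    exact ⟨h2.ge, fun _ => h2⟩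
  · have h2 := h.finrank_polarSpace_six hE hp hφ
    exact ⟨h2.ge, fun _ => h2⟩

lemma IsModel.finrank_polarSpace_four (h : IsModel φ κ) (hW : Module.finrank ℝ W = 8)
    {g : Fin 4 → C3 × W} (hg : VerticalSurj κ fun i => (g i).1) :
    Module.finrank ℝ (polarSpace φ (Submodule.span ℝ (range g))) = 8 := by
  have h1 := finrank_polarSpace_of_surjective (h.contractPairs_surjective (by norm_num) hg)
  have c4 : Fintype.card (IncPair 4) = 6 := by decide
  omega

end PolarDimension

/-! ### The projection and the tangent vectors of `K` in coordinates -/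

section Coordinates

variable {M : Type*} [TopologicalSpace M] [ChartedSpace C3 M] [IsManifold 𝓘(ℂ, C3) ω M]

lemma chartAt_apply {Υ : HolVolumeForm M} (k k' : SU3Bundle Υ) :
    chartAt KModel k k' = SU3Bundle.chartFun Υ k.1 k' := rfl

lemma proj_chartAt_symm {Υ : HolVolumeForm M} (k : SU3Bundle Υ) {y : KModel}
    (hy : y ∈ (chartAt KModel k).target) :
    ((chartAt KModel k).symm y).1 = (chartAt C3 k.1).symm y.1 := by
  have h1 := (chartAt KModel k).right_inv hy
  have h2 : ((chartAt KModel k).symm y).1 ∈ (chartAt C3 k.1).source :=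
    (chartAt KModel k).map_target hy
  rw [chartAt_apply] at h1
  have h3 : chartAt C3 k.1 ((chartAt KModel k).symm y).1 = y.1 := congrArg Prod.fst h1
  rw [← h3, (chartAt C3 k.1).left_inv h2]

lemma proj_eqOn {Υ : HolVolumeForm M} (k : SU3Bundle Υ) {k' : SU3Bundle Υ}
    (hk : k' ∈ (chartAt KModel k).source) :
    k'.proj = (chartAt C3 k.1).symm (chartAt KModel k k').1 :=
  ((chartAt C3 k.1).left_inv hk).symm

lemma continuous_proj (Υ : HolVolumeForm M) : Continuous (SU3Bundle.proj (Υ := Υ)) := by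
  rw [continuous_iff_continuousAt]
  intro k
  have hs := (chartAt KModel k).open_source.mem_nhds (mem_chart_source KModel k)
  have h1 : ContinuousAt (fun k' : SU3Bundle Υ => (chartAt C3 k.1).symm (chartAt KModel k k').1)
      k := by
    refine ContinuousAt.comp (f := fun k' : SU3Bundle Υ => (chartAt KModel k k').1)
      ((chartAt C3 k.1).symm.continuousAt ?_)
      (continuousAt_fst.comp ((chartAt KModel k).continuousAt (mem_chart_source KModel k)))
    exact (chartAt C3 k.1).map_source (mem_chart_source C3 k.1)
  refine h1.congr ?_
  filter_upwards [hs] with k' hk'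
  exact (proj_eqOn k hk').symm

/-- Points of one fibre lie in a common chart; points of different fibres are separated in `M`. The
cutoff construction on `K` needs this. -/
instance SU3Bundle.instT2Space [T2Space M] (Υ : HolVolumeForm M) : T2Space (SU3Bundle Υ) := by
  refine ⟨fun k k' hne => ?_⟩
  by_cases hp : k.1 = k'.1
  · have hk : k ∈ (chartAt KModel k).source := mem_chart_source KModel k
    have hk' : k' ∈ (chartAt KModel k).source := by
      change k'.1 ∈ (chartAt C3 k.1).source
      rw [← hp]
      exact mem_chart_source C3 k.1
    obtain ⟨U, U', hU, hU', hkU, hkU', hd⟩ :=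
      t2_separation (fun h => hne ((chartAt KModel k).injOn hk hk' h))
    refine ⟨_, _, (chartAt KModel k).isOpen_inter_preimage hU,
      (chartAt KModel k).isOpen_inter_preimage hU', ⟨hk, hkU⟩, ⟨hk', hkU'⟩, ?_⟩
    exact (hd.preimage _).mono inter_subset_right inter_subset_right
  · obtain ⟨U, U', hU, hU', hkU, hkU', hd⟩ := t2_separation hp
    exact ⟨_, _, hU.preimage (continuous_proj Υ), hU'.preimage (continuous_proj Υ), hkU, hkU',
      hd.preimage _⟩

lemma isManifold_real : IsManifold 𝓘(ℝ, C3) ∞ M := by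
  refine isManifold_of_contDiffOn _ _ _ ?_
  intro e e' he he'
  have h := (contDiffGroupoid ω 𝓘(ℂ, C3)).compatible he he'
  rw [contDiffGroupoid, mem_groupoid_of_pregroupoid] at h
  have h1 : ContDiffOn ℂ ω (𝓘(ℂ, C3) ∘ (e.symm ≫ₕ e') ∘ 𝓘(ℂ, C3).symm)
    (𝓘(ℂ, C3).symm ⁻¹' (e.symm ≫ₕ e').source ∩ range 𝓘(ℂ, C3)) := h.1
  exact (h1.restrict_scalars ℝ).of_le (m := ∞) le_top

/-- The derivative of the inverse of a chart, in the preferred chart at the image point. -/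
def chartSymmDeriv (x₀ : M) (z : C3) : C3 →L[ℂ] C3 :=
  fderiv ℂ (chartAt C3 ((chartAt C3 x₀).symm z) ∘ (chartAt C3 x₀).symm) z

lemma hasFDerivAt_chartSymmDeriv (x₀ : M) {z : C3} (hz : z ∈ (chartAt C3 x₀).target) :
    HasFDerivAt (chartAt C3 ((chartAt C3 x₀).symm z) ∘ (chartAt C3 x₀).symm)
      (chartSymmDeriv x₀ z) z := by
  have hs : z ∈ ((chartAt C3 x₀).symm.trans (chartAt C3 ((chartAt C3 x₀).symm z))).source :=
    ⟨hz, mem_chart_source C3 ((chartAt C3 x₀).symm z)⟩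
  have h := contDiffOn_ext_coord_change (I := 𝓘(ℂ, C3)) (n := ω)
    ((chartAt C3 x₀).symm z) x₀
  have h1 : ContDiffOn ℂ ω (chartAt C3 ((chartAt C3 x₀).symm z) ∘ (chartAt C3 x₀).symm)
      ((chartAt C3 x₀).symm.trans (chartAt C3 ((chartAt C3 x₀).symm z))).source := by
    simpa [extChartAt, OpenPartialHomeomorph.extend] using h
  exact ((h1.contDiffAt (OpenPartialHomeomorph.open_source _ |>.mem_nhds hs)).differentiableAt
    (by simp)).hasFDerivAt

lemma mfderiv_chartAt_symm_complex (x₀ : M) {z : C3} (hz : z ∈ (chartAt C3 x₀).target) :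
    (mfderiv 𝓘(ℂ, C3) 𝓘(ℂ, C3) (chartAt C3 x₀).symm z : C3 →L[ℂ] C3) = chartSymmDeriv x₀ z :=
  HasMFDerivAt.mfderiv (I := 𝓘(ℂ, C3)) (I' := 𝓘(ℂ, C3)) (f := (chartAt C3 x₀).symm)
    ⟨(chartAt C3 x₀).symm.continuousAt hz,
      (hasFDerivAt_chartSymmDeriv x₀ hz).hasFDerivWithinAt⟩

/-- The inverse chart is complex differentiable, so its real derivative is the complex one with
scalars restricted. This links the real frame used for forms with the complex vectors `coordVec`. -/
lemma chartFrame_base (x₀ : M) {z : C3} (hz : z ∈ (chartAt C3 x₀).target) (v : C3) :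
    (chartFrame x₀ z v : C3) = chartSymmDeriv x₀ z v := by
  have h : mfderiv 𝓘(ℝ, C3) 𝓘(ℝ, C3) (chartAt C3 x₀).symm z =
      (chartSymmDeriv x₀ z).restrictScalars ℝ :=
    HasMFDerivAt.mfderiv (I := 𝓘(ℝ, C3)) (I' := 𝓘(ℝ, C3)) (f := (chartAt C3 x₀).symm)
      ⟨(chartAt C3 x₀).symm.continuousAt hz,
        ((hasFDerivAt_chartSymmDeriv x₀ hz).restrictScalars ℝ).hasFDerivWithinAt⟩
  exact congrArg (fun L : C3 →L[ℝ] C3 => L v) h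

lemma coordVec_eq_chartSymmDeriv (x₀ : M) {z : C3} (hz : z ∈ (chartAt C3 x₀).target) (i : Fin 3) :
    (coordVec x₀ ((chartAt C3 x₀).symm z) i : C3) = chartSymmDeriv x₀ z (Pi.single i 1) := by
  have : IsManifold 𝓘(ℂ, C3) 1 M := isManifold_one
  rw [← mfderiv_chartAt_symm_complex x₀ hz]
  have hx := (chartAt C3 x₀).map_target hz
  refine (coordVec_eq hx i).trans ((chartDeriv hx).symm_apply_eq.2 ?_)
  have h := (mdifferentiable_chart (I := 𝓘(ℂ, C3)) x₀).comp_symm_deriv hz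
  exact (congrArg (fun L : C3 →L[ℂ] C3 => L (Pi.single i 1)) h).symm

/-- In the charts of `K` the projection is `Prod.fst` followed by the inverse chart of `M`. Thus the
horizontal part of a tangent vector is its first component. -/
lemma projDeriv_chartFrame {Υ : HolVolumeForm M} (k : SU3Bundle Υ) {y : KModel}
    (hy : y ∈ (chartAt KModel k).target) (v : KModel) :
    (projDeriv ((chartAt KModel k).symm y) (chartFrame k y v) : C3) =
      chartSymmDeriv k.1 y.1 v.1 := by
  have : IsManifold 𝓘(ℝ, C3) ∞ M := isManifold_real
  rw [← chartFrame_base k.1 hy.1]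
  have hev : (SU3Bundle.proj ∘ (chartAt KModel k).symm) =ᶠ[𝓝 y]
      ((chartAt C3 k.1).symm ∘ (Prod.fst : KModel → C3)) := by
    filter_upwards [(chartAt KModel k).open_target.mem_nhds hy] with z hz
    exact proj_chartAt_symm k hz
  have hdP : MDifferentiableAt 𝓘(ℝ, KModel) 𝓘(ℝ, C3) (SU3Bundle.proj (Υ := Υ))
      ((chartAt KModel k).symm y) := by
    have hk := (chartAt KModel k).map_target hy
    have h1 : MDifferentiableAt 𝓘(ℝ, KModel) 𝓘(ℝ, C3)
        ((chartAt C3 k.1).symm ∘ (Prod.fst : KModel → C3) ∘ chartAt KModel k)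
        ((chartAt KModel k).symm y) := by
      refine MDifferentiableAt.comp (I' := 𝓘(ℝ, C3)) _ ?_
        (MDifferentiableAt.comp (I' := 𝓘(ℝ, KModel)) _ ?_ (mdifferentiableAt_chartAt k hk))
      · refine mdifferentiableAt_chartAt_symm k.1 ?_
        simp only [Function.comp_apply, (chartAt KModel k).right_inv hy]
        exact hy.1
      · exact differentiableAt_fst.mdifferentiableAt
    refine h1.congr_of_eventuallyEq ?_
    filter_upwards [(chartAt KModel k).open_source.mem_nhds hk] with k' hk'
    exact proj_eqOn k hk'
  have h1 := hev.mfderiv_eq (I := 𝓘(ℝ, KModel)) (I' := 𝓘(ℝ, C3))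
  have h2 := mfderiv_comp (I := 𝓘(ℝ, KModel)) (I' := 𝓘(ℝ, KModel)) (I'' := 𝓘(ℝ, C3)) y hdP
    (mdifferentiableAt_chartAt_symm k hy)
  have h3 := mfderiv_comp (I := 𝓘(ℝ, KModel)) (I' := 𝓘(ℝ, C3)) (I'' := 𝓘(ℝ, C3)) y
    (mdifferentiableAt_chartAt_symm k.1 (y := y.1) hy.1)
    (differentiableAt_fst (𝕜 := ℝ) (p := y)).mdifferentiableAt
  have h4 := (h2.symm.trans h1).trans h3
  rw [mfderiv_eq_fderiv, fderiv_fst] at h4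
  exact congrArg (fun L : KModel →L[ℝ] C3 => L v) h4

end Coordinates

/-! ### The determinant on Hermitian matrices -/

section HermitianDeterminant

/-- The derivative of the determinant at a matrix. -/
def detDeriv (G : Matrix (Fin 3) (Fin 3) ℂ) : Matrix (Fin 3) (Fin 3) ℂ →ₗ[ℂ] ℂ where
  toFun B := (G.adjugate * B).trace
  map_add' B B' := by rw [Matrix.mul_add, Matrix.trace_add]
  map_smul' c B := by rw [Matrix.mul_smul, Matrix.trace_smul]; rfl

lemma detDeriv_vecMulVec (G : Matrix (Fin 3) (Fin 3) ℂ) (r : C3) :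
    detDeriv G (Matrix.vecMulVec r (star r)) = sesq G.adjugate r r := by
  change (G.adjugate * Matrix.vecMulVec r (star r)).trace = _
  rw [Matrix.mul_vecMulVec, Matrix.trace_vecMulVec, sesq, dotProduct_comm]

lemma detDeriv_single (G : Matrix (Fin 3) (Fin 3) ℂ) (c : ℂ) :
    detDeriv G (Matrix.single 2 2 c) = (G 0 0 * G 1 1 - G 0 1 * G 1 0) * c := by
  change (G.adjugate * Matrix.single 2 2 c).trace = _
  rw [Matrix.trace_mul_single, Matrix.adjugate_fin_three]
  simp

lemma star_detDeriv {G B : Matrix (Fin 3) (Fin 3) ℂ} (hG : G.IsHermitian) (hB : B.IsHermitian) :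
    star (detDeriv G B) = detDeriv G B := by
  change star (G.adjugate * B).trace = (G.adjugate * B).trace
  rw [← Matrix.trace_conjTranspose, Matrix.conjTranspose_mul, hB.eq, Matrix.adjugate_conjTranspose,
    hG.eq, Matrix.trace_mul_comm]

/-- With `A = adj U` the value is the squared norm of `Aᴴ r`, and `Uᴴ Aᴴ` is the nonzero scalar
`star (det U)`. So forms of rank one are transverse to the kernel of the derivative of the
determinant. -/
lemma sesq_adjugate_ne_zero {U : Matrix (Fin 3) (Fin 3) ℂ} (hU : U.det ≠ 0) {r : C3}
    (hr : r ≠ 0) : sesq (Uᴴ * U).adjugate r r ≠ 0 := by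
  have h1 : sesq (Uᴴ * U).adjugate r r = star (U.adjugateᴴ *ᵥ r) ⬝ᵥ (U.adjugateᴴ *ᵥ r) := by
    rw [Matrix.adjugate_mul_distrib, sesq, ← Matrix.adjugate_conjTranspose, Matrix.star_mulVec,
      Matrix.conjTranspose_conjTranspose, ← Matrix.dotProduct_mulVec, Matrix.mulVec_mulVec]
  rw [h1]
  intro h
  open scoped ComplexOrder in
  have h2 : U.adjugateᴴ *ᵥ r = 0 := dotProduct_star_self_eq_zero.1 h
  have h3 : Uᴴ *ᵥ (U.adjugateᴴ *ᵥ r) = star U.det • r := by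
    rw [Matrix.mulVec_mulVec, ← Matrix.conjTranspose_mul, Matrix.adjugate_mul,
      Matrix.conjTranspose_smul, Matrix.conjTranspose_one, Matrix.smul_mulVec, Matrix.one_mulVec]
  rw [h2, Matrix.mulVec_zero] at h3
  exact (smul_ne_zero (star_ne_zero.2 hU) hr) h3.symm

/-- Jacobi's formula, checked on the explicit expansion. -/
lemma hasDerivAt_det {γ : ℝ → Matrix (Fin 3) (Fin 3) ℂ} {B : Matrix (Fin 3) (Fin 3) ℂ} {s : ℝ}
    (h : ∀ i j, HasDerivAt (fun t => γ t i j) (B i j) s) :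
    HasDerivAt (fun t => (γ t).det) (detDeriv (γ s) B) s := by
  have hd : (fun t => (γ t).det) = fun t => γ t 0 0 * γ t 1 1 * γ t 2 2 -
      γ t 0 0 * γ t 1 2 * γ t 2 1 - γ t 0 1 * γ t 1 0 * γ t 2 2 + γ t 0 1 * γ t 1 2 * γ t 2 0 +
      γ t 0 2 * γ t 1 0 * γ t 2 1 - γ t 0 2 * γ t 1 1 * γ t 2 0 := by
    funext t
    exact Matrix.det_fin_three _
  rw [hd]
  have := ((((((((h 0 0).mul (h 1 1)).mul (h 2 2)).sub (((h 0 0).mul (h 1 2)).mul (h 2 1))).sub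
    (((h 0 1).mul (h 1 0)).mul (h 2 2))).add (((h 0 1).mul (h 1 2)).mul (h 2 0))).add
    (((h 0 2).mul (h 1 0)).mul (h 2 1))).sub (((h 0 2).mul (h 1 1)).mul (h 2 0)))
  refine HasDerivAt.congr_deriv this ?_
  change _ = ((γ s).adjugate * B).trace
  simp only [Matrix.trace, Matrix.diag, Matrix.mul_apply, Fin.sum_univ_three,
    Matrix.adjugate_fin_three, Matrix.of_apply, Matrix.cons_val, Pi.mul_apply]
  ring

lemma isHermitian_gramMat (f : ℂ) (w : ℝ × ℝ × ℂ × ℂ × ℂ) : (gramMat f w).IsHermitian := by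
  ext i j
  fin_cases i <;> fin_cases j <;> simp [gramMat]
  ring

lemma exists_gramMat_eq {f : ℂ} (hf : f ≠ 0) {w : ℝ × ℝ × ℂ × ℂ × ℂ} (h0 : 0 < w.1)
    (hw : Complex.normSq w.2.2.1 < w.1 * w.2.1) :
    ∃ U : Matrix (Fin 3) (Fin 3) ℂ, U.det = f ∧ Uᴴ * U = gramMat f w := by
  obtain ⟨U, hU, h1, h2, h3, h4, h5⟩ := exists_gram hf h0 hw
  exact ⟨U, hU, gram_eq hw hU h1 h2 h3 h4 h5⟩

end HermitianDeterminant

/-! ### The Hermitian matrix as a smooth function of the coordinates -/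

section HermCoord

variable {M : Type*} [TopologicalSpace M] [ChartedSpace C3 M]

/-- The Hermitian matrix of the point of `K` with given coordinates over the chart around `x₀`. -/
def hermCoord (Υ : HolVolumeForm M) (x₀ : M) (y : KModel) : Fin 3 → Fin 3 → ℂ :=
  gramMat (Υ.toFun ((chartAt C3 x₀).symm y.1) (coordVec x₀ ((chartAt C3 x₀).symm y.1))) y.2

lemma contDiffOn_hermCoord (Υ : HolVolumeForm M) (x₀ : M) :
    ContDiffOn ℝ ∞ (hermCoord Υ x₀) (chartRange x₀) := by
  have hf : ContDiffOn ℝ ∞ (fun w : KModel => Υ.toFun ((chartAt C3 x₀).symm w.1)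
      (coordVec x₀ ((chartAt C3 x₀).symm w.1))) (chartRange x₀) := by
    have h1 := ((Υ.holomorphic x₀).restrict_scalars ℝ).of_le (m := ∞) le_top
    exact h1.comp contDiff_fst.contDiffOn fun w hw => hw.1
  have hstar : ∀ {g : KModel → ℂ}, ContDiffOn ℝ ∞ g (chartRange x₀) →
      ContDiffOn ℝ ∞ (fun w => star (g w)) (chartRange x₀) :=
    fun hg => Complex.conjCLE.contDiff.comp_contDiffOn hg
  have hofReal : ∀ {g : KModel → ℝ}, ContDiffOn ℝ ∞ g (chartRange x₀) →
      ContDiffOn ℝ ∞ (fun w => (g w : ℂ)) (chartRange x₀) :=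
    fun hg => Complex.ofRealCLM.contDiff.comp_contDiffOn hg
  have ha : ContDiffOn ℝ ∞ (fun w : KModel => w.2.1) (chartRange x₀) := by fun_prop
  have hb : ContDiffOn ℝ ∞ (fun w : KModel => w.2.2.1) (chartRange x₀) := by fun_prop
  have hc : ContDiffOn ℝ ∞ (fun w : KModel => w.2.2.2.1) (chartRange x₀) := by fun_prop
  have hd : ContDiffOn ℝ ∞ (fun w : KModel => w.2.2.2.2.1) (chartRange x₀) := by fun_prop
  have he : ContDiffOn ℝ ∞ (fun w : KModel => w.2.2.2.2.2) (chartRange x₀) := by fun_prop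
  have hn : ContDiffOn ℝ ∞ (fun w : KModel => Complex.normSq w.2.2.2.1) (chartRange x₀) := by
    simp only [Complex.normSq_apply]
    have hre := Complex.reCLM.contDiff.comp_contDiffOn (n := ∞) hc
    have him := Complex.imCLM.contDiff.comp_contDiffOn (n := ∞) hc
    exact (hre.mul hre).add (him.mul him)
  refine contDiffOn_pi.2 fun i => contDiffOn_pi.2 fun j => ?_
  fin_cases i <;> fin_cases j
  · exact hofReal ha
  · exact hc
  · exact hd
  · exact hstar hc
  · exact hofReal hb
  · exact he
  · exact hstar hd
  · exact hstar he
  · refine ContDiffOn.mul ?_ (ContDiffOn.inv (hofReal ((ha.mul hb).sub hn)) ?_)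
    · exact (((((hstar hf).mul hf).sub ((hc.mul he).mul (hstar hd))).sub
        (((hstar hc).mul (hstar he)).mul hd)).add ((hofReal ha).mul (he.mul (hstar he)))).add
        ((hofReal hb).mul (hd.mul (hstar hd)))
    · intro w hw
      exact_mod_cast (sub_pos.2 hw.2.2).ne'

lemma isOpen_chartRange (x₀ : M) : IsOpen (chartRange x₀) := by
  have h := isOpen_trans_source x₀ x₀
  convert h using 1
  exact (inter_eq_left.2 fun w hw => (chartAt C3 x₀).map_target hw.1).symm

lemma isHermitian_hermCoord (Υ : HolVolumeForm M) (x₀ : M) (y : KModel) :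
    Matrix.IsHermitian (hermCoord Υ x₀ y : Matrix (Fin 3) (Fin 3) ℂ) :=
  isHermitian_gramMat _ _

/-- The derivative of the Hermitian matrix in the coordinates of `K`. -/
def hermDeriv (Υ : HolVolumeForm M) (x₀ : M) (y : KModel) :
    KModel →ₗ[ℝ] Matrix (Fin 3) (Fin 3) ℂ :=
  (fderiv ℝ (hermCoord Υ x₀) y : KModel →ₗ[ℝ] (Fin 3 → Fin 3 → ℂ))

lemma hasFDerivAt_hermCoord (Υ : HolVolumeForm M) (x₀ : M) {y : KModel}
    (hy : y ∈ chartRange x₀) :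
    HasFDerivAt (hermCoord Υ x₀) (fderiv ℝ (hermCoord Υ x₀) y) y :=
  (((contDiffOn_hermCoord Υ x₀).contDiffAt ((isOpen_chartRange x₀).mem_nhds hy)).differentiableAt
    (by simp)).hasFDerivAt

lemma hasFDerivAt_hermCoord_apply (Υ : HolVolumeForm M) (x₀ : M) {y : KModel}
    (hy : y ∈ chartRange x₀) (i j : Fin 3) :
    HasFDerivAt (fun y => hermCoord Υ x₀ y i j)
      ((ContinuousLinearMap.proj j).comp ((ContinuousLinearMap.proj i).comp
        (fderiv ℝ (hermCoord Υ x₀) y)) : KModel →L[ℝ] ℂ) y :=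
  hasFDerivAt_pi'.1 (hasFDerivAt_pi'.1 (hasFDerivAt_hermCoord Υ x₀ hy) i) j

end HermCoord

/-! ### `β` in coordinates, and the model property of `dβ` -/

section BetaForm

variable {M : Type*} [TopologicalSpace M] [ChartedSpace C3 M] [IsManifold 𝓘(ℂ, C3) ω M]

/-- The standard Kähler form is the imaginary part of the standard Hermitian product, and a coframe
`U` pulls that product back to its Gram matrix. -/
lemma stdKahler_mulVec (U : Matrix (Fin 3) (Fin 3) ℂ) (a b : C3) :
    stdKahler ![U *ᵥ a, U *ᵥ b] = sig (Uᴴ * U) a b := by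
  have h : ∀ x z : C3, stdKahler ![x, z] = (star x ⬝ᵥ z).im := by
    intro x z
    change (Complex.I / 2 * ∑ j, (x j * star (z j) - z j * star (x j))).re = _
    simp [dotProduct, Fin.sum_univ_three]
    ring
  rw [h, sig, sesq, Matrix.star_mulVec, ← Matrix.dotProduct_mulVec, Matrix.mulVec_mulVec]

lemma Coframe.real_sum {Υ : HolVolumeForm M} {x : M} (u : Coframe Υ x) (x₀ : M) (c : Fin 3 → C3)
    (hc : ∀ j, c j = coordVec x₀ x j) (a : C3) :
    u.real (∑ j, a j • c j : C3) = u.mat x₀ *ᵥ a := by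
  let u' : C3 →ₗ[ℂ] C3 := u.1.toLinearMap
  have h1 : u' (∑ j, a j • c j) = ∑ j, a j • u' (c j) := by
    rw [map_sum]
    exact Finset.sum_congr rfl fun j _ => LinearMap.map_smul _ _ _
  refine Eq.trans h1 ?_
  ext l
  rw [Finset.sum_apply, Matrix.mulVec, dotProduct]
  refine Finset.sum_congr rfl fun j _ => ?_
  rw [Pi.smul_apply, hc, smul_eq_mul, mul_comm]
  rfl

lemma betaForm_apply (Υ : HolVolumeForm M) (x₀ : M) {y : KModel} (hy : y ∈ chartRange x₀)
    (k : SU3Bundle Υ) (hk : k.1 ∈ (chartAt C3 x₀).source) (hky : SU3Bundle.chartFun Υ x₀ k = y)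
    (v : Fin 2 → TangentSpace 𝓘(ℝ, KModel) k) (a : Fin 2 → C3) (c : Fin 3 → C3)
    (hc : ∀ j, c j = coordVec x₀ k.1 j) (hv : ∀ i, projDeriv k (v i) = (∑ j, a i j • c j : C3)) :
    betaForm Υ k v = sig (hermCoord Υ x₀ y) (a 0) (a 1) := by
  obtain ⟨x, q⟩ := k
  induction q using Quotient.inductionOn with | _ u
  have hx : (chartAt C3 x₀).symm y.1 = x := by
    rw [← hky]
    exact (chartAt C3 x₀).left_inv hk
  have hg : hermCoord Υ x₀ y = (u.mat x₀)ᴴ * u.mat x₀ := by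
    rw [chartFun_gram u hy hky, hermCoord, hx]
  have h2 : (fun i => u.real (projDeriv (Υ := Υ) (Sigma.mk x (Quotient.mk _ u) : SU3Bundle Υ)
      (v i))) = ![u.mat x₀ *ᵥ a 0, u.mat x₀ *ᵥ a 1] := by
    funext i
    refine (congrArg u.real (hv i)).trans ((u.real_sum x₀ c hc (a i)).trans ?_)
    fin_cases i <;> rfl
  exact (congrArg stdKahler h2).trans
    ((stdKahler_mulVec _ _ _).trans (congrArg (fun B => sig B (a 0) (a 1)) hg.symm))

lemma apply_eq_sum_single (L : C3 →L[ℂ] C3) (a : C3) :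
    L a = ∑ j, a j • L (Pi.single j 1) := by
  have h : a = ∑ j, a j • (Pi.single j 1 : C3) := by
    ext l
    simp [Finset.sum_apply, Pi.single_apply]
  conv_lhs => rw [h, map_sum]
  exact Finset.sum_congr rfl fun j _ => ContinuousLinearMap.map_smul _ _ _

lemma chartRep_betaForm (Υ : HolVolumeForm M) (k : SU3Bundle Υ) {y : KModel}
    (hy : y ∈ (chartAt KModel k).target) (v : Fin 2 → KModel) :
    chartRep (betaForm Υ) k y v = sig (hermCoord Υ k.1 y) (v 0).1 (v 1).1 := by
  refine betaForm_apply Υ k.1 hy _ ((chartAt KModel k).map_target hy)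
    ((chartAt KModel k).right_inv hy) _ (fun i => (v i).1)
    (fun j => chartSymmDeriv k.1 y.1 (Pi.single j 1)) (fun j => ?_) fun i => ?_
  · rw [proj_chartAt_symm k hy]
    exact (coordVec_eq_chartSymmDeriv k.1 hy.1 j).symm
  · refine (projDeriv_chartFrame k hy (v i)).trans ?_
    exact apply_eq_sum_single (chartSymmDeriv k.1 y.1) (v i).1

lemma isHermitian_hermDeriv (Υ : HolVolumeForm M) (x₀ : M) {y : KModel}
    (hy : y ∈ chartRange x₀) (u : KModel) : (hermDeriv Υ x₀ y u).IsHermitian := by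
  ext i j
  have h1 := hasFDerivAt_hermCoord_apply Υ x₀ hy i j
  have h2 := (Complex.conjCLE : ℂ →L[ℝ] ℂ).hasFDerivAt.comp y
    (hasFDerivAt_hermCoord_apply Υ x₀ hy j i)
  have h3 : (fun y => hermCoord Υ x₀ y i j) =
      (Complex.conjCLE : ℂ →L[ℝ] ℂ) ∘ fun y => hermCoord Υ x₀ y j i := by
    funext y
    exact ((isHermitian_hermCoord Υ x₀ y).apply i j).symm
  rw [← h3] at h2
  exact congrArg (fun L : KModel →L[ℝ] ℂ => L u) (h2.unique h1)

/-- The fibre coordinates are themselves the listed entries of `h`, so these entries depend linearly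
on `y`. -/
lemma hermDeriv_vertical (Υ : HolVolumeForm M) (x₀ : M) {y : KModel}
    (hy : y ∈ chartRange x₀) (w : ℝ × ℝ × ℂ × ℂ × ℂ) :
    hermDeriv Υ x₀ y (0, w) 0 0 = (w.1 : ℂ) ∧ hermDeriv Υ x₀ y (0, w) 1 1 = (w.2.1 : ℂ) ∧
    hermDeriv Υ x₀ y (0, w) 0 1 = w.2.2.1 ∧ hermDeriv Υ x₀ y (0, w) 0 2 = w.2.2.2.1 ∧
    hermDeriv Υ x₀ y (0, w) 1 2 = w.2.2.2.2 := by
  have key : ∀ (i j : Fin 3) (L : KModel →L[ℝ] ℂ), (∀ y, hermCoord Υ x₀ y i j = L y) →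
      hermDeriv Υ x₀ y (0, w) i j = L (0, w) := by
    intro i j L hL
    have h1 := hasFDerivAt_hermCoord_apply Υ x₀ hy i j
    rw [funext hL] at h1
    exact congrArg (fun L : KModel →L[ℝ] ℂ => L (0, w)) (h1.unique L.hasFDerivAt)
  let p2 := ContinuousLinearMap.snd ℝ C3 (ℝ × ℝ × ℂ × ℂ × ℂ)
  let q1 := (ContinuousLinearMap.snd ℝ ℝ (ℝ × ℂ × ℂ × ℂ)).comp p2
  let q2 := (ContinuousLinearMap.snd ℝ ℝ (ℂ × ℂ × ℂ)).comp q1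
  let q3 := (ContinuousLinearMap.snd ℝ ℂ (ℂ × ℂ)).comp q2
  refine ⟨?_, ?_, ?_, ?_, ?_⟩
  · exact key 0 0 (Complex.ofRealCLM.comp ((ContinuousLinearMap.fst ℝ ℝ _).comp p2)) fun y => rfl
  · exact key 1 1 (Complex.ofRealCLM.comp ((ContinuousLinearMap.fst ℝ ℝ _).comp q1)) fun y => rfl
  · exact key 0 1 ((ContinuousLinearMap.fst ℝ ℂ _).comp q2) fun y => rfl
  · exact key 0 2 ((ContinuousLinearMap.fst ℝ ℂ ℂ).comp q3) fun y => rfl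
  · exact key 1 2 ((ContinuousLinearMap.snd ℝ ℂ ℂ).comp q3) fun y => rfl

lemma vol_coord_ne_zero (Υ : HolVolumeForm M) (x₀ : M) {z : C3} (hz : z ∈ (chartAt C3 x₀).target) :
    Υ.toFun ((chartAt C3 x₀).symm z) (coordVec x₀ ((chartAt C3 x₀).symm z)) ≠ 0 :=
  vol_coordVec_ne_zero Υ ((chartAt C3 x₀).map_target hz)

/-- Along a fibre the determinant of `h` keeps the value `|Υ(∂₀, ∂₁, ∂₂)|²`, so vertical forms lie
in the kernel of the derivative of the determinant. -/
lemma detDeriv_hermDeriv (Υ : HolVolumeForm M) (x₀ : M) {y : KModel}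
    (hy : y ∈ chartRange x₀) (w : ℝ × ℝ × ℂ × ℂ × ℂ) :
    detDeriv (hermCoord Υ x₀ y) (hermDeriv Υ x₀ y (0, w)) = 0 := by
  set γ : ℝ → KModel := fun t => y + t • ((0, w) : KModel) with hγ
  have hγ0 : γ 0 = y := by simp [hγ]
  have hγd : HasDerivAt γ ((0, w) : KModel) 0 := by
    exact (((hasDerivAt_id (0 : ℝ)).smul_const ((0, w) : KModel)).const_add y).congr_deriv
      (one_smul _ _)
  have h1 : ∀ i j, HasDerivAt (fun t => hermCoord Υ x₀ (γ t) i j)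
      (hermDeriv Υ x₀ y (0, w) i j) 0 := by
    intro i j
    have h := hasFDerivAt_hermCoord_apply Υ x₀ hy i j
    rw [← hγ0] at h
    have h2 := HasFDerivAt.comp_hasDerivAt (0 : ℝ) h hγd
    rw [hγ0] at h2
    exact h2
  have h2 := hasDerivAt_det (γ := fun t => hermCoord Υ x₀ (γ t)) h1
  rw [hγ0] at h2
  have h3 : (fun t => Matrix.det (hermCoord Υ x₀ (γ t))) =ᶠ[𝓝 0]
      fun _ => Matrix.det (hermCoord Υ x₀ y) := by
    have hdet : ∀ z ∈ chartRange x₀, Matrix.det (hermCoord Υ x₀ z) =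
        star (Υ.toFun ((chartAt C3 x₀).symm z.1) (coordVec x₀ ((chartAt C3 x₀).symm z.1))) *
          Υ.toFun ((chartAt C3 x₀).symm z.1) (coordVec x₀ ((chartAt C3 x₀).symm z.1)) := by
      intro z hz
      obtain ⟨U, hU, hUU⟩ := exists_gramMat_eq (vol_coord_ne_zero Υ x₀ hz.1) hz.2.1 hz.2.2
      rw [hermCoord, ← hUU, Matrix.det_mul, Matrix.det_conjTranspose, hU]
    have hm : ∀ᶠ t in 𝓝 (0 : ℝ), γ t ∈ chartRange x₀ := by
      refine hγd.continuousAt.eventually_mem ?_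
      rw [hγ0]
      exact (isOpen_chartRange x₀).mem_nhds hy
    filter_upwards [hm] with t ht
    have hb : (γ t).1 = y.1 := by simp [hγ]
    rw [hdet _ ht, hdet _ hy, hb]
  exact h2.unique ((hasDerivAt_const (0 : ℝ) _).congr_of_eventuallyEq h3)

/-- The alternating form that a matrix defines by the skew-symmetric part of `sig`. -/
def sigForm (B : Matrix (Fin 3) (Fin 3) ℂ) : KModel [⋀^Fin 2]→L[ℝ] ℝ where
  toFun v := (sig B (v 0).1 (v 1).1 - sig B (v 1).1 (v 0).1) / 2
  map_update_add' := by
    intro _ v i x y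
    fin_cases i <;> simp [sig_add_left, sig_add_right] <;> ring
  map_update_smul' := by
    intro _ v i c x
    fin_cases i <;> simp [sig_smul_left, sig_smul_right] <;> ring
  map_eq_zero_of_eq' := by
    intro v i j h hij
    fin_cases i <;> fin_cases j <;> simp_all
  cont := by
    simp only [sig, sesq, dotProduct, Matrix.mulVec, Fin.sum_univ_three]
    fun_prop

/-- The linear map from matrices to alternating forms. -/
def sigFormL : (Fin 3 → Fin 3 → ℂ) →L[ℝ] KModel [⋀^Fin 2]→L[ℝ] ℝ :=
  LinearMap.toContinuousLinearMap
    { toFun := sigForm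
      map_add' := fun B B' => by
        ext v
        change (sig (B + B') _ _ - sig (B + B') _ _) / 2 =
          (sig B _ _ - sig B _ _) / 2 + (sig B' _ _ - sig B' _ _) / 2
        have h : ∀ x z, sig (B + B') x z = sig B x z + sig B' x z := fun x z => sig_add_mat B B' x z
        rw [h, h]
        ring
      map_smul' := fun c B => by
        ext v
        have h : ∀ x z, sig (c • B) x z = c * sig B x z := fun x z => sig_smul_mat B x z c
        change (sig (c • B) _ _ - sig (c • B) _ _) / 2 = c * ((sig B _ _ - sig B _ _) / 2)
        rw [h, h]
        ring }

lemma sigFormL_apply {B : Matrix (Fin 3) (Fin 3) ℂ} (hB : B.IsHermitian) (v : Fin 2 → KModel) :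
    sigFormL B v = sig B (v 0).1 (v 1).1 := by
  change (sig B (v 0).1 (v 1).1 - sig B (v 1).1 (v 0).1) / 2 = _
  rw [sig_antisymm hB (v 0).1 (v 1).1]
  ring

lemma chartRep_betaForm_eqOn (Υ : HolVolumeForm M) (k : SU3Bundle Υ) :
    EqOn (chartRep (betaForm Υ) k) (fun y => sigFormL (hermCoord Υ k.1 y))
      (chartAt KModel k).target := by
  intro y hy
  ext v
  rw [chartRep_betaForm Υ k hy]
  exact (sigFormL_apply (isHermitian_hermCoord Υ k.1 y) v).symm

lemma isSmoothForm_betaForm (Υ : HolVolumeForm M) : IsSmoothForm (betaForm Υ) := fun k =>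
  (sigFormL.contDiff.comp_contDiffOn (contDiffOn_hermCoord Υ k.1)).congr
    (chartRep_betaForm_eqOn Υ k)

/-- The vertical forms are exactly the Hermitian matrices in the kernel of `detDeriv`: the five
coordinate entries can be prescribed, and the kernel condition then fixes the last diagonal entry
because a leading minor is positive. The kernel does not contain `r r*`, so adding a suitable real
multiple moves any Hermitian matrix into it. -/
lemma isModel_dBeta (Υ : HolVolumeForm M) (k : SU3Bundle Υ) {y : KModel}
    (hy : y ∈ (chartAt KModel k).target) :
    IsModel (chartRep (dForm (betaForm Υ)) k y) (hermDeriv Υ k.1 y) where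
  formula := by
    intro u v w
    have hh := isHermitian_hermDeriv Υ k.1 hy
    have hev : chartRep (betaForm Υ) k =ᶠ[𝓝 y] fun y => sigFormL (hermCoord Υ k.1 y) :=
      (chartRep_betaForm_eqOn Υ k).eventuallyEq_of_mem ((chartAt KModel k).open_target.mem_nhds hy)
    have hd := (sigFormL.hasFDerivAt.comp y (hasFDerivAt_hermCoord Υ k.1 hy))
    rw [chartRep_dForm (isSmoothForm_betaForm Υ) k hy, hev.extDeriv_eq]
    change extDeriv _ y ![u, v, w] = _
    have hd' : fderiv ℝ (fun y => sigFormL (hermCoord Υ k.1 y)) y =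
      sigFormL.comp (fderiv ℝ (hermCoord Υ k.1) y) := hd.fderiv
    have key : ∀ (x : KModel) (z : Fin 2 → KModel),
        (fderiv ℝ (fun y => sigFormL (hermCoord Υ k.1 y)) y x) z =
          sig (hermDeriv Υ k.1 y x) (z 0).1 (z 1).1 := by
      intro x z
      rw [hd']
      exact sigFormL_apply (hh x) z
    rw [extDeriv, ContinuousAlternatingMap.alternatizeUncurryFin_apply, Fin.sum_univ_three]
    simp only [key]
    -- The exterior derivative is an alternating sum; swapping the arguments of its middle term
    -- gives the cyclic form.
    rw [sig_antisymm (hh v) u.1 w.1]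
    simp [Fin.removeNth, Fin.succAbove]
  herm := isHermitian_hermDeriv Υ k.1 hy
  surj := by
    intro B hB r hr
    obtain ⟨U, hU, hUU⟩ := exists_gramMat_eq (vol_coord_ne_zero Υ k.1 hy.1) hy.2.1 hy.2.2
    set G : Matrix (Fin 3) (Fin 3) ℂ := hermCoord Υ k.1 y with hG
    have hne : detDeriv G (Matrix.vecMulVec r (star r)) ≠ 0 := by
      rw [detDeriv_vecMulVec, hG, hermCoord, ← hUU]
      exact sesq_adjugate_ne_zero (by rw [hU]; exact vol_coord_ne_zero Υ k.1 hy.1) hr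
    have hGh : G.IsHermitian := isHermitian_hermCoord Υ k.1 y
    have hrr : (Matrix.vecMulVec r (star r)).IsHermitian := by
      rw [Matrix.IsHermitian, Matrix.conjTranspose_vecMulVec, star_star]
    have hr1 := Complex.conj_eq_iff_re.1 (star_detDeriv hGh hB)
    have hr2 := Complex.conj_eq_iff_re.1 (star_detDeriv hGh hrr)
    -- The solution of `detDeriv G (B + t r r*) = 0`; both derivatives are real because all matrices
    -- are Hermitian.
    set t : ℝ := -((detDeriv G B).re / (detDeriv G (Matrix.vecMulVec r (star r))).re) with ht
    set C := B + (t : ℂ) • Matrix.vecMulVec r (star r) with hC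
    have htC : (t : ℂ) = -(detDeriv G B / detDeriv G (Matrix.vecMulVec r (star r))) := by
      rw [ht]
      push_cast
      rw [hr1, hr2]
    have hC0 : detDeriv G C = 0 := by
      rw [hC, map_add, map_smul, htC, smul_eq_mul]
      field_simp
      ring
    have hCh : C.IsHermitian := by
      refine hB.add ?_
      rw [Matrix.IsHermitian, Matrix.conjTranspose_smul, hrr.eq]
      simp
    refine ⟨t, ((C 0 0).re, (C 1 1).re, C 0 1, C 0 2, C 1 2), ?_⟩
    rw [← hC]
    obtain ⟨e1, e2, e3, e4, e5⟩ := hermDeriv_vertical Υ k.1 hy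
      ((C 0 0).re, (C 1 1).re, C 0 1, C 0 2, C 1 2)
    have e0 := detDeriv_hermDeriv Υ k.1 hy ((C 0 0).re, (C 1 1).re, C 0 1, C 0 2, C 1 2)
    have eh := isHermitian_hermDeriv Υ k.1 hy (0, ((C 0 0).re, (C 1 1).re, C 0 1, C 0 2, C 1 2))
    generalize hermDeriv Υ k.1 y (0, ((C 0 0).re, (C 1 1).re, C 0 1, C 0 2, C 1 2)) = D at *
    have g00 : D 0 0 = C 0 0 := e1.trans (Complex.conj_eq_iff_re.1 (hCh.apply 0 0))
    have g11 : D 1 1 = C 1 1 := e2.trans (Complex.conj_eq_iff_re.1 (hCh.apply 1 1))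
    have g10 : D 1 0 = C 1 0 := by rw [← eh.apply, ← hCh.apply, e3]
    have g20 : D 2 0 = C 2 0 := by rw [← eh.apply, ← hCh.apply, e4]
    have g21 : D 2 1 = C 2 1 := by rw [← eh.apply, ← hCh.apply, e5]
    -- Both matrices lie in the kernel of `detDeriv G`, which multiplies the entry at `(2, 2)` by
    -- the leading minor. As that minor is nonzero, `D = C`.
    have hdiff : D - C = Matrix.single 2 2 (D 2 2 - C 2 2) := by
      ext i j
      fin_cases i <;> fin_cases j <;> simp [g00, g11, g10, g20, g21, e3, e4, e5]
    have hz : detDeriv G (D - C) = 0 := by rw [map_sub, e0, hC0, sub_zero]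
    rw [hdiff, detDeriv_single] at hz
    have hminor : G 0 0 * G 1 1 - G 0 1 * G 1 0 ≠ 0 := by
      have h1 : G 0 0 * G 1 1 - G 0 1 * G 1 0 =
          ((y.2.1 * y.2.2.1 - Complex.normSq y.2.2.2.1 : ℝ) : ℂ) := by
        push_cast
        rw [← Complex.mul_conj]
        rfl
      rw [h1]
      exact_mod_cast (sub_pos.2 hy.2.2).ne'
    have hz' := (mul_eq_zero.1 hz).resolve_left hminor
    rw [hz', Matrix.single_zero] at hdiff
    exact sub_eq_zero.1 hdiff
  inj := by
    intro w t r hr hw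
    obtain ⟨U, hU, hUU⟩ := exists_gramMat_eq (vol_coord_ne_zero Υ k.1 hy.1) hy.2.1 hy.2.2
    set G : Matrix (Fin 3) (Fin 3) ℂ := hermCoord Υ k.1 y with hG
    have hne : detDeriv G (Matrix.vecMulVec r (star r)) ≠ 0 := by
      rw [detDeriv_vecMulVec, hG, hermCoord, ← hUU]
      exact sesq_adjugate_ne_zero (by rw [hU]; exact vol_coord_ne_zero Υ k.1 hy.1) hr
    have h0 := detDeriv_hermDeriv Υ k.1 hy w
    rw [hw, map_smul, smul_eq_mul] at h0
    have ht := (mul_eq_zero.1 h0).resolve_right hne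
    rw [ht, zero_smul] at hw
    obtain ⟨e1, e2, e3, e4, e5⟩ := hermDeriv_vertical Υ k.1 hy w
    rw [hw] at e1 e2 e3 e4 e5
    simp only [Matrix.zero_apply] at e1 e2 e3 e4 e5
    have e1' : w.1 = 0 := by exact_mod_cast e1.symm
    have e2' : w.2.1 = 0 := by exact_mod_cast e2.symm
    exact Prod.ext e1' (Prod.ext e2' (Prod.ext e3.symm (Prod.ext e4.symm e5.symm)))

end BetaForm

/-! ### Passing between planes in the Grassmann bundle and frames in coordinates -/

section PolarSets

variable {V : Type*} [NormedAddCommGroup V] [NormedSpace ℝ V]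
variable {N : Type*} [TopologicalSpace N] [ChartedSpace V N]

lemma isIntegral_iff_vanishesOn (φ : DForm V N 3) (x : N)
    (P : Submodule ℝ (TangentSpace 𝓘(ℝ, V) x)) :
    IsIntegral (principalIdeal φ) x P ↔ VanishesOn (φ x) P :=
  (isIntegral_principalIdeal_iff φ x P).trans (vanishesOn_iff (φ x) P).symm

/-- Adjoining one polar vector to an integral element leaves it integral, so every polar vector lies
in some integral extension of `E`. -/
lemma polarSet_eq_polarSpace (φ : DForm V N 3) {p : ℕ} {E : TangentPlane V N p}
    (hE : E ∈ integralElements (principalIdeal φ) p) :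
    polarSet (principalIdeal φ) E = (polarSpace (φ E.base) E.plane : Set _) := by
  have hv : VanishesOn (φ E.base) E.plane := (isIntegral_iff_vanishesOn φ _ _).1 hE
  ext v
  constructor
  · rintro ⟨P, hP, hEP, hvP⟩
    have hP' := (isIntegral_iff_vanishesOn φ _ _).1 hP
    exact fun a ha b hb => hP' v hvP a (hEP ha) b (hEP hb)
  · intro h
    refine ⟨E.plane ⊔ Submodule.span ℝ {v}, (isIntegral_iff_vanishesOn φ _ _).2 (hv.sup_span h),
      le_sup_left, (le_sup_right : _ ≤ E.plane ⊔ Submodule.span ℝ {v})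
        (Submodule.mem_span_singleton_self v)⟩

lemma polarDim_eq_finrank (φ : DForm V N 3) {p : ℕ} {E : TangentPlane V N p}
    (hE : E ∈ integralElements (principalIdeal φ) p) :
    polarDim (principalIdeal φ) E = Module.finrank ℝ (polarSpace (φ E.base) E.plane) := by
  rw [polarDim, polarSet_eq_polarSpace φ hE, Submodule.span_eq]

/-- Planes over points that are only propositionally equal have different types; membership is
compared through the common model `V`. -/
lemma TangentPlane.ext_of_mem {p : ℕ} {E F : TangentPlane V N p} (hb : E.base = F.base)
    (h : ∀ v : V, (show TangentSpace 𝓘(ℝ, V) E.base from v) ∈ E.plane ↔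
      (show TangentSpace 𝓘(ℝ, V) F.base from v) ∈ F.plane) : E = F := by
  obtain ⟨x, P, hP⟩ := E
  obtain ⟨x', P', hP'⟩ := F
  obtain rfl : x = x' := hb
  obtain rfl : P = P' := Submodule.ext h
  rfl

lemma vanishesOn_comp {W T : Type*} [AddCommGroup W] [Module ℝ W] [TopologicalSpace W]
    [AddCommGroup T] [Module ℝ T] [TopologicalSpace T] (φ : T [⋀^Fin 3]→L[ℝ] ℝ) (L : W →L[ℝ] T)
    (S : Submodule ℝ W) :
    VanishesOn (φ.compContinuousLinearMap L) S ↔ VanishesOn φ (S.map (L : W →ₗ[ℝ] T)) := by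
  rw [vanishesOn_iff, vanishesOn_iff]
  constructor
  · intro h v hv
    choose u hu huv using hv
    obtain rfl : (fun i => L (u i)) = v := funext huv
    exact h u hu
  · exact fun h v hv => h _ fun i => Submodule.mem_map_of_mem (hv i)

lemma polarSpace_comp {W T : Type*} [AddCommGroup W] [Module ℝ W] [TopologicalSpace W]
    [AddCommGroup T] [Module ℝ T] [TopologicalSpace T] (φ : T [⋀^Fin 3]→L[ℝ] ℝ) (L : W →L[ℝ] T)
    (S : Submodule ℝ W) :
    polarSpace (φ.compContinuousLinearMap L) S =
      (polarSpace φ (S.map (L : W →ₗ[ℝ] T))).comap (L : W →ₗ[ℝ] T) := by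
  have h : ∀ a b c, triLin (φ.compContinuousLinearMap L) a b c = triLin φ (L a) (L b) (L c) := by
    intro a b c
    rw [triLin_apply, triLin_apply, ContinuousAlternatingMap.compContinuousLinearMap_apply]
    congr 1
    ext i
    fin_cases i <;> rfl
  ext v
  rw [Submodule.mem_comap, mem_polarSpace, mem_polarSpace]
  constructor
  · rintro hv _ ⟨a, ha, rfl⟩ _ ⟨b, hb, rfl⟩
    exact (h v a b).symm.trans (hv a ha b hb)
  · exact fun hv a ha b hb =>
      (h v a b).trans (hv _ (Submodule.mem_map_of_mem ha) _ (Submodule.mem_map_of_mem hb))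

lemma map_chartFrame_span {ι : Type*} (x₀ : N) (y : V) (g : ι → V) :
    (Submodule.span ℝ (range g)).map (chartFrame x₀ y : V →ₗ[ℝ] _) =
      Submodule.span ℝ (range fun i => chartFrame (N := N) x₀ y (g i)) := by
  rw [Submodule.map_span, ← range_comp]
  rfl

lemma isIntegral_span_chartFrame (φ : DForm V N 3) {ι : Type*} (x₀ : N) (y : V) (g : ι → V) :
    IsIntegral (principalIdeal φ) ((chartAt V x₀).symm y)
        (Submodule.span ℝ (range fun i => chartFrame (N := N) x₀ y (g i))) ↔
      VanishesOn (chartRep φ x₀ y) (Submodule.span ℝ (range g)) := by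
  rw [isIntegral_iff_vanishesOn, chartRep, vanishesOn_comp, map_chartFrame_span]

variable [IsManifold 𝓘(ℝ, V) ∞ N]

lemma planeOfFrame_mem_integralElements (φ : DForm V N 3) {p : ℕ} (x₀ : N)
    (w : ChartFrames (V := V) N p x₀) :
    planeOfFrame x₀ w ∈ integralElements (principalIdeal φ) p ↔
      VanishesOn (chartRep φ x₀ w.1.1) (Submodule.span ℝ (range w.1.2)) :=
  isIntegral_span_chartFrame φ x₀ w.1.1 w.1.2

lemma chartFrame_bijective [FiniteDimensional ℝ V] (x₀ : N) {y : V}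
    (hy : y ∈ (chartAt V x₀).target) : Function.Bijective (chartFrame (N := N) x₀ y) := by
  have h := chartFrame_injective (N := N) x₀ hy
  let L : V →L[ℝ] V := chartFrame (N := N) x₀ y
  exact ⟨h, (LinearMap.injective_iff_surjective (f := (L : V →ₗ[ℝ] V))).1 h⟩

lemma finrank_polarSpace_chartRep [FiniteDimensional ℝ V] (φ : DForm V N 3) {p : ℕ} (x₀ : N)
    (w : ChartFrames (V := V) N p x₀) :
    Module.finrank ℝ (polarSpace (φ (planeOfFrame x₀ w).base) (planeOfFrame x₀ w).plane) =
      Module.finrank ℝ (polarSpace (chartRep φ x₀ w.1.1) (Submodule.span ℝ (range w.1.2))) := by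
  let L : V ≃ₗ[ℝ] TangentSpace 𝓘(ℝ, V) (planeOfFrame x₀ w).base := LinearEquiv.ofBijective (chartFrame (N := N) x₀ w.1.1).toLinearMap
    (chartFrame_bijective (N := N) x₀ w.2.1)
  have h : polarSpace (chartRep φ x₀ w.1.1) (Submodule.span ℝ (range w.1.2)) =
      (polarSpace (φ (planeOfFrame x₀ w).base) (planeOfFrame x₀ w).plane).comap
        L.toLinearMap := by
    rw [chartRep, polarSpace_comp, map_chartFrame_span]
    rfl
  rw [h]
  exact (LinearEquiv.finrank_eq (L.ofSubmodule' _)).symm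

lemma polarDim_planeOfFrame [FiniteDimensional ℝ V] (φ : DForm V N 3) {p : ℕ} (x₀ : N)
    (w : ChartFrames (V := V) N p x₀)
    (hw : VanishesOn (chartRep φ x₀ w.1.1) (Submodule.span ℝ (range w.1.2))) :
    polarDim (principalIdeal φ) (planeOfFrame x₀ w) =
      Module.finrank ℝ (polarSpace (chartRep φ x₀ w.1.1) (Submodule.span ℝ (range w.1.2))) := by
  rw [polarDim_eq_finrank φ ((planeOfFrame_mem_integralElements φ x₀ w).2 hw),
    finrank_polarSpace_chartRep]

/-- The derivative of the preferred chart around `x`, at `x`. -/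
def chartPush (x : N) : TangentSpace 𝓘(ℝ, V) x →L[ℝ] V :=
  mfderiv 𝓘(ℝ, V) 𝓘(ℝ, V) (chartAt V x) x

lemma chartFrame_chartPush (x : N) (v : TangentSpace 𝓘(ℝ, V) x) :
    (chartFrame x (chartAt V x x) (chartPush x v) : V) = v :=
  chartFrame_comp_mfderiv_chartAt x (mem_chart_source V x) v

lemma chartPush_injective (x : N) : Function.Injective (chartPush (V := V) x) := by
  intro u v huv
  exact (chartFrame_chartPush x u).symm.trans
    ((congrArg (fun z : V => (chartFrame x (chartAt V x x) z : V)) huv).trans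
      (chartFrame_chartPush x v))

/-- The expression of a plane in the preferred chart around its base point. -/
def chartPlane {p : ℕ} (E : TangentPlane V N p) : Submodule ℝ V :=
  E.plane.map (chartPush (V := V) E.base).toLinearMap

lemma chartPush_mem_chartPlane {p : ℕ} (E : TangentPlane V N p)
    (v : TangentSpace 𝓘(ℝ, V) E.base) : chartPush E.base v ∈ chartPlane E ↔ v ∈ E.plane := by
  constructor
  · rintro ⟨u, hu, huv⟩
    exact chartPush_injective E.base huv ▸ hu
  · exact fun hv => Submodule.mem_map_of_mem hv

lemma planeOfFrame_eq {p : ℕ} (E : TangentPlane V N p) (w : ChartFrames (V := V) N p E.base)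
    (hw : w.1.1 = chartAt V E.base E.base)
    (hg : Submodule.span ℝ (range w.1.2) = chartPlane E) : planeOfFrame E.base w = E := by
  have hb : (chartAt V E.base).symm (chartAt V E.base E.base) = E.base :=
    (chartAt V E.base).left_inv (mem_chart_source V E.base)
  obtain ⟨⟨y, g⟩, hy, hgl⟩ := w
  obtain rfl : y = chartAt V E.base E.base := hw
  refine TangentPlane.ext_of_mem hb fun v => ?_
  have h1 : (show TangentSpace 𝓘(ℝ, V) ((chartAt V E.base).symm (chartAt V E.base E.base)) from v) ∈
        Submodule.span ℝ (range fun i => chartFrame E.base (chartAt V E.base E.base) (g i)) ↔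
      ∃ u ∈ chartPlane E, (chartFrame E.base (chartAt V E.base E.base) u : V) = v := by
    rw [← hg, ← map_chartFrame_span]
    rfl
  refine h1.trans ⟨?_, ?_⟩
  · rintro ⟨_, ⟨z, hz, rfl⟩, rfl⟩
    have h2 := chartFrame_chartPush E.base z
    rw [← h2] at hz
    exact hz
  · intro hv
    exact ⟨_, ⟨v, hv, rfl⟩, chartFrame_chartPush E.base v⟩

lemma finrank_chartPlane {p : ℕ} (E : TangentPlane V N p) :
    Module.finrank ℝ (chartPlane E) = p := by
  exact (LinearEquiv.finrank_eq (Submodule.equivMapOfInjective _ (chartPush_injective E.base)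
    E.plane)).symm.trans E.finrank_plane

lemma exists_planeOfFrame_eq {p : ℕ} (E : TangentPlane V N p) {g : Fin p → V}
    (hg : LinearIndependent ℝ g) (hs : Submodule.span ℝ (range g) = chartPlane E) :
    ∃ w : ChartFrames (V := V) N p E.base, w.1 = (chartAt V E.base E.base, g) ∧
      planeOfFrame E.base w = E :=
  let w : ChartFrames (V := V) N p E.base := ⟨(chartAt V E.base E.base, g),
    (chartAt V E.base).map_source (mem_chart_source V E.base), hg⟩
  ⟨w, rfl, planeOfFrame_eq E w rfl hs⟩

lemma exists_eq_planeOfFrame [FiniteDimensional ℝ V] {p : ℕ} (E : TangentPlane V N p) :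
    ∃ (x₀ : N) (w : ChartFrames (V := V) N p x₀), planeOfFrame x₀ w = E := by
  obtain ⟨g, hg, hs⟩ := exists_frame (finrank_chartPlane E)
  obtain ⟨w, -, hw⟩ := exists_planeOfFrame_eq E hg hs
  exact ⟨E.base, w, hw⟩

lemma isOpen_tangentPlane_iff {p : ℕ} {U : Set (TangentPlane V N p)} :
    IsOpen U ↔ ∀ x₀ : N, IsOpen {w : ChartFrames (V := V) N p x₀ | planeOfFrame x₀ w ∈ U} := by
  simp only [isOpen_iSup_iff, isOpen_coinduced]
  rfl

lemma continuous_planeOfFrame {p : ℕ} (x₀ : N) :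
    Continuous (planeOfFrame (V := V) (N := N) (p := p) x₀) :=
  continuous_def.2 fun _ hU => isOpen_tangentPlane_iff.1 hU x₀

lemma isSmoothForm_dForm {n : ℕ} {θ : DForm V N n} (hθ : IsSmoothForm θ) :
    IsSmoothForm (dForm θ) := by
  intro x₀
  have h : ContDiffOn ℝ ∞ (extDeriv (chartRep θ x₀)) (chartAt V x₀).target := by
    have h1 := (hθ x₀).fderiv_of_isOpen (m := ∞) (chartAt V x₀).open_target (by simp)
    exact (ContinuousAlternatingMap.alternatizeUncurryFinCLM ℝ V ℝ).contDiff.comp_contDiffOn h1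
  exact h.congr fun y hy => chartRep_dForm hθ x₀ hy

end PolarSets

/-! ### Upper semicontinuity of the polar dimension -/

section PolarContinuity

variable {V : Type*} [NormedAddCommGroup V] [NormedSpace ℝ V]
variable {N : Type*} [TopologicalSpace N] [ChartedSpace V N]

lemma continuousOn_triLin {X : Type*} [TopologicalSpace X] {s : Set X}
    {φ : X → V [⋀^Fin 3]→L[ℝ] ℝ} {a b c : X → V} (hφ : ContinuousOn φ s) (ha : ContinuousOn a s)
    (hb : ContinuousOn b s) (hc : ContinuousOn c s) :
    ContinuousOn (fun x => triLin (φ x) (a x) (b x) (c x)) s := by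
  have h : ContinuousOn (fun x => φ x ![a x, b x, c x]) s := by
    have hv : ContinuousOn (fun x => ![a x, b x, c x]) s := by
      refine continuousOn_pi.2 fun i => ?_
      fin_cases i
      exacts [ha, hb, hc]
    exact continuous_eval.comp_continuousOn (hφ.prodMk hv)
  exact h

variable [FiniteDimensional ℝ V]

lemma finrank_polarSpace_add_rank_contractPairs (φ : V [⋀^Fin 3]→L[ℝ] ℝ) {j : ℕ} (g : Fin j → V) :
    Module.finrank ℝ (LinearMap.range (contractPairs φ g)) +
      Module.finrank ℝ (polarSpace φ (Submodule.span ℝ (range g))) = Module.finrank ℝ V := by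
  rw [← ker_contractPairs]
  exact LinearMap.finrank_range_add_finrank_ker _

/-- The polar space is the kernel of a linear map that depends continuously on the frame, and rank
is lower semicontinuous. -/
lemma isOpen_finrank_polarSpace_le {φ : DForm V N 3} (hφ : IsSmoothForm φ) {p : ℕ} (x₀ : N)
    (d : ℕ) :
    IsOpen {w : ChartFrames (V := V) N p x₀ | Module.finrank ℝ (polarSpace (chartRep φ x₀ w.1.1)
      (Submodule.span ℝ (range w.1.2))) ≤ d} := by
  let T : ChartFrames (V := V) N p x₀ → V →L[ℝ] (IncPair p → ℝ) := fun w =>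
    LinearMap.toContinuousLinearMap (contractPairs (chartRep φ x₀ w.1.1) w.1.2)
  have hcont : Continuous T := by
    refine continuous_clm_apply.2 fun v => continuous_pi fun a => ?_
    have hrep : Continuous fun w : ChartFrames (V := V) N p x₀ => chartRep φ x₀ w.1.1 := by
      rw [← continuousOn_univ]
      exact (hφ x₀).continuousOn.comp (by fun_prop) fun w _ => w.2.1
    rw [← continuousOn_univ]
    exact continuousOn_triLin hrep.continuousOn continuousOn_const
      (Continuous.continuousOn (by fun_prop)) (Continuous.continuousOn (by fun_prop))
  have hset : {w : ChartFrames (V := V) N p x₀ | Module.finrank ℝ (polarSpace (chartRep φ x₀ w.1.1)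
      (Submodule.span ℝ (range w.1.2))) ≤ d} =
      -- Truncated subtraction is harmless: for `d` above the dimension of `V` both conditions
      -- always hold.
      T ⁻¹' {f | ((Module.finrank ℝ V - d : ℕ) : Cardinal) ≤ (f : V →ₗ[ℝ] IncPair p → ℝ).rank} := by
    ext w
    have h := finrank_polarSpace_add_rank_contractPairs (chartRep φ x₀ w.1.1) w.1.2
    have hr : (T w : V →ₗ[ℝ] IncPair p → ℝ).rank =
        Module.finrank ℝ (LinearMap.range (contractPairs (chartRep φ x₀ w.1.1) w.1.2)) :=
      (Module.finrank_eq_rank ℝ _).symm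
    rw [mem_preimage, mem_ofPred_eq, mem_ofPred_eq, hr, Nat.cast_le]
    omega
  rw [hset]
  exact (isOpen_setOfPred_nat_le_rank _).preimage hcont

lemma isOpen_finrank_polarSpace_plane_le [IsManifold 𝓘(ℝ, V) ∞ N] {φ : DForm V N 3} (hφ : IsSmoothForm φ) (p d : ℕ) :
    IsOpen {E : TangentPlane V N p |
      Module.finrank ℝ (polarSpace (φ E.base) E.plane) ≤ d} := by
  refine isOpen_tangentPlane_iff.2 fun x₀ => ?_
  convert isOpen_finrank_polarSpace_le hφ x₀ d (p := p) using 3 with w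
  rw [mem_ofPred_eq, finrank_polarSpace_chartRep]

end PolarContinuity

/-! ### Transverse integral elements: polar dimension and its local constancy -/

section Transverse

variable {M : Type*} [TopologicalSpace M] [ChartedSpace C3 M] [IsManifold 𝓘(ℂ, C3) ω M]
variable {Υ : HolVolumeForm M}

lemma chartSymmDeriv_injective (x₀ : M) {z : C3} (hz : z ∈ (chartAt C3 x₀).target) :
    Function.Injective (chartSymmDeriv x₀ z) := by
  have : IsManifold 𝓘(ℝ, C3) ∞ M := isManifold_real
  intro u v huv
  exact chartFrame_injective x₀ hz ((chartFrame_base x₀ hz u).trans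
    (huv.trans (chartFrame_base x₀ hz v).symm))

lemma isTransverse_planeOfFrame {p : ℕ} (k : SU3Bundle Υ)
    (w : ChartFrames (V := KModel) (SU3Bundle Υ) p k) :
    IsTransverse (planeOfFrame k w) ↔
      InjOn Prod.fst (Submodule.span ℝ (range w.1.2) : Set KModel) := by
  have hinj := chartSymmDeriv_injective k.1 w.2.1.1
  have hframe : ∀ u v : KModel, projDeriv ((chartAt KModel k).symm w.1.1) (chartFrame k w.1.1 u) =
      projDeriv ((chartAt KModel k).symm w.1.1) (chartFrame k w.1.1 v) ↔ u.1 = v.1 := by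
    intro u v
    have hu := projDeriv_chartFrame k w.2.1 u
    have hv := projDeriv_chartFrame k w.2.1 v
    constructor
    · exact fun h => hinj (hu.symm.trans (h.trans hv))
    · exact fun h => hu.trans ((congrArg (chartSymmDeriv k.1 w.1.1.1) h).trans hv.symm)
  change InjOn (projDeriv ((chartAt KModel k).symm w.1.1))
    (Submodule.span ℝ (range fun i => chartFrame k w.1.1 (w.1.2 i)) : Set _) ↔ _
  rw [← map_chartFrame_span]
  constructor
  · intro h u hu v hv huv
    exact chartFrame_injective k w.2.1 (h (Submodule.mem_map_of_mem hu)
      (Submodule.mem_map_of_mem hv) ((hframe u v).2 huv))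
  · rintro h _ ⟨u, hu, rfl⟩ _ ⟨v, hv, rfl⟩ huv
    rw [h hu hv ((hframe u v).1 huv)]

/-- Transversality is linear independence of the horizontal parts of a frame, an open condition. -/
lemma isOpen_isTransverse (p : ℕ) :
    IsOpen {E : TangentPlane KModel (SU3Bundle Υ) p | IsTransverse E} := by
  refine isOpen_tangentPlane_iff.2 fun k => ?_
  have h : {w : ChartFrames (V := KModel) (SU3Bundle Υ) p k |
      planeOfFrame k w ∈ {E : TangentPlane KModel (SU3Bundle Υ) p | IsTransverse E}} =
      (fun (w : ChartFrames (V := KModel) (SU3Bundle Υ) p k) i => (w.1.2 i).1) ⁻¹'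
        {f : Fin p → C3 | LinearIndependent ℝ f} := by
    ext w
    rw [mem_ofPred_eq, mem_ofPred_eq, isTransverse_planeOfFrame]
    exact ⟨linearIndependent_fst w.2.2, injOn_fst_span⟩
  rw [h]
  exact isOpen_setOfPred_linearIndependent.preimage (by fun_prop)

lemma finrank_vertical : Module.finrank ℝ (ℝ × ℝ × ℂ × ℂ × ℂ) = 8 := by
  simp [Module.finrank_prod, Complex.finrank_real_complex]

lemma mem_transverseElements_planeOfFrame {p : ℕ} (k : SU3Bundle Υ)
    (w : ChartFrames (V := KModel) (SU3Bundle Υ) p k) :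
    planeOfFrame k w ∈ transverseElements Υ p ↔
      VanishesOn (chartRep (dForm (betaForm Υ)) k w.1.1) (Submodule.span ℝ (range w.1.2)) ∧
        InjOn Prod.fst (Submodule.span ℝ (range w.1.2) : Set KModel) :=
  and_congr (planeOfFrame_mem_integralElements (dForm (betaForm Υ)) k w)
    (isTransverse_planeOfFrame k w)

lemma polarDim_transverse {p : Fin 7} {E : TangentPlane KModel (SU3Bundle Υ) p}
    (hE : E ∈ transverseElements Υ p) :
    polarDims p ≤ polarDim (idealK Υ) E ∧ (p ≠ 4 → polarDim (idealK Υ) E = polarDims p) := by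
  obtain ⟨k, w, rfl⟩ := exists_eq_planeOfFrame E
  obtain ⟨h1, h2⟩ := (mem_transverseElements_planeOfFrame k w).1 hE
  rw [idealK, polarDim_planeOfFrame _ k w h1]
  exact (isModel_dBeta Υ k w.2.1).finrank_polarSpace finrank_vertical h2
    (by simpa using finrank_span_eq_card w.2.2) h1

/-- Nearby integral elements are transverse, so their polar dimension is at least the generic one;
by semicontinuity it is at most the generic one. -/
lemma eventually_extensionRank_eq {p : Fin 7} {E : TangentPlane KModel (SU3Bundle Υ) p}
    (hE : E ∈ transverseElements Υ p) (hp : polarDim (idealK Υ) E = polarDims p) :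
    ∀ᶠ F in 𝓝[integralElements (idealK Υ) p] E,
      extensionRank (idealK Υ) F = extensionRank (idealK Υ) E := by
  have h1 : ∀ᶠ F in 𝓝[integralElements (idealK Υ) p] E, IsTransverse F :=
    nhdsWithin_le_nhds ((isOpen_isTransverse p).mem_nhds hE.2)
  have h2 : ∀ᶠ F in 𝓝[integralElements (idealK Υ) p] E,
      Module.finrank ℝ (polarSpace (dForm (betaForm Υ) F.base) F.plane) ≤ polarDims p := by
    refine nhdsWithin_le_nhds ((isOpen_finrank_polarSpace_plane_le
      (isSmoothForm_dForm (isSmoothForm_betaForm Υ)) p (polarDims p)).mem_nhds ?_)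
    rw [mem_ofPred_eq, ← polarDim_eq_finrank _ hE.1]
    exact hp.le
  filter_upwards [h1, h2, self_mem_nhdsWithin] with F hF1 hF2 hF3
  have h3 := (polarDim_transverse ⟨hF3, hF1⟩).1
  rw [← polarDim_eq_finrank _ hF3] at hF2
  have h4 : polarDim (idealK Υ) F = polarDims p := le_antisymm hF2 h3
  rw [extensionRank, extensionRank, hp, h4]

end Transverse

/-! ### Graph functions of multiples of a 3-form -/

section WedgeForms

variable {V : Type*} [NormedAddCommGroup V] [NormedSpace ℝ V]
variable {N : Type*} [TopologicalSpace N] [ChartedSpace V N]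

lemma wedgeAlt_comp {W T : Type*} [AddCommGroup W] [Module ℝ W] [TopologicalSpace W]
    [AddCommGroup T] [Module ℝ T] [TopologicalSpace T] {k n m : ℕ} (h : k + n = m)
    (α : T [⋀^Fin k]→L[ℝ] ℝ) (φ : T [⋀^Fin n]→L[ℝ] ℝ) (L : W →L[ℝ] T) (v : Fin m → W) :
    wedgeAlt h α φ (fun i => L (v i)) =
      wedgeAlt h (α.compContinuousLinearMap L) (φ.compContinuousLinearMap L) v := by
  change LinearMap.mul' ℝ ℝ ((∑ σ : Equiv.Perm.ModSumCongr (Fin k) (Fin n),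
      AlternatingMap.domCoprod.summand α.toAlternatingMap φ.toAlternatingMap σ)
        fun i => L (v ((finSumFinEquiv.trans (finCongr h)) i))) =
    LinearMap.mul' ℝ ℝ ((∑ σ : Equiv.Perm.ModSumCongr (Fin k) (Fin n),
      AlternatingMap.domCoprod.summand (α.compContinuousLinearMap L).toAlternatingMap
        (φ.compContinuousLinearMap L).toAlternatingMap σ)
        fun i => v ((finSumFinEquiv.trans (finCongr h)) i))
  simp only [sum_apply, map_sum]
  refine Finset.sum_congr rfl fun σ _ => ?_
  induction σ using Quotient.inductionOn' with | _ σ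
  rfl

/-- The basis of a plane with given graph coordinates. -/
def graphFrame {p m : ℕ} (b : Module.Basis (Fin p ⊕ Fin m) ℝ V) (A : Fin p → Fin m → ℝ)
    (i : Fin p) : V :=
  b (Sum.inl i) + ∑ j, A i j • b (Sum.inr j)

lemma coord_graphFrame {p m : ℕ} (b : Module.Basis (Fin p ⊕ Fin m) ℝ V) (A : Fin p → Fin m → ℝ)
    (i j : Fin p) : b.coord (Sum.inl i) (graphFrame b A j) = if i = j then 1 else 0 := by
  simp [graphFrame, Finsupp.single_apply, eq_comm]

/-- A multiple of a given 3-form whose graph function is, up to a constant factor, the value of the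
3-form on three of the vectors of the frame. -/
lemma exists_graphFun_eq [FiniteDimensional ℝ V] [T2Space N] [IsManifold 𝓘(ℝ, V) ∞ N]
    (θ : DForm V N 3) (x₀ : N) {p m : ℕ} (b : Module.Basis (Fin p ⊕ Fin m) ℝ V)
    {d : Fin 3 → Fin p} (hd : Function.Injective d) :
    ∃ φ ∈ principalIdeal θ p, ∃ s : ℝ, s ≠ 0 ∧ ∀ᶠ y in 𝓝 (chartAt V x₀ x₀), ∀ A,
      graphFun b x₀ φ (y, A) = s * chartRep θ x₀ y fun l => graphFrame b A (d l) := by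
  have hp : 3 ≤ p := by simpa using Fintype.card_le_of_injective d hd
  obtain ⟨k, rfl⟩ : ∃ k, p = k + 3 := ⟨p - 3, by omega⟩
  -- The three chosen indices form the right block of `τ`. The form `α` is the product of the
  -- covectors dual to the remaining frame vectors, and the scalar is the sign of the shuffle.
  obtain ⟨τ, hτ⟩ := exists_equiv_extend_inr (rfl : k + 3 = k + 3) hd
  let ξ : Fin (k + 3) → V →L[ℝ] ℝ := fun i =>
    LinearMap.toContinuousLinearMap (b.coord (Sum.inl i))
  obtain ⟨α, hα, hα₀⟩ := exists_isSmoothForm_eventuallyEq x₀ (detForm fun a => ξ (τ (Sum.inl a)))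
  refine ⟨wedge rfl α θ, IdealGen.wedge rfl α hα (IdealGen.gen θ singleForm.self),
    ((shuffleSign rfl τ : ℤ) : ℝ), by simp, ?_⟩
  filter_upwards [hα₀] with y hy A
  have h1 : graphFun b x₀ (wedge rfl α θ) (y, A) =
      wedgeAlt rfl (chartRep α x₀ y) (chartRep θ x₀ y) (graphFrame b A) :=
    wedgeAlt_comp rfl _ _ (chartFrame x₀ y) (graphFrame b A)
  rw [h1, hy, wedgeAlt_detForm rfl τ ξ _ _ fun i j => coord_graphFrame b A i j]
  simp only [hτ]

end WedgeForms

/-! ### Calculus of the test functions -/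

section Derivatives

variable {V : Type*} [NormedAddCommGroup V] [NormedSpace ℝ V]

lemma contDiffAt_triLin {X : Type*} [NormedAddCommGroup X] [NormedSpace ℝ X] {n : WithTop ℕ∞}
    {φ : X → V [⋀^Fin 3]→L[ℝ] ℝ} {a b c : X → V} {x : X} (hφ : ContDiffAt ℝ n φ x)
    (ha : ContDiffAt ℝ n a x) (hb : ContDiffAt ℝ n b x) (hc : ContDiffAt ℝ n c x) :
    ContDiffAt ℝ n (fun x => triLin (φ x) (a x) (b x) (c x)) x := by
  let T : V [⋀^Fin 3]→L[ℝ] ℝ →L[ℝ] ContinuousMultilinearMap ℝ (fun _ : Fin 3 => V) ℝ :=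
    ContinuousAlternatingMap.toContinuousMultilinearMapCLM ℝ
  have h0 := T.contDiff.comp_contDiffAt x hφ
  have h1 := ((continuousMultilinearCurryLeftEquiv ℝ (fun _ : Fin 3 => V) ℝ).contDiff.comp_contDiffAt
    x h0).clm_apply ha
  have h2 := ((continuousMultilinearCurryLeftEquiv ℝ (fun _ : Fin 2 => V) ℝ).contDiff.comp_contDiffAt
    x h1).clm_apply hb
  have h3 := ((continuousMultilinearCurryLeftEquiv ℝ (fun _ : Fin 1 => V) ℝ).contDiff.comp_contDiffAt
    x h2).clm_apply hc
  have h4 := (ContinuousMultilinearMap.apply ℝ (fun _ : Fin 0 => V) ℝ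
    Fin.elim0).contDiff.comp_contDiffAt x h3
  refine h4.congr_of_eventuallyEq (Eventually.of_forall fun x => ?_)
  change φ x ![a x, b x, c x] = φ x _
  congr 1

lemma eventually_linearIndependent_fderiv {X ι : Type*} [NormedAddCommGroup X] [NormedSpace ℝ X]
    [Finite ι] {F : ι → X → ℝ} {x : X} (hF : ∀ a, ContDiffAt ℝ 1 (F a) x)
    (h : LinearIndependent ℝ fun a => fderiv ℝ (F a) x) :
    ∀ᶠ y in 𝓝 x, LinearIndependent ℝ fun a => fderiv ℝ (F a) y := by
  have hc : ContinuousAt (fun y a => fderiv ℝ (F a) y) x :=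
    continuousAt_pi.2 fun a => (hF a).continuousAt_fderiv one_ne_zero
  exact hc.eventually_mem (isOpen_setOfPred_linearIndependent.mem_nhds h)

lemma fderiv_apply_eq_of_affine {X : Type*} [NormedAddCommGroup X] [NormedSpace ℝ X] {F : X → ℝ}
    {x v : X} {c : ℝ} (hF : DifferentiableAt ℝ F x) (h : ∀ t : ℝ, F (x + t • v) = F x + t * c) :
    fderiv ℝ F x v = c := by
  rw [← hF.lineDeriv_eq_fderiv]
  have h1 : HasDerivAt (fun t : ℝ => F x + t * c) c 0 := by
    simpa using ((hasDerivAt_id (0 : ℝ)).mul_const c).const_add (F x)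
  have h2 : (fun t : ℝ => F (x + t • v)) = fun t => F x + t * c := funext h
  rw [lineDeriv, h2, h1.deriv]

end Derivatives

/-! ### Which triples of frame vectors test integrality -/

section Triples

/-- The increasing triples of indices which are needed to test whether a 3-form vanishes on a
plane: the triples `(2, ·, 5)` are redundant. -/
abbrev Trip (p : ℕ) : Type :=
  {d : Fin p × Fin p × Fin p // d.1 < d.2.1 ∧ d.2.1 < d.2.2 ∧ ¬(d.2.2.val = 5 ∧ d.1.val = 2)}

lemma vanishesOn_span_iff_trip {V : Type*} [AddCommGroup V] [Module ℝ V] [TopologicalSpace V]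
    {p : ℕ} (hp : p ≤ 5) (φ : V [⋀^Fin 3]→L[ℝ] ℝ) (g : Fin p → V) :
    VanishesOn φ (Submodule.span ℝ (range g)) ↔
      ∀ a : Trip p, triLin φ (g a.1.1) (g a.1.2.1) (g a.1.2.2) = 0 := by
  rw [vanishesOn_span_lt]
  constructor
  · exact fun h a => h _ _ _ a.2.1 a.2.2.1
  · exact fun h i j k hij hjk => h ⟨(i, j, k), hij, hjk, fun hh => by have := k.2; omega⟩

variable {W : Type*} [NormedAddCommGroup W] [NormedSpace ℝ W]
variable {φ : (C3 × W) [⋀^Fin 3]→L[ℝ] ℝ} {κ : C3 × W →ₗ[ℝ] Matrix (Fin 3) (Fin 3) ℂ}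

/-- The first five vectors span a transverse integral 5-plane, so the sixth differs from a polar
vector by a vertical `B`. The retained equations with last index 5 say that eight values of the form
of `B` vanish, so `B = 0` and the sixth vector is polar. The omitted equations follow. -/
lemma IsModel.vanishesOn_span_iff_trip_six (h : IsModel φ κ) {g : Fin 6 → C3 × W}
    (hg : LinearIndependent ℝ fun i => (g i).1)
    (hinj : ∀ B : W, (∀ i i' : Fin 5, i < i' → i.val ≠ 2 →
      triLin φ (0, B) (g i.castSucc) (g i'.castSucc) = 0) → B = 0) :
    VanishesOn φ (Submodule.span ℝ (range g)) ↔
      ∀ a : Trip 6, triLin φ (g a.1.1) (g a.1.2.1) (g a.1.2.2) = 0 := by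
  rw [vanishesOn_span_lt]
  refine ⟨fun h a => h _ _ _ a.2.1 a.2.2.1, fun ht i j k hij hjk => ?_⟩
  have hg5 : LinearIndependent ℝ fun i : Fin 5 => (g i.castSucc).1 :=
    hg.comp _ (Fin.castSucc_injective 5)
  set F := Submodule.span ℝ (range fun i : Fin 5 => g i.castSucc) with hF
  have hFinj : InjOn Prod.fst (F : Set (C3 × W)) := injOn_fst_span hg5
  have hF5 : Module.finrank ℝ F = 5 := by
    simpa using finrank_span_eq_card (linearIndependent_of_fst hg5)
  have : FiniteDimensional ℝ F := FiniteDimensional.span_of_finite ℝ (finite_range _)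
  have hFφ : VanishesOn φ F := by
    rw [hF, vanishesOn_span_lt]
    intro i j k hij hjk
    refine ht ⟨(i.castSucc, j.castSucc, k.castSucc), hij, hjk, fun hh => ?_⟩
    have := k.2
    have h1 : k.val = 5 := hh.1
    omega
  obtain ⟨B, hB⟩ := h.exists_sub_vertical_mem_polarSpace hFinj hF5 hFφ (g (Fin.last 5))
  have hval : ∀ i i' : Fin 5, triLin φ (g (Fin.last 5)) (g i.castSucc) (g i'.castSucc) =
      triLin φ (0, B) (g i.castSucc) (g i'.castSucc) := by
    intro i i'
    have := (polarSpace_span φ _ _).1 hB i i'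
    rw [map_sub, LinearMap.sub_apply, LinearMap.sub_apply, sub_eq_zero] at this
    exact this
  have hB0 : B = 0 := by
    refine hinj B fun i i' hii' hi => ?_
    rw [← hval, ← triLin_cycle]
    exact ht ⟨(i.castSucc, i'.castSucc, Fin.last 5), hii', Fin.castSucc_lt_last i',
      fun hh => hi hh.2⟩
  by_cases hk : k = Fin.last 5
  · subst hk
    obtain ⟨j, rfl⟩ := Fin.exists_castSucc_eq.2 hjk.ne
    obtain ⟨i, rfl⟩ := Fin.exists_castSucc_eq.2 (hij.trans hjk).ne
    rw [triLin_cycle φ (g (Fin.last 5)), hval, hB0, ← Prod.zero_eq_mk, map_zero]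
    rfl
  · refine ht ⟨(i, j, k), hij, hjk, fun hh => hk (Fin.ext hh.1)⟩

end Triples

/-! ### Independence of the differentials of the test functions -/

section Differentials

variable {W : Type*} [NormedAddCommGroup W] [NormedSpace ℝ W]

/-- The values of a family of 3-forms on the triples of vectors of a graph frame. -/
def tripFun {V : Type*} [NormedAddCommGroup V] [NormedSpace ℝ V] {p m : ℕ}
    (b : Module.Basis (Fin p ⊕ Fin m) ℝ V) (Ω : V → V [⋀^Fin 3]→L[ℝ] ℝ) (a : Trip p)
    (w : V × (Fin p → Fin m → ℝ)) : ℝ :=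
  triLin (Ω w.1) (graphFrame b w.2 a.1.1) (graphFrame b w.2 a.1.2.1) (graphFrame b w.2 a.1.2.2)

lemma contDiff_graphFrame {V : Type*} [NormedAddCommGroup V] [NormedSpace ℝ V] {p m : ℕ}
    {n : WithTop ℕ∞} (b : Module.Basis (Fin p ⊕ Fin m) ℝ V) (i : Fin p) :
    ContDiff ℝ n fun w : V × (Fin p → Fin m → ℝ) => graphFrame b w.2 i := by
  unfold graphFrame
  fun_prop

lemma contDiffAt_tripFun {V : Type*} [NormedAddCommGroup V] [NormedSpace ℝ V] {p m : ℕ}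
    {n : WithTop ℕ∞} (b : Module.Basis (Fin p ⊕ Fin m) ℝ V) {Ω : V → V [⋀^Fin 3]→L[ℝ] ℝ}
    (a : Trip p) {w : V × (Fin p → Fin m → ℝ)} (hΩ : ContDiffAt ℝ n Ω w.1) :
    ContDiffAt ℝ n (tripFun b Ω a) w :=
  contDiffAt_triLin (hΩ.comp w contDiffAt_fst) (contDiff_graphFrame b _).contDiffAt
    (contDiff_graphFrame b _).contDiffAt (contDiff_graphFrame b _).contDiffAt

lemma graphFrame_zero {V : Type*} [NormedAddCommGroup V] [NormedSpace ℝ V] {p m : ℕ}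
    (b : Module.Basis (Fin p ⊕ Fin m) ℝ V) (i : Fin p) : graphFrame b 0 i = b (Sum.inl i) := by
  simp [graphFrame]

/-- The graph coordinates of the direction which moves one vector of the frame. -/
def frameDir {V : Type*} [NormedAddCommGroup V] [NormedSpace ℝ V] {p m : ℕ}
    (b : Module.Basis (Fin p ⊕ Fin m) ℝ V) (j : Fin p) (u : V) : Fin p → Fin m → ℝ :=
  Pi.single j fun l => b.repr u (Sum.inr l)

lemma graphFrame_smul_frameDir_of_ne {V : Type*} [NormedAddCommGroup V] [NormedSpace ℝ V]
    {p m : ℕ} (b : Module.Basis (Fin p ⊕ Fin m) ℝ V) {i j : Fin p} (hij : i ≠ j) (u : V) (t : ℝ) :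
    graphFrame b (t • frameDir b j u) i = b (Sum.inl i) := by
  simp [graphFrame, frameDir, hij]

lemma exists_graphFrame_smul_frameDir {V : Type*} [NormedAddCommGroup V] [NormedSpace ℝ V]
    {p m : ℕ} (b : Module.Basis (Fin p ⊕ Fin m) ℝ V) (j : Fin p) (u : V) :
    ∃ e ∈ Submodule.span ℝ (range fun i => b (Sum.inl i)), ∀ t : ℝ,
      graphFrame b (t • frameDir b j u) j = b (Sum.inl j) + t • (u - e) := by
  refine ⟨∑ i, b.repr u (Sum.inl i) • b (Sum.inl i), Submodule.sum_mem _ fun i _ =>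
    Submodule.smul_mem _ _ (Submodule.subset_span ⟨i, rfl⟩), fun t => ?_⟩
  have h := b.sum_repr u
  rw [Fintype.sum_sum_type] at h
  have h2 : ∑ l, b.repr u (Sum.inr l) • b (Sum.inr l) =
      u - ∑ i, b.repr u (Sum.inl i) • b (Sum.inl i) := eq_sub_of_add_eq' h
  rw [← h2, Finset.smul_sum]
  simp [graphFrame, frameDir, mul_smul]

variable {κ : C3 × W →ₗ[ℝ] Matrix (Fin 3) (Fin 3) ℂ} {p m : ℕ}

/-- Along a direction which moves the vector `j` of the frame, the triples that end with `j` change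
by the 2-form of a vertical vector, and the previous ones do not change. -/
lemma fderiv_tripFun {b : Module.Basis (Fin p ⊕ Fin m) ℝ (C3 × W)}
    {Ω : C3 × W → (C3 × W) [⋀^Fin 3]→L[ℝ] ℝ} {y : C3 × W} (hΩ : ContDiffAt ℝ 1 Ω y)
    (h : IsModel (Ω y) κ)
    (hφ : VanishesOn (Ω y) (Submodule.span ℝ (range fun i => b (Sum.inl i))))
    (j : Fin p) (B : W) (a : Trip p) :
    (a.1.2.2 < j → fderiv ℝ (tripFun b Ω a) (y, 0) (0, frameDir b j (0, B)) = 0) ∧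
    (a.1.2.2 = j → fderiv ℝ (tripFun b Ω a) (y, 0) (0, frameDir b j (0, B)) =
      sig (κ (0, B)) (b (Sum.inl a.1.1)).1 (b (Sum.inl a.1.2.1)).1) := by
  have hd : DifferentiableAt ℝ (tripFun b Ω a) (y, 0) :=
    (contDiffAt_tripFun b a (w := (y, 0)) hΩ).differentiableAt one_ne_zero
  obtain ⟨⟨i, i', j'⟩, hi, hi', hij⟩ := a
  have hmem : ∀ i, b (Sum.inl i) ∈ Submodule.span ℝ (range fun i => b (Sum.inl i)) :=
    fun i => Submodule.subset_span ⟨i, rfl⟩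
  have hpt : ∀ t : ℝ, ((y, 0) + t • (0, frameDir b j (0, B)) : (C3 × W) × (Fin p → Fin m → ℝ)) =
      (y, t • frameDir b j (0, B)) := fun t => by simp
  constructor
  · intro hj
    refine fderiv_apply_eq_of_affine hd fun t => ?_
    have hj : j' < j := hj
    rw [hpt, tripFun, tripFun, graphFrame_smul_frameDir_of_ne b (hi.trans (hi'.trans hj)).ne,
      graphFrame_smul_frameDir_of_ne b (hi'.trans hj).ne, graphFrame_smul_frameDir_of_ne b hj.ne]
    simp [graphFrame_zero]
  · intro hj
    obtain rfl : j' = j := hj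
    refine fderiv_apply_eq_of_affine hd fun t => ?_
    -- Graph coordinates move the vector only modulo the span of the frame. The discrepancy `e`
    -- contributes nothing, since the 3-form vanishes on that span.
    obtain ⟨e, he, het⟩ := exists_graphFrame_smul_frameDir b j' (0, B)
    rw [hpt, tripFun, tripFun, graphFrame_smul_frameDir_of_ne b (hi.trans hi').ne,
      graphFrame_smul_frameDir_of_ne b hi'.ne, het]
    simp only [graphFrame_zero, map_add, map_smul, map_sub, smul_eq_mul]
    rw [hφ _ (hmem i) _ (hmem i') _ he, triLin_cycle (Ω y) (0, B), h.vertical, sub_zero]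

/-- The differentials of the functions which test the vanishing of the 3-form are linearly
independent at a plane with an adapted basis. -/
lemma linearIndependent_fderiv_tripFun {b : Module.Basis (Fin p ⊕ Fin m) ℝ (C3 × W)}
    {Ω : C3 × W → (C3 × W) [⋀^Fin 3]→L[ℝ] ℝ} {y : C3 × W} (hΩ : ContDiffAt ℝ 1 Ω y)
    (h : IsModel (Ω y) κ)
    (hφ : VanishesOn (Ω y) (Submodule.span ℝ (range fun i => b (Sum.inl i))))
    (hb : ∀ j : Fin p, VerticalSurj κ fun i : Fin j => (b (Sum.inl (Fin.castLE j.2.le i))).1) :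
    LinearIndependent ℝ fun a : Trip p => fderiv ℝ (tripFun b Ω a) (y, 0) := by
  rw [Fintype.linearIndependent_iff]
  intro c hc
  by_contra! hne
  obtain ⟨a₁, ha₁⟩ := hne
  -- Take the largest last index `j` with a nonzero coefficient. Moving vector `j` vertically does
  -- not affect triples ending earlier, and later ones have coefficient zero.
  obtain ⟨a₀, ha₀, hmax⟩ := Finset.exists_max_image (Finset.univ.filter fun a => c a ≠ 0)
    (fun a => a.1.2.2) ⟨a₁, by simpa using ha₁⟩
  replace ha₀ : c a₀ ≠ 0 := by simpa using ha₀
  replace hmax : ∀ a, c a ≠ 0 → a.1.2.2 ≤ a₀.1.2.2 := fun a ha => hmax a (by simpa using ha)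
  set j := a₀.1.2.2 with hj
  -- The values prescribed are the coefficients themselves, so the relation becomes a vanishing sum
  -- of squares.
  obtain ⟨B, hB⟩ := hb j fun i i' =>
    if hh : i < i' ∧ ¬(j.val = 5 ∧ i.val = 2) then
      c ⟨(Fin.castLE j.2.le i, Fin.castLE j.2.le i', j), hh.1, i'.2, hh.2⟩ else 0
  have hval : ∀ a : Trip p, a.1.2.2 = j →
      sig (κ (0, B)) (b (Sum.inl a.1.1)).1 (b (Sum.inl a.1.2.1)).1 = c a := by
    rintro ⟨⟨i, i', j'⟩, hi, hi', hne⟩ hj'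
    obtain rfl : j' = j := hj'
    have h1 := hB ⟨i, hi.trans hi'⟩ ⟨i', hi'⟩ hi hne
    rw [dif_pos ⟨hi, hne⟩] at h1
    exact h1
  have h0 := congrArg (fun L : (C3 × W) × (Fin p → Fin m → ℝ) →L[ℝ] ℝ =>
    L (0, frameDir b j (0, B))) hc
  simp only [_root_.sum_apply, _root_.smul_apply, smul_eq_mul,
    _root_.zero_apply] at h0
  have hterm : ∀ a : Trip p, c a * fderiv ℝ (tripFun b Ω a) (y, 0) (0, frameDir b j (0, B)) =
      if a.1.2.2 = j then c a * c a else 0 := by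
    intro a
    obtain ⟨h1, h2⟩ := fderiv_tripFun hΩ h hφ j B a
    split_ifs with haj
    · rw [h2 haj, hval a haj]
    · rcases lt_or_gt_of_ne haj with hlt | hgt
      · rw [h1 hlt, mul_zero]
      · have : c a = 0 := by
          by_contra hca
          exact absurd (hmax a hca) (not_le.2 hgt)
        rw [this, zero_mul]
  rw [Finset.sum_congr rfl fun a _ => hterm a] at h0
  have h3 := (Finset.sum_eq_zero_iff_of_nonneg fun a _ => by
    split_ifs
    · exact mul_self_nonneg _
    · exact le_rfl).1 h0 a₀ (Finset.mem_univ _)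
  rw [if_pos rfl] at h3
  exact ha₀ (mul_self_eq_zero.1 h3)

/-- Near a plane with an adapted basis, a 3-form that takes the value zero on a vertical vector and
all pairs of vectors, apart from those that begin with the vector `2`, has no such vector. -/
lemma IsModel.eventually_vertical_eq_zero [FiniteDimensional ℝ W]
    {b : Module.Basis (Fin 6 ⊕ Fin m) ℝ (C3 × W)}
    {Ω : C3 × W → (C3 × W) [⋀^Fin 3]→L[ℝ] ℝ} {y : C3 × W} {s : Set (C3 × W)} (hs : s ∈ 𝓝 y)
    (hΩ : ContinuousOn Ω s)
    (h : IsModel (Ω y) κ) {e : Fin 3 → C3} (he : LinearIndependent ℂ e)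
    (hb : ∀ i, (b (Sum.inl i)).1 = adaptedVec e i) :
    ∀ᶠ w : (C3 × W) × (Fin 6 → Fin m → ℝ) in 𝓝 (y, 0), ∀ B : W,
      (∀ i i' : Fin 5, i < i' → i.val ≠ 2 → triLin (Ω w.1) (0, B)
        (graphFrame b w.2 i.castSucc) (graphFrame b w.2 i'.castSucc) = 0) → B = 0 := by
  -- The eight equations, padded by zeros, form a linear map in `B`. The property is its
  -- injectivity, which is open and holds at the adapted frame.
  let T : (C3 × W) × (Fin 6 → Fin m → ℝ) → W →L[ℝ] (Fin 5 × Fin 5 → ℝ) := fun w =>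
    LinearMap.toContinuousLinearMap (LinearMap.pi fun a : Fin 5 × Fin 5 =>
      if a.1 < a.2 ∧ a.1.val ≠ 2 then
        ((triLin (Ω w.1)).flip (graphFrame b w.2 a.1.castSucc)).flip
          (graphFrame b w.2 a.2.castSucc) ∘ₗ LinearMap.inr ℝ C3 W
      else 0)
  have hT : ∀ w B a, T w B a = if a.1 < a.2 ∧ a.1.val ≠ 2 then triLin (Ω w.1) (0, B)
      (graphFrame b w.2 a.1.castSucc) (graphFrame b w.2 a.2.castSucc) else 0 := by
    intro w B a
    change (if a.1 < a.2 ∧ a.1.val ≠ 2 then _ else (0 : W →ₗ[ℝ] ℝ)) B = _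
    split_ifs <;> rfl
  have hTinj : ∀ w, Function.Injective (T w) ↔ ∀ B : W,
      (∀ i i' : Fin 5, i < i' → i.val ≠ 2 → triLin (Ω w.1) (0, B)
        (graphFrame b w.2 i.castSucc) (graphFrame b w.2 i'.castSucc) = 0) → B = 0 := by
    intro w
    rw [injective_iff_map_eq_zero]
    refine forall_congr' fun B => imp_congr_left ?_
    constructor
    · intro h0 i i' hii' hi
      have h1 := congrFun h0 (i, i')
      rwa [hT, if_pos ⟨hii', hi⟩] at h1
    · intro h0
      funext a
      rw [hT]
      split_ifs with ha
      · exact h0 _ _ ha.1 ha.2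
      · rfl
  have hcont : ContinuousAt T (y, 0) := by
    have hcs : ContinuousOn T (s ×ˢ univ) := by
      refine continuousOn_clm_apply.2 fun B => continuousOn_pi.2 fun a => ?_
      simp only [hT]
      split_ifs
      · exact continuousOn_triLin (hΩ.comp continuousOn_fst fun w hw => hw.1) continuousOn_const
          (contDiff_graphFrame (n := 0) b _).continuous.continuousOn
          (contDiff_graphFrame (n := 0) b _).continuous.continuousOn
      · exact continuousOn_const
    exact hcs.continuousAt (prod_mem_nhds hs univ_mem)
  have h0 : Function.Injective (T (y, 0)) := by
    rw [hTinj]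
    intro B hB
    refine h.vertical_eq_zero_of_sig he fun i i' hii' hi => ?_
    have h1 := hB i i' hii' hi
    rw [h.vertical, graphFrame_zero, graphFrame_zero, hb, hb] at h1
    exact h1
  filter_upwards [hcont.eventually_mem (ContinuousLinearMap.isOpen_injective.mem_nhds h0)] with w hw
  exact (hTinj w).1 hw

end Differentials

/-! ### Adapted frames of transverse planes -/

section AdaptedBases

variable {W : Type*} [NormedAddCommGroup W] [NormedSpace ℝ W]
variable {φ : (C3 × W) [⋀^Fin 3]→L[ℝ] ℝ} {κ : C3 × W →ₗ[ℝ] Matrix (Fin 3) (Fin 3) ℂ}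

lemma exists_basis_extend {V : Type*} [AddCommGroup V] [Module ℝ V] [FiniteDimensional ℝ V]
    {p : ℕ} {g : Fin p → V} (hg : LinearIndependent ℝ g) :
    ∃ (m : ℕ) (b : Module.Basis (Fin p ⊕ Fin m) ℝ V), ∀ i, b (Sum.inl i) = g i := by
  let b := Module.Basis.sumExtend hg
  have hfin : Finite (Fin p ⊕ Module.Basis.sumExtendIndex hg) := Module.Finite.finite_basis b
  have hfin' : Finite (Module.Basis.sumExtendIndex hg) :=
    Finite.of_injective (Sum.inr : _ → Fin p ⊕ Module.Basis.sumExtendIndex hg) Sum.inr_injective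
  have : Fintype (Module.Basis.sumExtendIndex hg) := Fintype.ofFinite _
  refine ⟨_, b.reindex (Equiv.sumCongr (Equiv.refl _) (Fintype.equivFin _)), fun i => ?_⟩
  rw [Module.Basis.reindex_apply]
  simp only [b, Module.Basis.sumExtend, Module.Basis.reindex_apply, Module.Basis.extend_apply_self]
  rfl

/-- The first vectors of the frame impose independent conditions on vertical vectors. -/
def PrefixSurj (κ : C3 × W →ₗ[ℝ] Matrix (Fin 3) (Fin 3) ℂ) {p : ℕ} (g : Fin p → C3 × W) : Prop :=
  ∀ j : Fin p, VerticalSurj κ fun i : Fin j => (g (Fin.castLE j.2.le i)).1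

/-- A proper initial segment has at most three vectors, for which real independence suffices. From
`p = 5` on, segments of length four occur and the frame must be adapted. -/
lemma IsModel.prefixSurj_of_le_four (h : IsModel φ κ) {p : ℕ} (hp : p ≤ 4) {g : Fin p → C3 × W}
    (hg : LinearIndependent ℝ fun i => (g i).1) : PrefixSurj κ g := fun j =>
  h.verticalSurj_of_le_three (by have := j.2; omega) (hg.comp _ (Fin.castLE_injective j.2.le))

lemma IsModel.prefixSurj_of_adapted (h : IsModel φ κ) {p : ℕ} (hp : p ≤ 6) {g : Fin p → C3 × W}
    {e : Fin 3 → C3} (he : LinearIndependent ℂ e)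
    (hg : ∀ i, (g i).1 = adaptedVec e (Fin.castLE hp i)) : PrefixSurj κ g := by
  have hli : LinearIndependent ℝ fun i => (g i).1 := by
    simp only [hg]
    exact (linearIndependent_adaptedVec he).comp _ (Fin.castLE_injective hp)
  rintro ⟨j, hj⟩
  have hj' : j ≤ 3 ∨ j = 4 ∨ j = 5 := by omega
  rcases hj' with hj' | rfl | rfl
  · exact h.verticalSurj_of_le_three hj' (hli.comp _ (Fin.castLE_injective hj.le))
  · simp only [hg]
    exact h.verticalSurj_four he
  · simp only [hg]
    exact h.verticalSurj_five he

lemma linearIndependent_single : LinearIndependent ℂ fun i : Fin 3 => (Pi.single i 1 : C3) := by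
  have := (Pi.basisFun ℂ (Fin 3)).linearIndependent
  convert this using 1
  ext i : 1
  simp

/-- Every integral element has an adapted frame. -/
lemma IsModel.exists_prefixSurj_frame [FiniteDimensional ℝ W] (h : IsModel φ κ) {p : ℕ}
    (hp6 : p ≤ 6) {E : Submodule ℝ (C3 × W)} (hE : InjOn Prod.fst (E : Set (C3 × W)))
    (hp : Module.finrank ℝ E = p) :
    ∃ g : Fin p → C3 × W, LinearIndependent ℝ (fun i => (g i).1) ∧
      Submodule.span ℝ (range g) = E ∧ PrefixSurj κ g ∧
      (p = 6 → ∃ e : Fin 3 → C3, LinearIndependent ℂ e ∧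
        ∀ i, (g i).1 = adaptedVec e (Fin.castLE hp6 i)) := by
  have hcases : p ≤ 4 ∨ p = 5 ∨ p = 6 := by omega
  rcases hcases with hle | rfl | rfl
  · obtain ⟨g, hli, hs⟩ := exists_frame hp
    rw [← hs] at hE
    have hfst := linearIndependent_fst hli hE
    exact ⟨g, hfst, hs, h.prefixSurj_of_le_four hle hfst, fun h6 => by omega⟩
  · obtain ⟨e, g, he, hg, hli, hs⟩ := exists_adapted_frame_five hE hp
    rw [← hs] at hE
    exact ⟨g, linearIndependent_fst hli hE, hs, h.prefixSurj_of_adapted hp6 he hg,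
      fun h6 => by omega⟩
  -- A transverse 6-plane projects onto `ℂ³`, so any complex basis can be lifted; the standard one
  -- is used.
  · have htop : E.map (LinearMap.fst ℝ C3 W) = ⊤ := by
      refine Submodule.eq_top_of_finrank_eq ?_
      rw [finrank_map_fst hE, hp, finrank_C3]
    have he := linearIndependent_single
    obtain ⟨g, hgE, hg⟩ := exists_lift (E := E) (adaptedVec fun i => Pi.single i 1) fun i => by
      rw [htop]; trivial
    have hfst : LinearIndependent ℝ fun i => (g i).1 := by
      simp only [hg]
      exact linearIndependent_adaptedVec he
    exact ⟨g, hfst, span_eq_of_card_eq (linearIndependent_of_fst hfst) hgE (by simpa using hp),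
      h.prefixSurj_of_adapted hp6 he hg, fun _ => ⟨_, he, hg⟩⟩

lemma IsModel.exists_prefixSurj_basis [FiniteDimensional ℝ W] (h : IsModel φ κ) {p : ℕ}
    (hp6 : p ≤ 6) {E : Submodule ℝ (C3 × W)} (hE : InjOn Prod.fst (E : Set (C3 × W)))
    (hp : Module.finrank ℝ E = p) :
    ∃ (m : ℕ) (b : Module.Basis (Fin p ⊕ Fin m) ℝ (C3 × W)),
      Submodule.span ℝ (range fun i => b (Sum.inl i)) = E ∧ PrefixSurj κ (fun i => b (Sum.inl i)) ∧
      (p = 6 → ∃ e : Fin 3 → C3, LinearIndependent ℂ e ∧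
        ∀ i, (b (Sum.inl i)).1 = adaptedVec e (Fin.castLE hp6 i)) := by
  obtain ⟨g, hgf, hgs, hpre, hsix⟩ := h.exists_prefixSurj_frame hp6 hE hp
  have hli : LinearIndependent ℝ g := linearIndependent_of_fst hgf
  obtain ⟨m, b, hb⟩ : ∃ (m : ℕ) (b : Module.Basis (Fin p ⊕ Fin m) ℝ (C3 × W)),
      ∀ i, b (Sum.inl i) = g i := exists_basis_extend hli
  have hb' : (fun i => b (Sum.inl i)) = g := funext hb
  refine ⟨m, b, ?_, ?_, fun h6 => ?_⟩
  · rw [hb']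
    exact hgs
  · rw [hb']
    exact hpre
  · obtain ⟨e, he, hge⟩ := hsix h6
    exact ⟨e, he, fun i => by rw [hb]; exact hge i⟩

end AdaptedBases

/-! ### From test functions to ordinary elements -/

section TestForms

variable {V : Type*} [NormedAddCommGroup V] [NormedSpace ℝ V] [FiniteDimensional ℝ V]
variable {N : Type*} [TopologicalSpace N] [T2Space N] [ChartedSpace V N] [IsManifold 𝓘(ℝ, V) ∞ N]

lemma Trip.injective {p : ℕ} (a : Trip p) : Function.Injective ![a.1.1, a.1.2.1, a.1.2.2] := by
  have h1 : a.1.1 < a.1.2.1 := a.2.1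
  have h2 : a.1.2.1 < a.1.2.2 := a.2.2.1
  have h3 : StrictMono ![a.1.1, a.1.2.1, a.1.2.2] := by
    refine Fin.strictMono_iff_lt_succ.2 fun i => ?_
    fin_cases i
    exacts [h1, h2]
  exact h3.injective

lemma exists_graphFun_eq_tripFun (θ : DForm V N 3) (x₀ : N) {p m : ℕ}
    (b : Module.Basis (Fin p ⊕ Fin m) ℝ V) (a : Trip p) :
    ∃ ψ ∈ principalIdeal θ p, ∃ s : ℝ, s ≠ 0 ∧
      graphFun b x₀ ψ =ᶠ[𝓝 (chartAt V x₀ x₀, 0)] s • tripFun b (chartRep θ x₀) a := by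
  obtain ⟨ψ, hψ, s, hs, hev⟩ := exists_graphFun_eq θ x₀ b a.injective
  refine ⟨ψ, hψ, s, hs, ?_⟩
  have h1 : ∀ᶠ w : V × (Fin p → Fin m → ℝ) in 𝓝 (chartAt V x₀ x₀, 0), ∀ A,
      graphFun b x₀ ψ (w.1, A) =
        s * chartRep θ x₀ w.1 fun l => graphFrame b A (![a.1.1, a.1.2.1, a.1.2.2] l) :=
    (continuous_fst.continuousAt (x := (chartAt V x₀ x₀, (0 : Fin p → Fin m → ℝ)))).eventually hev
  refine h1.mono fun w hw => (hw w.2).trans ?_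
  refine congrArg (fun v => s * chartRep θ x₀ w.1 v) (funext fun l => ?_)
  fin_cases l <;> rfl

/-- Criterion for an integral element of the ideal generated by a 3-form to be ordinary. -/
lemma isOrdinary_of_tripFun {θ : DForm V N 3} (hθ : IsSmoothForm θ) {p m : ℕ}
    {E : TangentPlane V N p} (hE : E ∈ integralElements (principalIdeal θ) p)
    (b : Module.Basis (Fin p ⊕ Fin m) ℝ V)
    (hb : Submodule.span ℝ (range fun i => b (Sum.inl i)) = chartPlane E)
    (hLI : LinearIndependent ℝ fun a : Trip p =>
      fderiv ℝ (tripFun b (chartRep θ E.base) a) (chartAt V E.base E.base, 0))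
    (hzero : ∀ᶠ w : V × (Fin p → Fin m → ℝ) in 𝓝 (chartAt V E.base E.base, 0),
      (∀ a, tripFun b (chartRep θ E.base) a w = 0) →
        VanishesOn (chartRep θ E.base w.1) (Submodule.span ℝ (range (graphFrame b w.2)))) :
    IsOrdinary (principalIdeal θ) E := by
  obtain ⟨x₀, hx₀⟩ : ∃ x₀, x₀ = E.base := ⟨_, rfl⟩
  have hyt : chartAt V x₀ x₀ ∈ (chartAt V x₀).target :=
    (chartAt V x₀).map_source (mem_chart_source V x₀)
  have hyn := (chartAt V x₀).open_target.mem_nhds hyt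
  have hΩ : ContDiffAt ℝ 1 (chartRep θ x₀) (chartAt V x₀ x₀) :=
    ((hθ x₀).contDiffAt hyn).of_le (by norm_cast)
  have hF := fun a : Trip p => contDiffAt_tripFun b a (w := (chartAt V x₀ x₀, 0)) hΩ
  rw [← hx₀] at hLI hzero
  choose ψ hψ s hs hev using exists_graphFun_eq_tripFun θ x₀ b
  have hLI0 : LinearIndependent ℝ fun a : Trip p =>
      fderiv ℝ (s a • tripFun b (chartRep θ x₀) a) (chartAt V x₀ x₀, 0) := by
    -- The graph functions are nonzero constant multiples of the test functions, which preserves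
    -- independence of the differentials.
    have h1 := hLI.units_smul fun a => Units.mk0 (s a) (hs a)
    convert h1 using 1
    ext1 a
    exact fderiv_const_smul ((hF a).differentiableAt one_ne_zero) (s a)
  have hLI1 := eventually_linearIndependent_fderiv (fun a => (hF a).const_smul (s a)) hLI0
  have hall : ∀ᶠ w : V × (Fin p → Fin m → ℝ) in 𝓝 (chartAt V x₀ x₀, 0),
      w.1 ∈ (chartAt V x₀).target ∧
      (LinearIndependent ℝ fun a => fderiv ℝ (graphFun b x₀ (ψ a)) w) ∧
      (∀ a, graphFun b x₀ (ψ a) w = s a • tripFun b (chartRep θ x₀) a w) ∧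
      ((∀ a, tripFun b (chartRep θ x₀) a w = 0) →
        VanishesOn (chartRep θ x₀ w.1) (Submodule.span ℝ (range (graphFrame b w.2)))) := by
    have h1 : ∀ᶠ w : V × (Fin p → Fin m → ℝ) in 𝓝 (chartAt V x₀ x₀, 0),
        w.1 ∈ (chartAt V x₀).target := continuousAt_fst.eventually hyn
    have h2 := eventually_all.2 fun a => (hev a).fderiv (𝕜 := ℝ)
    have h3 := eventually_all.2 hev
    filter_upwards [h1, h2, h3, hLI1, hzero] with w hw1 hw2 hw3 hw4 hw5
    refine ⟨hw1, ?_, hw3, hw5⟩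
    simp only [hw2]
    exact hw4
  obtain ⟨S, hS, hSo, hS0⟩ := eventually_nhds_iff.1 hall
  let q := Fintype.equivFin (Trip p)
  subst hx₀
  refine ⟨hE, m, b, _, fun i => ψ (q.symm i), S, fun v => ?_, fun i => hψ _, hSo, hS0,
    fun w hw => (hS w hw).1, fun w hw => (hS w hw).2.1.comp _ q.symm.injective, fun w hw => ?_⟩
  · rw [hb]
    exact (chartPush_mem_chartPlane E v).symm
  · obtain ⟨-, -, hw3, hw4⟩ := hS w hw
    refine (isIntegral_span_chartFrame θ E.base w.1 (graphFrame b w.2)).trans ?_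
    have hz : (∀ i, graphFun b E.base (ψ (q.symm i)) w = 0) ↔
        ∀ a, tripFun b (chartRep θ E.base) a w = 0 := by
      rw [q.symm.forall_congr_left]
      simp only [hw3, smul_eq_zero, hs, false_or, Equiv.symm_symm, Equiv.symm_apply_apply]
    rw [hz]
    exact ⟨fun h a => h _ (Submodule.subset_span ⟨_, rfl⟩) _ (Submodule.subset_span ⟨_, rfl⟩) _
      (Submodule.subset_span ⟨_, rfl⟩), hw4⟩

end TestForms

/-! ### Every transverse integral element is ordinary -/

section Ordinary

variable {M : Type*} [TopologicalSpace M] [ChartedSpace C3 M] [IsManifold 𝓘(ℂ, C3) ω M]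
variable {Υ : HolVolumeForm M}

lemma isSmoothForm_dBeta (Υ : HolVolumeForm M) : IsSmoothForm (dForm (betaForm Υ)) :=
  isSmoothForm_dForm (isSmoothForm_betaForm Υ)

lemma chartPlane_of_mem_transverseElements {p : ℕ} {E : TangentPlane KModel (SU3Bundle Υ) p}
    (hE : E ∈ transverseElements Υ p) :
    VanishesOn (chartRep (dForm (betaForm Υ)) E.base (chartAt KModel E.base E.base))
      (chartPlane E) ∧ InjOn Prod.fst (chartPlane E : Set KModel) := by
  obtain ⟨g, hg, hs⟩ := exists_frame (finrank_chartPlane E)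
  obtain ⟨w, hw, hwE⟩ := exists_planeOfFrame_eq E hg hs
  have h1 : planeOfFrame E.base w ∈ transverseElements Υ p := hwE.symm ▸ hE
  have h2 := (mem_transverseElements_planeOfFrame E.base w).1 h1
  rw [hw] at h2
  exact hs ▸ h2

/-- For `p ≤ 5` no triple is omitted. For `p = 6` the redundancy argument is run at each nearby
frame, which need not be adapted; only injectivity of the eight conditions and independence of the
horizontal parts have to persist. -/
lemma eventually_vanishesOn_of_tripFun (k : SU3Bundle Υ) {y : KModel}
    (hy : y ∈ (chartAt KModel k).target) {p m : ℕ} (hp6 : p ≤ 6)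
    (b : Module.Basis (Fin p ⊕ Fin m) ℝ KModel)
    (hsix : p = 6 → ∃ e : Fin 3 → C3, LinearIndependent ℂ e ∧
        ∀ i, (b (Sum.inl i)).1 = adaptedVec e (Fin.castLE hp6 i)) :
    ∀ᶠ w : KModel × (Fin p → Fin m → ℝ) in 𝓝 (y, 0),
      (∀ a, tripFun b (chartRep (dForm (betaForm Υ)) k) a w = 0) →
        VanishesOn (chartRep (dForm (betaForm Υ)) k w.1)
          (Submodule.span ℝ (range (graphFrame b w.2))) := by
  have hcases : p ≤ 5 ∨ p = 6 := by omega
  rcases hcases with h5 | rfl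
  · exact Eventually.of_forall fun w => (vanishesOn_span_iff_trip h5 _ _).2
  · obtain ⟨e, he, hge⟩ := hsix rfl
    have hyn := (chartAt KModel k).open_target.mem_nhds hy
    have h1 := (isModel_dBeta Υ k hy).eventually_vertical_eq_zero (m := m) hyn
      (isSmoothForm_dBeta Υ k).continuousOn he hge
    have h2 : ∀ᶠ w : KModel × (Fin 6 → Fin m → ℝ) in 𝓝 (y, 0),
        w.1 ∈ (chartAt KModel k).target := continuousAt_fst.eventually hyn
    have h3 : ∀ᶠ w : KModel × (Fin 6 → Fin m → ℝ) in 𝓝 (y, 0),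
        LinearIndependent ℝ fun i => (graphFrame b w.2 i).1 := by
      have hc : Continuous fun (w : KModel × (Fin 6 → Fin m → ℝ)) i => (graphFrame b w.2 i).1 :=
        continuous_pi fun i => continuous_fst.comp (contDiff_graphFrame (n := 0) b i).continuous
      refine hc.continuousAt.eventually_mem (isOpen_setOfPred_linearIndependent.mem_nhds ?_)
      simp only [graphFrame_zero, mem_ofPred_eq, hge]
      exact linearIndependent_adaptedVec he
    filter_upwards [h1, h2, h3] with w hw1 hw2 hw3
    exact ((isModel_dBeta Υ k hw2).vanishesOn_span_iff_trip_six hw3 hw1).2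

lemma isOrdinary_of_mem_transverseElements [T2Space M] {p : ℕ} (hp6 : p ≤ 6)
    {E : TangentPlane KModel (SU3Bundle Υ) p} (hE : E ∈ transverseElements Υ p) :
    IsOrdinary (idealK Υ) E := by
  have hyt := (chartAt KModel E.base).map_source (mem_chart_source KModel E.base)
  have hyn := (chartAt KModel E.base).open_target.mem_nhds hyt
  have hΩ : ContDiffAt ℝ 1 (chartRep (dForm (betaForm Υ)) E.base) (chartAt KModel E.base E.base) :=
    ((isSmoothForm_dBeta Υ E.base).contDiffAt hyn).of_le (by norm_cast)
  have hmod := isModel_dBeta Υ E.base hyt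
  obtain ⟨hvan, hinj⟩ := chartPlane_of_mem_transverseElements hE
  obtain ⟨m, b, hb, hpre, hsix⟩ := hmod.exists_prefixSurj_basis hp6 hinj (finrank_chartPlane E)
  rw [← hb] at hvan
  exact isOrdinary_of_tripFun (isSmoothForm_dBeta Υ) hE.1 b hb
    (linearIndependent_fderiv_tripFun hΩ hmod hvan hpre)
    (eventually_vanishesOn_of_tripFun E.base hyt hp6 b hsix)

end Ordinary

/-! ### Lifting horizontal frames to integral frames -/

section Submersion

variable {W : Type*} [NormedAddCommGroup W] [NormedSpace ℝ W]
variable {φ : (C3 × W) [⋀^Fin 3]→L[ℝ] ℝ} {κ : C3 × W →ₗ[ℝ] Matrix (Fin 3) (Fin 3) ℂ} {p : ℕ}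

/-- The value of a 3-form on a triple of vectors of a frame. -/
def tripVal {V : Type*} [AddCommGroup V] [Module ℝ V] [TopologicalSpace V]
    (φ : V [⋀^Fin 3]→L[ℝ] ℝ) (a : Trip p) (g : Fin p → V) : ℝ :=
  triLin φ (g a.1.1) (g a.1.2.1) (g a.1.2.2)

lemma contDiff_tripVal {V : Type*} [NormedAddCommGroup V] [NormedSpace ℝ V] {n : WithTop ℕ∞}
    (φ : V [⋀^Fin 3]→L[ℝ] ℝ) (a : Trip p) : ContDiff ℝ n (tripVal φ a) :=
  contDiff_iff_contDiffAt.2 fun _ => contDiffAt_triLin contDiffAt_const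
    (contDiff_apply ℝ V _).contDiffAt (contDiff_apply ℝ V _).contDiffAt
    (contDiff_apply ℝ V _).contDiffAt

lemma IsModel.fderiv_tripVal (h : IsModel φ κ) (g : Fin p → C3 × W) (j : Fin p) (B : W)
    (a : Trip p) :
    (a.1.2.2 < j → fderiv ℝ (tripVal φ a) g (Pi.single j (0, B)) = 0) ∧
    (a.1.2.2 = j → fderiv ℝ (tripVal φ a) g (Pi.single j (0, B)) =
      sig (κ (0, B)) (g a.1.1).1 (g a.1.2.1).1) := by
  have hd : DifferentiableAt ℝ (tripVal φ a) g :=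
    (contDiff_tripVal (n := 1) φ a).contDiffAt.differentiableAt one_ne_zero
  obtain ⟨⟨i, i', j'⟩, hi, hi', hij⟩ := a
  have hne : ∀ (t : ℝ) (i : Fin p), i ≠ j →
      (g + t • (Pi.single j (0, B) : Fin p → C3 × W)) i = g i := fun t i hij => by simp [hij]
  constructor
  · intro hj
    have hj : j' < j := hj
    refine fderiv_apply_eq_of_affine hd fun t => ?_
    rw [tripVal, tripVal, hne t _ (hi.trans (hi'.trans hj)).ne, hne t _ (hi'.trans hj).ne,
      hne t _ hj.ne, mul_zero, add_zero]
  · intro hj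
    obtain rfl : j' = j := hj
    have heq : ∀ t : ℝ, (g + t • (Pi.single j' (0, B) : Fin p → C3 × W)) j' =
        g j' + t • ((0 : C3), B) := fun t => by simp
    refine fderiv_apply_eq_of_affine hd fun t => ?_
    rw [tripVal, tripVal, hne t _ (hi.trans hi').ne, hne t _ hi'.ne, heq, map_add, map_smul,
      smul_eq_mul, triLin_cycle φ (0, B), h.vertical]

/-- The same triangular argument as for the graph functions, in dual form: independence of the
differentials restricted to vertical motions makes these motions attain all values. -/
lemma IsModel.exists_vertical_fderiv_tripVal (h : IsModel φ κ) {g : Fin p → C3 × W}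
    (hg : PrefixSurj κ g) (d : Trip p → ℝ) :
    ∃ B : Fin p → W, ∀ a, fderiv ℝ (tripVal φ a) g (fun i => (0, B i)) = d a := by
  let L : (Fin p → W) →ₗ[ℝ] Trip p → ℝ := LinearMap.pi fun a =>
    (fderiv ℝ (tripVal φ a) g : (Fin p → C3 × W) →ₗ[ℝ] ℝ) ∘ₗ
      LinearMap.pi fun i => LinearMap.inr ℝ C3 W ∘ₗ LinearMap.proj i
  have hLs : ∀ j B a, L (Pi.single j B) a = fderiv ℝ (tripVal φ a) g (Pi.single j (0, B)) := by
    intro j B a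
    refine congrArg (fderiv ℝ (tripVal φ a) g) (funext fun i => ?_)
    by_cases hij : i = j
    · subst hij; simp
    · simp [hij]
  suffices hL : Function.Surjective L by
    obtain ⟨B, hB⟩ := hL d
    exact ⟨B, fun a => congrFun hB a⟩
  refine surjective_of_forall_sum_eq_zero L fun c hc => ?_
  by_contra hne
  obtain ⟨a₁, ha₁⟩ := Function.ne_iff.1 hne
  obtain ⟨a₀, ha₀, hmax⟩ := Finset.exists_max_image (Finset.univ.filter fun a => c a ≠ 0)
    (fun a => a.1.2.2) ⟨a₁, by simpa using ha₁⟩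
  replace ha₀ : c a₀ ≠ 0 := by simpa using ha₀
  replace hmax : ∀ a, c a ≠ 0 → a.1.2.2 ≤ a₀.1.2.2 := fun a ha => hmax a (by simpa using ha)
  set j := a₀.1.2.2 with hj
  obtain ⟨B, hB⟩ := hg j fun i i' =>
    if hh : i < i' ∧ ¬(j.val = 5 ∧ i.val = 2) then
      c ⟨(Fin.castLE j.2.le i, Fin.castLE j.2.le i', j), hh.1, i'.2, hh.2⟩ else 0
  have hval : ∀ a : Trip p, a.1.2.2 = j → sig (κ (0, B)) (g a.1.1).1 (g a.1.2.1).1 = c a := by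
    rintro ⟨⟨i, i', j'⟩, hi, hi', hne⟩ hj'
    obtain rfl : j' = j := hj'
    have h1 := hB ⟨i, hi.trans hi'⟩ ⟨i', hi'⟩ hi hne
    rw [dif_pos ⟨hi, hne⟩] at h1
    exact h1
  have hterm : ∀ a : Trip p, c a * L (Pi.single j B) a =
      if a.1.2.2 = j then c a * c a else 0 := by
    intro a
    obtain ⟨h1, h2⟩ := h.fderiv_tripVal g j B a
    rw [hLs]
    split_ifs with haj
    · rw [h2 haj, hval a haj]
    · rcases lt_or_gt_of_ne haj with hlt | hgt
      · rw [h1 hlt, mul_zero]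
      · have : c a = 0 := by
          by_contra hca
          exact absurd (hmax a hca) (not_le.2 hgt)
        rw [this, zero_mul]
  have h0 := hc (Pi.single j B)
  rw [Finset.sum_congr rfl fun a _ => hterm a] at h0
  have h3 := (Finset.sum_eq_zero_iff_of_nonneg fun a _ => by
    split_ifs
    · exact mul_self_nonneg _
    · exact le_rfl).1 h0 a₀ (Finset.mem_univ _)
  rw [if_pos rfl] at h3
  exact ha₀ (mul_self_eq_zero.1 h3)

/-- Near a frame on which the 3-form vanishes, each horizontal perturbation of the frame lifts to a
frame on which the 3-form vanishes. -/
lemma IsModel.eventually_exists_lift [FiniteDimensional ℝ W] (h : IsModel φ κ)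
    {g : Fin p → C3 × W} (hg : PrefixSurj κ g) (hφ : ∀ a : Trip p, tripVal φ a g = 0)
    {U : Set (Fin p → C3 × W)} (hU : U ∈ 𝓝 g) :
    ∀ᶠ X : Fin p → C3 in 𝓝 fun i => (g i).1,
      ∃ g' ∈ U, (∀ a : Trip p, tripVal φ a g' = 0) ∧ ∀ i, (g' i).1 = X i := by
  let P : (Fin p → C3 × W) →L[ℝ] Fin p → C3 :=
    ContinuousLinearMap.pi fun i => ContinuousLinearMap.fst ℝ C3 W ∘L ContinuousLinearMap.proj i
  let D : (Fin p → C3 × W) →L[ℝ] Trip p → ℝ :=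
    ContinuousLinearMap.pi fun a => fderiv ℝ (tripVal φ a) g
  let F : (Fin p → C3 × W) → (Fin p → C3) × (Trip p → ℝ) := fun g => (P g, fun a => tripVal φ a g)
  have hF : HasStrictFDerivAt F (P.prod D) g :=
    P.hasStrictFDerivAt.prodMk (hasStrictFDerivAt_pi'.2 fun a =>
      (contDiff_tripVal (n := 1) φ a).contDiffAt.hasStrictFDerivAt one_ne_zero)
  have hsurj : Function.Surjective (P.prod D) := by
    rintro ⟨X, d⟩
    -- A vertical motion corrects the change of the test values caused by the horizontal motion `X`,
    -- without altering the horizontal parts.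
    obtain ⟨B, hB⟩ := h.exists_vertical_fderiv_tripVal hg
      (d - D fun i => (X i, 0))
    refine ⟨(fun i => (X i, 0)) + fun i => (0, B i), Prod.ext ?_ ?_⟩
    · funext i
      change X i + 0 = X i
      rw [add_zero]
    · funext a
      change D (_ + _) a = d a
      rw [map_add, Pi.add_apply]
      change _ + fderiv ℝ (tripVal φ a) g (fun i => (0, B i)) = _
      rw [hB, Pi.sub_apply]
      ring
  have hmap := hF.map_nhds_eq_of_surj (LinearMap.range_eq_top.2 hsurj)
  -- A submersion is open, so the image contains every pair of a nearby horizontal frame and test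
  -- values zero.
  have hFU : F '' U ∈ 𝓝 (F g) := hmap ▸ image_mem_map hU
  have hFg : F g = (fun i => (g i).1, 0) := Prod.ext rfl (funext hφ)
  rw [hFg] at hFU
  have hcont : ContinuousAt (fun X : Fin p → C3 => (X, (0 : Trip p → ℝ))) fun i => (g i).1 := by
    fun_prop
  filter_upwards [hcont.preimage_mem_nhds hFU] with X hX
  obtain ⟨g', hg', hX'⟩ := hX
  exact ⟨g', hg', fun a => congrFun (congrArg Prod.snd hX') a,
    fun i => congrFun (congrArg Prod.fst hX') i⟩

end Submersion

/-! ### Genericity of horizontal frames -/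

section GenericFrames

variable {W : Type*} [NormedAddCommGroup W] [NormedSpace ℝ W]
variable {φ : (C3 × W) [⋀^Fin 3]→L[ℝ] ℝ} {κ : C3 × W →ₗ[ℝ] Matrix (Fin 3) (Fin 3) ℂ}

lemma contDiff_sig {X : Type*} [NormedAddCommGroup X] [NormedSpace ℝ X] {n : WithTop ℕ∞}
    (B : Matrix (Fin 3) (Fin 3) ℂ) {u v : X → C3} (hu : ContDiff ℝ n u) (hv : ContDiff ℝ n v) :
    ContDiff ℝ n fun x => sig B (u x) (v x) := by
  have hu' : ∀ i, ContDiff ℝ n fun x => star (u x i) := fun i =>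
    Complex.conjCLE.contDiff.comp (contDiff_pi.1 hu i)
  have h : ContDiff ℝ n fun x => sesq B (u x) (v x) := by
    simp only [sesq, dotProduct, Matrix.mulVec, Pi.star_apply]
    exact ContDiff.sum fun i _ => (hu' i).mul (ContDiff.sum fun l _ =>
      contDiff_const.mul (contDiff_pi.1 hv l))
  exact Complex.imCLM.contDiff.comp h

/-- For generic vectors, the values of the forms of vertical vectors can be prescribed. -/
lemma dense_verticalSurj {j : ℕ} {X₀ : Fin j → C3} (hX₀ : VerticalSurj κ X₀) (hj : j ≠ 5) :
    Dense {X : Fin j → C3 | VerticalSurj κ X} := by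
  -- Vertical vectors dual to the pairs of `X₀`, so that `A X₀` is the identity matrix. Wherever `A
  -- X` is invertible, combinations of these same vectors solve the problem for `X`.
  choose w hw using fun a : IncPair j => hX₀ fun i i' => if a.1 = (i, i') then 1 else 0
  let A : (Fin j → C3) → Matrix (IncPair j) (IncPair j) ℝ := fun X =>
    Matrix.of fun b a => sig (κ (0, w a)) (X b.1.1) (X b.1.2)
  have hA : ContDiff ℝ ω fun X => (A X).det := by
    simp only [Matrix.det_apply]
    exact ContDiff.sum fun σ _ => (contDiff_prod fun a _ => contDiff_sig _
      (contDiff_apply ℝ C3 _) (contDiff_apply ℝ C3 _)).const_smul _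
  have hA₀ : (A X₀).det ≠ 0 := by
    have : A X₀ = 1 := by
      ext b a
      change sig _ _ _ = _
      rw [hw a _ _ b.2 fun hh => hj hh.1, Matrix.one_apply]
      exact if_congr (by rw [Prod.mk.eta, Subtype.ext_iff, eq_comm]) rfl rfl
    rw [this, Matrix.det_one]
    exact one_ne_zero
  have hsub : {X | (A X).det ≠ 0} ⊆ {X : Fin j → C3 | VerticalSurj κ X} := by
    intro X hX d
    have hunit : IsUnit (A X).det := isUnit_iff_ne_zero.2 hX
    let c : IncPair j → ℝ := (A X)⁻¹ *ᵥ fun b => d b.1.1 b.1.2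
    have hc : A X *ᵥ c = fun b => d b.1.1 b.1.2 := by
      rw [Matrix.mulVec_mulVec, Matrix.mul_nonsing_inv _ hunit, Matrix.one_mulVec]
    refine ⟨∑ a, c a • w a, fun i i' hii' _ => ?_⟩
    have h1 := congrFun hc ⟨(i, i'), hii'⟩
    have h2 : ∀ s : Finset (IncPair j), sig (κ (0, ∑ a ∈ s, c a • w a)) (X i) (X i') =
        ∑ a ∈ s, c a * sig (κ (0, w a)) (X i) (X i') := by
      intro s
      induction s using Finset.cons_induction with
      | empty => simpa using sig_smul_vertical (κ := κ) 0 0 (X i) (X i')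
      | cons a s ha ih =>
        rw [Finset.sum_cons, Finset.sum_cons, sig_add_vertical, sig_smul_vertical, ih]
    rw [h2, ← h1]
    exact Finset.sum_congr rfl fun a _ => mul_comm _ _
  refine Dense.mono hsub fun X => ?_
  by_contra hX
  rw [mem_closure_iff_frequently, not_frequently] at hX
  -- If the set were not dense, the analytic function `det A` would vanish on an open set, hence
  -- everywhere, but it is nonzero at `X₀`.
  have hz : (fun X => (A X).det) =ᶠ[𝓝 X] 0 := hX.mono fun Y hY => not_not.1 hY
  exact hA₀ (hA.analyticOnNhd.eqOn_zero_of_preconnected_of_eventuallyEq_zero isPreconnected_univ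
    (mem_univ X) hz (mem_univ X₀))

lemma IsModel.dense_verticalSurj_four (h : IsModel φ κ) :
    Dense {X : Fin 4 → C3 | VerticalSurj κ X} :=
  dense_verticalSurj (h.verticalSurj_four linearIndependent_single) (by norm_num)

end GenericFrames

/-! ### Dense open sets of generic transverse elements -/

section Density

variable {M : Type*} [TopologicalSpace M] [ChartedSpace C3 M] [IsManifold 𝓘(ℂ, C3) ω M]
variable {Υ : HolVolumeForm M}

/-- The transverse integral elements of dimension 4 whose polar space has the least possible
dimension are dense. -/
lemma dense_polarDim_four :
    Dense {E : transverseElements Υ 4 | polarDim (idealK Υ) E.1 = 8} := by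
  rintro ⟨E, hE⟩
  rw [mem_closure_iff]
  rintro _ ⟨O, hO, rfl⟩ hEO
  obtain ⟨k, ⟨⟨y, g⟩, hy, hg⟩, rfl⟩ := exists_eq_planeOfFrame E
  obtain ⟨hφ, hinj⟩ := (mem_transverseElements_planeOfFrame k _).1 hE
  have h := isModel_dBeta Υ k hy
  have hfst := linearIndependent_fst hg hinj
  have hpre : ContinuousAt (fun g' : Fin 4 → KModel => (y, g')) g := by fun_prop
  obtain ⟨O', hO', hO''⟩ := isOpen_induced_iff.1 (hO.preimage (continuous_planeOfFrame k))
  have hmem : (⟨(y, g), hy, hg⟩ : ChartFrames (V := KModel) (SU3Bundle Υ) 4 k) ∈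
      Subtype.val ⁻¹' O' := hO''.symm ▸ hEO
  have hU1 : ∀ᶠ g' : Fin 4 → KModel in 𝓝 g, (y, g') ∈ O' :=
    hpre.preimage_mem_nhds (hO'.mem_nhds hmem)
  have hcfst : ContinuousAt (fun (g' : Fin 4 → KModel) i => (g' i).1) g :=
    (continuous_pi fun i => continuous_fst.comp (continuous_apply i)).continuousAt
  have hU2 : ∀ᶠ g' : Fin 4 → KModel in 𝓝 g, LinearIndependent ℝ fun i => (g' i).1 :=
    hcfst.preimage_mem_nhds (isOpen_setOfPred_linearIndependent.mem_nhds hfst)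
  -- The base point `y` stays fixed. All horizontal frames near that of `g` lift to integral frames
  -- inside the given neighbourhood, and generic ones occur arbitrarily close, so some `X` has both
  -- properties.
  obtain ⟨X, ⟨g', ⟨hgO, hgli⟩, hg0, hgX⟩, hX⟩ :=
    ((h.eventually_exists_lift (h.prefixSurj_of_le_four le_rfl hfst)
      ((vanishesOn_span_iff_trip (by norm_num) _ _).1 hφ) (hU1.and hU2)).and_frequently
        (mem_closure_iff_frequently.1 (h.dense_verticalSurj_four _))).exists
  obtain rfl : (fun i => (g' i).1) = X := funext hgX
  let w : ChartFrames (V := KModel) (SU3Bundle Υ) 4 k := ⟨(y, g'), hy, linearIndependent_of_fst hgli⟩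
  have hv : VanishesOn (chartRep (dForm (betaForm Υ)) k y) (Submodule.span ℝ (range g')) :=
    (vanishesOn_span_iff_trip (by norm_num) _ _).2 hg0
  have hwO : w ∈ planeOfFrame k ⁻¹' O := hO'' ▸ (show w ∈ Subtype.val ⁻¹' O' from hgO)
  refine ⟨⟨planeOfFrame k w, (mem_transverseElements_planeOfFrame k w).2
    ⟨hv, injOn_fst_span hgli⟩⟩, hwO, ?_⟩
  exact (polarDim_planeOfFrame _ k w hv).trans (h.finrank_polarSpace_four finrank_vertical hX)

/-- Since 8 is a lower bound on transverse elements, equality is the open condition that the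
dimension be at most 8. -/
lemma isOpen_polarDim_four :
    IsOpen {E : transverseElements Υ 4 | polarDim (idealK Υ) E.1 = 8} := by
  have h := (isOpen_finrank_polarSpace_plane_le (isSmoothForm_dBeta Υ) 4 8).preimage
    (continuous_subtype_val (p := fun E => E ∈ transverseElements Υ 4))
  convert h using 1
  ext E
  have h1 := polarDim_eq_finrank (dForm (betaForm Υ)) E.2.1
  have h2 : 8 ≤ polarDim (idealK Υ) E.1 := (polarDim_transverse (p := 4) E.2).1
  change _ = 8 ↔ _ ≤ 8
  rw [← h1]
  exact ⟨fun h => h.le, fun h => le_antisymm h h2⟩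

lemma exists_isOpen_dense_polarDim (Υ : HolVolumeForm M) (p : Fin 7) :
    ∃ D : Set (transverseElements Υ p), IsOpen D ∧ Dense D ∧
      ∀ E ∈ D, polarDim (idealK Υ) E.1 = polarDims p := by
  by_cases hp : p = 4
  · subst hp
    exact ⟨_, isOpen_polarDim_four, dense_polarDim_four, fun E hE => hE⟩
  · exact ⟨univ, isOpen_univ, dense_univ, fun E _ => (polarDim_transverse E.2).2 hp⟩

end Density

end EDS

end

theorem proposition2 {M : Type*} [TopologicalSpace M] [T2Space M] [ChartedSpace EDS.C3 M]
    [IsManifold 𝓘(ℂ, EDS.C3) ω M] (Υ : EDS.HolVolumeForm M)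
    (p : Fin 7) (m : Fin 7 → ℕ) (hm : m = ![14, 14, 13, 11, 8, 6, 6]) :
    (∀ E ∈ EDS.transverseElements Υ p, m p ≤ EDS.polarDim (EDS.idealK Υ) E) ∧
    (p ≠ 3 → p ≠ 4 →
      ∀ E ∈ EDS.transverseElements Υ p, EDS.polarDim (EDS.idealK Υ) E = m p) ∧
    (∃ D : Set (EDS.transverseElements Υ p), IsOpen D ∧ Dense D ∧
      ∀ E ∈ D, EDS.polarDim (EDS.idealK Υ) E.1 = m p) ∧
    (∀ E ∈ EDS.transverseElements Υ p, EDS.polarDim (EDS.idealK Υ) E = m p →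
      EDS.IsRegular (EDS.idealK Υ) E) := by
  subst hm
  refine ⟨fun E hE => (EDS.polarDim_transverse hE).1,
    fun _ hp E hE => (EDS.polarDim_transverse hE).2 hp,
    EDS.exists_isOpen_dense_polarDim Υ p, fun E hE h =>
      ⟨EDS.isOrdinary_of_mem_transverseElements (by omega) hE,
        EDS.eventually_extensionRank_eq hE h⟩⟩
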